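/- All digraphs are finite and have neither loops nor parallel arcs (2-cycles are allowed). For a digraph $D=(V,A)$ and $U\subseteq V$, let $D[U]$ be the subdigraph induced by $U$ and let $\delta^-(D)$ be the minimum in-degree of $D$; $D$ is connected if its underlying undirected graph is connected. (The digraph without vertices counts as connected and as having minimum in-degree at least $1$.) The (connected, $\delta^-\ge 1$)-$[k_1,k_2]$-partition problem asks, for a given digraph $D=(V,A)$ and given natural numbers $k_1,k_2$, whether there is a partition of $V$ into two disjoint (possibly empty) sets $V_1,V_2$ such that $D[V_1]$ is connected, $\delta^-(D[V_2])\ge 1$, and $|V_i|\ge k_i$ for $i=1,2$. **Theorem.** With parameter $k=\max(k_1,k_2)$, this problem is fixed-parameter tractable on digraphs of minimum in-degree at least $1$: there are a single algorithm (a program of a random access machine whose arithmetic operations are $+$ and truncated $-$, each elementary operation costing one step), a computable function $f:\mathbb{N}\to\mathbb{N}$ and a constant $c$ such that, for every digraph $D$ with $\delta^-(D)\ge 1$ and all natural numbers $k_1,k_2$, the algorithm, given $|V|$, $k_1$, $k_2$ and the adjacency matrix of $D$, halts after at most $f(k)\,n^c$ steps, where $n=|V|^2+3$ is the size of this input, and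 correctly decides whether $D$ has such a partition $(V_1,V_2)$. -/

import Mathlib

/-! ## Digraphs -/

namespace Digraph

/-- The subdigraph `D[U]` induced by the vertex set `U`. -/
def induce {V : Type*} (D : Digraph V) (U : Set V) : Digraph U where
  Adj u v := D.Adj u v

/-- The minimum in-degree `δ⁻(D)`. It is an extended natural number, so that the digraph
without vertices satisfies `m ≤ δ⁻(D)` for every `m`, as it has no vertex of smaller in-degree. -/
noncomputable def minInDegree {V : Type*} (D : Digraph V) : ℕ∞ :=
  ⨅ v, {u | D.Adj u v}.encard

/-- `D` is connected if its underlying undirected graph is, that is, if any two vertices are joined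
by a path of that graph. The digraph without vertices counts as connected. -/
def IsConnected {V : Type*} (D : Digraph V) : Prop :=
  D.toSimpleGraphInclusive.Preconnected

/-- `(V₁, V₂)` is a (connected, `δ⁻ ≥ 1`)-`[k₁, k₂]`-partition of `D`. -/
structure IsConnInPartition {V : Type*} [Fintype V] [DecidableEq V] (D : Digraph V) (k₁ k₂ : ℕ)
    (V₁ V₂ : Finset V) : Prop where
  disjoint : Disjoint V₁ V₂
  union_eq : V₁ ∪ V₂ = Finset.univ
  connected : (D.induce (V₁ : Set V)).IsConnected
  one_le_minInDegree : 1 ≤ (D.induce (V₂ : Set V)).minInDegree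
  le_card_left : k₁ ≤ V₁.card
  le_card_right : k₂ ≤ V₂.card

end Digraph

/-! ## A random access machine with a step count

Programs are those of a structured random access machine. Its store consists of natural number
variables and of arrays of natural numbers with indirect addressing; a given program mentions only
finitely many variables and arrays, by name. The only arithmetic operations are `+` and truncated
`-`, and every elementary operation costs one step. There is no multiplication, hence the
bit-length of the numbers in use grows by at most one per step, and step counts agree up to a
polynomial with those of Turing machines. -/

namespace RAM

/-- A store: `s.var x` is the value of the variable `x`, and `s.arr a i` is the entry with index `i`
of the array `a`. -/
@[ext]
structure Store where
  var : ℕ → ℕ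
  arr : ℕ → ℕ → ℕ

/-- Expressions. -/
inductive Expr : Type
  | lit (m : ℕ) : Expr
  | var (x : ℕ) : Expr
  | read (a : ℕ) (i : Expr) : Expr
  | plus (e₁ e₂ : Expr) : Expr
  | minus (e₁ e₂ : Expr) : Expr

/-- The value of an expression. -/
def Expr.eval (s : Store) : Expr → ℕ
  | lit m => m
  | var x => s.var x
  | read a i => s.arr a (i.eval s)
  | plus e₁ e₂ => e₁.eval s + e₂.eval s
  | minus e₁ e₂ => e₁.eval s - e₂.eval s

/-- The number of steps that the evaluation of an expression takes. -/
def Expr.cost : Expr → ℕ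
  | lit _ => 1
  | var _ => 1
  | read _ i => i.cost + 1
  | plus e₁ e₂ => e₁.cost + e₂.cost + 1
  | minus e₁ e₂ => e₁.cost + e₂.cost + 1

/-- Programs. A test succeeds if its value is not `0`. -/
inductive Program : Type
  | skip : Program
  | assign (x : ℕ) (e : Expr) : Program
  | write (a : ℕ) (i e : Expr) : Program
  | seq (p q : Program) : Program
  | ite (e : Expr) (p q : Program) : Program
  | while (e : Expr) (p : Program) : Program

/-- The store after the variable `x` has been given the value `m`. -/
def Store.setVar (s : Store) (x m : ℕ) : Store :=
  { s with var := Function.update s.var x m }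

/-- The store after the entry `i` of the array `a` has been given the value `m`. -/
def Store.setArr (s : Store) (a i m : ℕ) : Store :=
  { s with arr := Function.update s.arr a (Function.update (s.arr a) i m) }

/-- `Exec p s s' t`: the program `p`, started in the store `s`, halts after exactly `t` steps
in the store `s'`. -/
inductive Exec : Program → Store → Store → ℕ → Prop
  | skip (s : Store) : Exec .skip s s 1
  | assign (x : ℕ) (e : Expr) (s : Store) :
      Exec (.assign x e) s (s.setVar x (e.eval s)) (e.cost + 1)
  | write (a : ℕ) (i e : Expr) (s : Store) :
      Exec (.write a i e) s (s.setArr a (i.eval s) (e.eval s)) (i.cost + e.cost + 1)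
  | seq {p q : Program} {s s' s'' : Store} {t t' : ℕ} :
      Exec p s s' t → Exec q s' s'' t' → Exec (.seq p q) s s'' (t + t')
  | ite_true {e : Expr} {p q : Program} {s s' : Store} {t : ℕ} :
      e.eval s ≠ 0 → Exec p s s' t → Exec (.ite e p q) s s' (e.cost + 1 + t)
  | ite_false {e : Expr} {p q : Program} {s s' : Store} {t : ℕ} :
      e.eval s = 0 → Exec q s s' t → Exec (.ite e p q) s s' (e.cost + 1 + t)
  | while_true {e : Expr} {p : Program} {s s' s'' : Store} {t t' : ℕ} :
      e.eval s ≠ 0 → Exec p s s' t → Exec (.while e p) s' s'' t' →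
        Exec (.while e p) s s'' (e.cost + 1 + t + t')
  | while_false {e : Expr} {p : Program} {s : Store} :
      e.eval s = 0 → Exec (.while e p) s s (e.cost + 1)

/-- The outcome and the running time of a program are determined by the initial store. -/
theorem Exec.unique {p : Program} {s s₁ s₂ : Store} {t₁ t₂ : ℕ} (h₁ : Exec p s s₁ t₁)
    (h₂ : Exec p s s₂ t₂) : s₁ = s₂ ∧ t₁ = t₂ := by
  induction h₁ generalizing s₂ t₂ with
  | skip s => cases h₂; exact ⟨rfl, rfl⟩
  | assign x e s => cases h₂; exact ⟨rfl, rfl⟩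
  | write a i e s => cases h₂; exact ⟨rfl, rfl⟩
  | seq _ _ ihp ihq =>
    cases h₂ with
    | seq hp hq =>
      obtain ⟨rfl, rfl⟩ := ihp hp
      obtain ⟨rfl, rfl⟩ := ihq hq
      exact ⟨rfl, rfl⟩
  | ite_true he _ ih =>
    cases h₂ with
    | ite_true _ hp => obtain ⟨rfl, rfl⟩ := ih hp; exact ⟨rfl, rfl⟩
    | ite_false he' _ => exact absurd he' he
  | ite_false he _ ih =>
    cases h₂ with
    | ite_true he' _ => exact absurd he he'
    | ite_false _ hp => obtain ⟨rfl, rfl⟩ := ih hp; exact ⟨rfl, rfl⟩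
  | while_true he _ _ ihp ihw =>
    cases h₂ with
    | while_true _ hp hw =>
      obtain ⟨rfl, rfl⟩ := ihp hp
      obtain ⟨rfl, rfl⟩ := ihw hw
      exact ⟨rfl, rfl⟩
    | while_false he' => exact absurd he' he
  | while_false he =>
    cases h₂ with
    | while_true he' _ _ => exact absurd he he'
    | while_false _ => exact ⟨rfl, rfl⟩

/-- The initial store for the input `w`: array `0` holds `w`, variable `0` holds its length,
and all other entries and variables are `0`. -/
def Store.init (w : List ℕ) : Store where
  var x := if x = 0 then w.length else 0
  arr a i := if a = 0 then w.getD i 0 else 0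

end RAM

/-! ## Parameterized problems -/

/-- A parameterized decision problem: a type of instances, each with its encoding as a list of
numbers, its parameter and the property to be decided. -/
structure ParamProblem where
  Inst : Type
  encode : Inst → List ℕ
  param : Inst → ℕ
  Yes : Inst → Prop

/-- The problem `P` is fixed-parameter tractable on the class `C` of instances: there are one
program, a computable function `f` and a constant `c` such that on every instance in `C` with
parameter `k` and size `n` (the length of the encoding) the program halts within `f k * n ^ c` steps
and answers correctly, its answer being "yes" if variable `0` finally is not `0`. -/
def ParamProblem.IsFPTOn (P : ParamProblem) (C : Set P.Inst) : Prop :=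
  ∃ (p : RAM.Program) (f : ℕ → ℕ) (c : ℕ), Computable f ∧
    ∀ I ∈ C, ∃ (s : RAM.Store) (t : ℕ),
      RAM.Exec p (RAM.Store.init (P.encode I)) s t ∧
      t ≤ f (P.param I) * (P.encode I).length ^ c ∧
      (s.var 0 ≠ 0 ↔ P.Yes I)

/-! ## The (connected, `δ⁻ ≥ 1`)-`[k₁, k₂]`-partition problem -/

/-- An instance: a digraph without loops with vertices `0, …, n - 1`, and two natural numbers. -/
structure PartitionInstance where
  n : ℕ
  D : Digraph (Fin n)
  loopless : ∀ v, ¬ D.Adj v v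
  k₁ : ℕ
  k₂ : ℕ

open Classical in
/-- The encoding of an instance: the numbers `n`, `k₁`, `k₂`, followed by the rows of the adjacency
matrix of the digraph (entry `(u, v)` of the matrix is at position `3 + (u * n + v)`). -/
noncomputable def PartitionInstance.encode (I : PartitionInstance) : List ℕ :=
  I.n :: I.k₁ :: I.k₂ ::
    List.ofFn fun i : Fin (I.n * I.n) => if I.D.Adj i.divNat i.modNat then 1 else 0

/-- The (connected, `δ⁻ ≥ 1`)-`[k₁, k₂]`-partition problem, with parameter `max k₁ k₂`. -/
noncomputable def connInPartitionProblem : ParamProblem where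
  Inst := PartitionInstance
  encode := PartitionInstance.encode
  param I := max I.k₁ I.k₂
  Yes I := ∃ V₁ V₂ : Finset (Fin I.n), I.D.IsConnInPartition I.k₁ I.k₂ V₁ V₂

/-! Since every vertex has an in-neighbour, it suffices to decide whether there is a pair
(`HasPair`): disjoint sets X and Z such that X is connected with at least k₁ vertices and Z has
minimum in-degree at least 1 and at least k₂ vertices. A pair with X ∪ Z as large as possible
already covers V (`exists_isConnInPartition`). If k₁ > 0, one may take |X| = k₁
(`HasPair.exists_ncard_eq`).

Sets of minimum in-degree at least 1 are handled through cores: `core E A l` is what can be reached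
inside A from closed walks in A of length at most l. Every vertex of a core has an in-neighbour in
the core, and for l ≥ |V| the core of A contains every Z ⊆ A of minimum in-degree at least 1.

The search fixes a root r of an unknown X and keeps a set P with r ∈ P ⊆ X, at first {r}. It takes
the least l for which the core of V \ P has at least k₂ vertices, and an inclusion-minimal Y ⊆ V \ P
whose core for this l is still that large. A component of V \ Y with k₁ vertices forms a pair with
Y. Otherwise X meets Y, and the first vertex of Y on a path in X from r is a candidate: it is
adjacent to the component K of r in V \ Y, and deleting it from V \ P leaves a core with at least k₂
vertices (`accepts_or_exists_candidate`). If there are few candidates, the search branches over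
them, adding one to P; as |X| = k₁, this happens fewer than k₁ times.

The heart of the matter is `hasPair_of_many`: more than 2k₂ + 2k₁(4k₁ + 1) candidates imply that a
pair exists. Minimality gives |Y| ≤ k₂ + l (`IsMinimalCore.ncard_le`), so l is large, and then Y is
a cycle of length l none of whose vertices lies on a shorter closed walk of V \ P
(`exists_isShortestCycle`). A candidate x can be avoided, so if all components of V \ Y are small, a
short walk off the cycle bypasses x (`exists_isBypass`). Among 2k₁ candidates far apart on the
cycle, fewer than k₁ have a bypass that meets K. The others together with K form X, and the cycle
rerouted around them gives Z.

On the machine, a sequence of choices is a number written in base M, where M bounds the number of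
candidates. All loops of the search run n or N times, where N is the input length plus 2 ^ 2 ^ (k₁ +
k₂ + 6), which is at least M ^ k₁. With loops nested to a fixed depth the time is polynomial in N +
n, and this splits into a function of k times a power of the input length. -/

/-! ## A small language with bounded loops, compiled to programs of the machine -/

namespace RAM

@[simp] theorem Store.setVar_var (s : Store) (x m y : ℕ) :
    (s.setVar x m).var y = if y = x then m else s.var y := by
  simp [Store.setVar, Function.update_apply]

@[simp] theorem Store.setVar_arr (s : Store) (x m : ℕ) : (s.setVar x m).arr = s.arr := rfl

@[simp] theorem Store.setArr_var (s : Store) (a i m : ℕ) : (s.setArr a i m).var = s.var := rfl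

theorem Store.setArr_arr (s : Store) (a i m b : ℕ) :
    (s.setArr a i m).arr b = if b = a then Function.update (s.arr a) i m else s.arr b := by
  by_cases h : b = a
  · subst h; simp [Store.setArr]
  · simp [Store.setArr, h]

/-- The variable that holds the bound of a loop or sum: variable `1` for `true`, variable `0` for
`false`. -/
def boundVar (b : Bool) : ℕ := if b then 1 else 0

theorem boundVar_lt_two (b : Bool) : boundVar b < 2 := by cases b <;> simp [boundVar]

theorem boundVar_le (b : Bool) (s : Store) : s.var (boundVar b) ≤ s.var 0 + s.var 1 := by
  cases b <;> simp [boundVar]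

/-- The stores `s` and `s'` agree on the first `V` variables and on the first `V` arrays. -/
def Agree (V : ℕ) (s s' : Store) : Prop :=
  (∀ x < V, s.var x = s'.var x) ∧ ∀ a < V, s.arr a = s'.arr a

theorem Agree.setVar {V : ℕ} {s s' : Store} (h : Agree V s s') (x m : ℕ) :
    Agree V (s.setVar x m) (s'.setVar x m) := by
  refine ⟨fun y hy => ?_, fun a ha => by simpa using h.2 a ha⟩
  simp only [Store.setVar_var]
  split
  · rfl
  · exact h.1 y hy

theorem Agree.boundVar {V : ℕ} {s s' : Store} (h : Agree V s s') (hV : 2 ≤ V) (b : Bool) :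
    s.var (boundVar b) = s'.var (boundVar b) :=
  h.1 _ (lt_of_lt_of_le (boundVar_lt_two b) hV)

/-- Terms: expressions with case distinctions and bounded sums. -/
inductive Term : Type
  | lit (m : ℕ) : Term
  | var (x : ℕ) : Term
  | read (a : ℕ) (i : Term) : Term
  | plus (t u : Term) : Term
  | minus (t u : Term) : Term
  | ite (c t u : Term) : Term
  | sum (b : Bool) (x : ℕ) (t : Term) : Term

namespace Term

/-- The value of a term. -/
def eval : Term → Store → ℕ
  | lit m, _ => m
  | var x, s => s.var x
  | read a i, s => s.arr a (i.eval s)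
  | plus t u, s => t.eval s + u.eval s
  | minus t u, s => t.eval s - u.eval s
  | ite c t u, s => if c.eval s ≠ 0 then t.eval s else u.eval s
  | sum b x t, s => ∑ i ∈ Finset.range (s.var (boundVar b)), t.eval (s.setVar x i)

/-- All names are below `V`, and the variables holding bounds are never bound. -/
def Wf (V : ℕ) : Term → Prop
  | lit _ => True
  | var x => x < V
  | read a i => a < V ∧ i.Wf V
  | plus t u => t.Wf V ∧ u.Wf V
  | minus t u => t.Wf V ∧ u.Wf V
  | ite c t u => c.Wf V ∧ t.Wf V ∧ u.Wf V
  | sum _ x t => (2 ≤ x ∧ x < V) ∧ t.Wf V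

/-- A bound on the running time of the compiled term. -/
def cost : Term → ℕ → ℕ
  | lit _, _ => 2
  | var _, _ => 2
  | read _ i, m => i.cost m + 3
  | plus t u, m => t.cost m + u.cost m + 4
  | minus t u, m => t.cost m + u.cost m + 4
  | ite c t u, m => c.cost m + t.cost m + u.cost m + 2
  | sum _ _ t, m => m * (t.cost m + 16) + 12

theorem eval_congr {V : ℕ} (hV : 2 ≤ V) (t : Term) (ht : t.Wf V) {s s' : Store}
    (h : Agree V s s') : t.eval s = t.eval s' := by
  induction t generalizing s s' with
  | lit m => rfl
  | var x => exact h.1 x ht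
  | read a i ih => simp only [eval, ih ht.2 h, h.2 a ht.1]
  | plus t u iht ihu => simp only [eval, iht ht.1 h, ihu ht.2 h]
  | minus t u iht ihu => simp only [eval, iht ht.1 h, ihu ht.2 h]
  | ite c t u ihc iht ihu => simp only [eval, ihc ht.1 h, iht ht.2.1 h, ihu ht.2.2 h]
  | sum b x t ih =>
    simp only [eval, h.boundVar hV b]
    exact Finset.sum_congr rfl fun i _ => ih ht.2 (h.setVar x i)

end Term

/-- The program that executes `p` with `x = 0, 1, …`, as many times as the bound says. The variables
`d` and `d + 1` count. -/
def forLoop (b : Bool) (x d : ℕ) (p : Program) : Program :=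
  .seq (.assign d (.var (boundVar b))) (.seq (.assign (d + 1) (.lit 0))
    (.while (.var d) (.seq (.assign x (.var (d + 1))) (.seq p
      (.seq (.assign (d + 1) (.plus (.var (d + 1)) (.lit 1)))
        (.assign d (.minus (.var d) (.lit 1))))))))

/-- The loop itself writes to the counters `d` and `d + 1`, so the invariant must not depend on
them, and the body has to leave them alone. The constant 12 is the cost of one test and of the three
assignments around the body. -/
theorem exec_forLoop {b : Bool} {x d : ℕ} {p : Program} {T m : ℕ} {I : ℕ → Store → Prop}
    (hI : ∀ i s z, I i s → I i (s.setVar d z))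
    (hI' : ∀ i s z, I i s → I i (s.setVar (d + 1) z))
    (hp : ∀ i < m, ∀ s, I i s → ∃ s' τ, Exec p (s.setVar x i) s' τ ∧ τ ≤ T ∧
      s'.var d = s.var d ∧ s'.var (d + 1) = s.var (d + 1) ∧ I (i + 1) s')
    {s : Store} (hs : s.var (boundVar b) = m) (h0 : I 0 s) :
    ∃ s' τ, Exec (forLoop b x d p) s s' τ ∧ τ ≤ m * (T + 12) + 6 ∧ I m s' := by
  -- Induction on the number j of rounds that remain after i rounds.
  suffices H : ∀ j i s, i + j = m → s.var d = j → s.var (d + 1) = i → I i s →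
      ∃ s' τ, Exec (.while (.var d) (.seq (.assign x (.var (d + 1))) (.seq p
        (.seq (.assign (d + 1) (.plus (.var (d + 1)) (.lit 1)))
          (.assign d (.minus (.var d) (.lit 1))))))) s s' τ ∧ τ ≤ j * (T + 12) + 2 ∧ I m s' by
    obtain ⟨s', τ, h1, h2, h3⟩ := H m 0 ((s.setVar d m).setVar (d + 1) 0) (by simp) (by simp)
      (by simp) (hI' _ _ _ (hI _ _ _ h0))
    refine ⟨s', _, .seq (.assign _ _ _) (.seq (t' := τ) (.assign _ _ _) ?_), ?_, h3⟩
    · simpa [Expr.eval, hs] using h1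
    · simp only [Expr.cost]; omega
  intro j
  induction j with
  | zero =>
    intro i s hij hd _ h
    refine ⟨s, _, .while_false (by simpa [Expr.eval] using hd), by simp [Expr.cost], ?_⟩
    rwa [show m = i by omega]
  | succ j ih =>
    intro i s hij hd hd1 h
    obtain ⟨s1, τ1, e1, t1, c1, c2, h1⟩ := hp i (by omega) s h
    obtain ⟨s2, τ2, e2, t2, h2⟩ := ih (i + 1) ((s1.setVar (d + 1) (i + 1)).setVar d j) (by omega)
      (by simp) (by simp) (hI _ _ _ (hI' _ _ _ h1))
    refine ⟨s2, _, .while_true (s' := (s1.setVar (d + 1) (i + 1)).setVar d j)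
      (by simp [Expr.eval, hd]) (.seq (.assign _ _ _) (.seq (t := τ1) (s' := s1) ?_
      (.seq (t' := 4) (.assign _ _ _) ?_))) e2, ?_, h2⟩
    · simpa [Expr.eval, hd1] using e1
    · have := Exec.assign d (.minus (.var d) (.lit 1)) (s1.setVar (d + 1) (i + 1))
      simpa [Expr.eval, Expr.cost, c1, c2, hd, hd1] using this
    · simp only [Expr.cost]
      have : (j + 1) * (T + 12) = j * (T + 12) + (T + 12) := by ring
      omega

/-- The program that computes a term and puts its value into the variable `d`, using no other
variables than those from `d` on and those bound in the term, which are restored. -/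
def Term.compile : Term → ℕ → Program
  | lit m, d => .assign d (.lit m)
  | var x, d => .assign d (.var x)
  | read a i, d => .seq (i.compile d) (.assign d (.read a (.var d)))
  | plus t u, d => .seq (t.compile d) (.seq (u.compile (d + 1))
      (.assign d (.plus (.var d) (.var (d + 1)))))
  | minus t u, d => .seq (t.compile d) (.seq (u.compile (d + 1))
      (.assign d (.minus (.var d) (.var (d + 1)))))
  | ite c t u, d => .seq (c.compile d) (.ite (.var d) (t.compile d) (u.compile d))
  | sum b x t, d => .seq (.assign d (.lit 0)) (.seq (.assign (d + 1) (.var x))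
      (.seq (forLoop b x (d + 2) (.seq (t.compile (d + 4))
        (.assign d (.plus (.var d) (.var (d + 4)))))) (.assign x (.var (d + 1)))))

theorem Term.exec_compile {V : ℕ} (hV : 2 ≤ V) (t : Term) (ht : t.Wf V) (d : ℕ) (hd : V ≤ d)
    (s : Store) : ∃ s' τ, Exec (t.compile d) s s' τ ∧ τ ≤ t.cost (s.var 0 + s.var 1) ∧
      s'.var d = t.eval s ∧ (∀ x < d, s'.var x = s.var x) ∧ s'.arr = s.arr := by
  induction t generalizing d s with
  | lit m => exact ⟨_, _, .assign _ _ _, by simp [Expr.cost, cost], by simp [Expr.eval, eval],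
      fun x hx => by simp [hx.ne], rfl⟩
  | var x => exact ⟨_, _, .assign _ _ _, by simp [Expr.cost, cost], by simp [Expr.eval, eval],
      fun x hx => by simp [hx.ne], rfl⟩
  | read a i ih =>
    obtain ⟨s1, τ1, e1, t1, v1, f1, a1⟩ := ih ht.2 d hd s
    refine ⟨_, _, .seq e1 (.assign _ _ _), by simp only [Expr.cost, cost]; omega, ?_, ?_, by simpa⟩
    · simp [Expr.eval, eval, v1, a1]
    · intro x hx; simp [hx.ne, f1 x hx]
  | plus t u iht ihu =>
    obtain ⟨s1, τ1, e1, t1, v1, f1, a1⟩ := iht ht.1 d hd s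
    obtain ⟨s2, τ2, e2, t2, v2, f2, a2⟩ := ihu ht.2 (d + 1) (by omega) s1
    have hu : u.eval s1 = u.eval s :=
      u.eval_congr hV ht.2 ⟨fun x hx => f1 x (by omega), fun a _ => by rw [a1]⟩
    rw [f1 0 (by omega), f1 1 (by omega)] at t2
    refine ⟨_, _, .seq e1 (.seq e2 (.assign _ _ _)), by simp only [Expr.cost, cost]; omega,
      ?_, ?_, by simp [a2, a1]⟩
    · simp [Expr.eval, eval, v1, v2, f2 d, hu]
    · intro x hx; simp [hx.ne, f1 x hx, f2 x (by omega)]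
  | minus t u iht ihu =>
    obtain ⟨s1, τ1, e1, t1, v1, f1, a1⟩ := iht ht.1 d hd s
    obtain ⟨s2, τ2, e2, t2, v2, f2, a2⟩ := ihu ht.2 (d + 1) (by omega) s1
    have hu : u.eval s1 = u.eval s :=
      u.eval_congr hV ht.2 ⟨fun x hx => f1 x (by omega), fun a _ => by rw [a1]⟩
    rw [f1 0 (by omega), f1 1 (by omega)] at t2
    refine ⟨_, _, .seq e1 (.seq e2 (.assign _ _ _)), by simp only [Expr.cost, cost]; omega,
      ?_, ?_, by simp [a2, a1]⟩
    · simp [Expr.eval, eval, v1, v2, f2 d, hu]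
    · intro x hx; simp [hx.ne, f1 x hx, f2 x (by omega)]
  | ite c t u ihc iht ihu =>
    obtain ⟨s1, τ1, e1, t1, v1, f1, a1⟩ := ihc ht.1 d hd s
    have ag : Agree V s1 s := ⟨fun x hx => f1 x (by omega), fun a _ => by rw [a1]⟩
    have h0 := f1 0 (by omega)
    have h1 := f1 1 (by omega)
    by_cases hc : c.eval s = 0
    · obtain ⟨s2, τ2, e2, t2, v2, f2, a2⟩ := ihu ht.2.2 d hd s1
      rw [h0, h1] at t2
      refine ⟨_, _, .seq e1 (.ite_false (by simp [Expr.eval, v1, hc]) e2),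
        by simp only [Expr.cost, cost]; omega, ?_, fun x hx => (f2 x hx).trans (f1 x hx),
        a2.trans a1⟩
      simp [eval, hc, v2, u.eval_congr hV ht.2.2 ag]
    · obtain ⟨s2, τ2, e2, t2, v2, f2, a2⟩ := iht ht.2.1 d hd s1
      rw [h0, h1] at t2
      refine ⟨_, _, .seq e1 (.ite_true (by simp [Expr.eval, v1, hc]) e2),
        by simp only [Expr.cost, cost]; omega, ?_, fun x hx => (f2 x hx).trans (f1 x hx),
        a2.trans a1⟩
      simp [eval, hc, v2, t.eval_congr hV ht.2.1 ag]
  | sum b x t ih =>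
    obtain ⟨⟨hx2, hxV⟩, htW⟩ := ht
    have hb := boundVar_lt_two b
    -- Register `d` accumulates the sum, `d + 1` saves the old value of the bound variable, `d + 2`
    -- and `d + 3` are the counters; hence the summand is compiled with registers from `d + 4` on.
    obtain ⟨s1, τ1, e1, t1, v1, w1, f1, a1⟩ := exec_forLoop (b := b) (x := x) (d := d + 2)
      (p := .seq (t.compile (d + 4)) (.assign d (.plus (.var d) (.var (d + 4)))))
      (T := t.cost (s.var 0 + s.var 1) + 4) (m := s.var (boundVar b))
      (I := fun i s1 => s1.var d = ∑ j ∈ Finset.range i, t.eval (s.setVar x j) ∧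
        s1.var (d + 1) = s.var x ∧ (∀ y < d, y ≠ x → s1.var y = s.var y) ∧ s1.arr = s.arr)
      (by
        rintro i s1 z ⟨h1, h2, h3, h4⟩
        refine ⟨by simpa using h1, by simpa using h2, fun y hy hyx => ?_, by simpa⟩
        rw [Store.setVar_var, if_neg (by omega), h3 y hy hyx])
      (by
        rintro i s1 z ⟨h1, h2, h3, h4⟩
        refine ⟨by simpa [show d ≠ d + 2 + 1 by omega] using h1, by simpa using h2,
          fun y hy hyx => ?_, by simpa⟩
        rw [Store.setVar_var, if_neg (by omega), h3 y hy hyx])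
      (by
        rintro i hi s1 ⟨h1, h2, h3, h4⟩
        obtain ⟨s2, τ2, e2, t2, v2, f2, a2⟩ := ih htW (d + 4) (by omega) (s1.setVar x i)
        have ag : Agree V (s1.setVar x i) (s.setVar x i) := by
          refine ⟨fun y hy => ?_, fun a _ => by simp [h4]⟩
          simp only [Store.setVar_var]
          split
          · rfl
          · exact h3 y (by omega) ‹_›
        rw [ag.1 0 (by omega), ag.1 1 (by omega)] at t2
        simp only [Store.setVar_var, if_neg (show (0 : ℕ) ≠ x by omega),
          if_neg (show (1 : ℕ) ≠ x by omega)] at t2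
        refine ⟨_, _, .seq e2 (.assign _ _ _), by simp only [Expr.cost]; omega, ?_, ?_, ?_, ?_, ?_,
          ?_⟩
        · simp [f2 (d + 2), show d + 2 ≠ x by omega]
        · simp [f2 (d + 3), show d + 3 ≠ x by omega, show d + 2 + 1 ≠ d by omega]
        · simp [Expr.eval, f2 d, v2, show d ≠ x by omega, h1, Finset.sum_range_succ,
            t.eval_congr hV htW ag]
        · simp [f2 (d + 1), show d + 1 ≠ x by omega, h2]
        · intro y hy hyx
          simp [hy.ne, f2 y (by omega), hyx, h3 y hy hyx]
        · simp [a2, h4])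
      (s := (s.setVar d 0).setVar (d + 1) (s.var x))
      (by simp [show boundVar b ≠ d by omega, show boundVar b ≠ d + 1 by omega])
      ⟨by simp, by simp, fun y hy hyx => by
        rw [Store.setVar_var, if_neg (by omega), Store.setVar_var, if_neg (by omega)], rfl⟩
    refine ⟨_, _, .seq (.assign _ _ _) (.seq (.assign _ _ _) (.seq (s' := s1) (t := τ1) ?_
      (.assign _ _ _))), ?_, ?_, ?_, ?_⟩
    · simpa [Expr.eval, show x ≠ d by omega] using e1
    · simp only [Expr.cost, cost]
      have := Nat.mul_le_mul_right (t.cost (s.var 0 + s.var 1) + 16) (boundVar_le b s)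
      rw [add_assoc _ 4 12, show 4 + 12 = 16 from rfl] at t1
      omega
    · simp [eval, show d ≠ x by omega, v1]
    · intro y hy
      by_cases hyx : y = x
      · simp [hyx, Expr.eval, w1]
      · simp [hyx, f1 y hy hyx]
    · simp [a1]

/-! ### Commands: semantics, frame conditions and compilation. -/

/-- Commands. -/
inductive Cmd : Type
  | assign (x : ℕ) (t : Term) : Cmd
  | fill (b : Bool) (a x : ℕ) (t : Term) : Cmd
  | seq (c d : Cmd) : Cmd
  | ite (t : Term) (c d : Cmd) : Cmd
  | loop (b : Bool) (x : ℕ) (c : Cmd) : Cmd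

/-- The store after the array `a` has been replaced by `f`. -/
def Store.setArray (s : Store) (a : ℕ) (f : ℕ → ℕ) : Store :=
  { s with arr := Function.update s.arr a f }

@[simp] theorem Store.setArray_var (s : Store) (a : ℕ) (f : ℕ → ℕ) :
    (s.setArray a f).var = s.var := rfl

@[simp] theorem Store.setArray_arr (s : Store) (a : ℕ) (f : ℕ → ℕ) (b : ℕ) :
    (s.setArray a f).arr b = if b = a then f else s.arr b := by
  simp [Store.setArray, Function.update_apply]

namespace Cmd

/-- The effect of a command. -/
def run : Cmd → Store → Store
  | assign x t, s => s.setVar x (t.eval s)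
  | fill b a x t, s => s.setArray a fun i =>
      if i < s.var (boundVar b) then t.eval (s.setVar x i) else s.arr a i
  | seq c d, s => d.run (c.run s)
  | ite t c d, s => if t.eval s ≠ 0 then c.run s else d.run s
  | loop b x c, s => (List.range (s.var (boundVar b))).foldl (fun s i => c.run (s.setVar x i)) s

/-- All names are below `V`, and the variables holding bounds are never changed. -/
def Wf (V : ℕ) : Cmd → Prop
  | assign x t => (2 ≤ x ∧ x < V) ∧ t.Wf V
  | fill _ a x t => (2 ≤ x ∧ x < V) ∧ a < V ∧ t.Wf V
  | seq c d => c.Wf V ∧ d.Wf V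
  | ite t c d => t.Wf V ∧ c.Wf V ∧ d.Wf V
  | loop _ x c => (2 ≤ x ∧ x < V) ∧ c.Wf V

/-- The variables that a command may change. -/
def varsChanged : Cmd → List ℕ
  | assign x _ => [x]
  | fill _ _ _ _ => []
  | seq c d => c.varsChanged ++ d.varsChanged
  | ite _ c d => c.varsChanged ++ d.varsChanged
  | loop _ x c => x :: c.varsChanged

/-- The arrays that a command may change. -/
def arrsChanged : Cmd → List ℕ
  | assign _ _ => []
  | fill _ a _ _ => [a]
  | seq c d => c.arrsChanged ++ d.arrsChanged
  | ite _ c d => c.arrsChanged ++ d.arrsChanged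
  | loop _ _ c => c.arrsChanged

/-- A bound on the running time of the compiled command. -/
def cost : Cmd → ℕ → ℕ
  | assign _ t, m => t.cost m + 2
  | fill _ _ _ t, m => m * (t.cost m + 31) + 16
  | seq c d, m => c.cost m + d.cost m
  | ite t c d, m => t.cost m + c.cost m + d.cost m + 2
  | loop _ _ c, m => m * (c.cost m + 12) + 6

/-- Every correctness proof of a loop goes through this principle; the invariant is indexed by the
number of completed rounds. -/
theorem run_loop_induct {b : Bool} {x : ℕ} {c : Cmd} (I : ℕ → Store → Prop) {s : Store}
    (h0 : I 0 s)
    (h : ∀ i < s.var (boundVar b), ∀ s', I i s' → I (i + 1) (c.run (s'.setVar x i))) :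
    I (s.var (boundVar b)) ((loop b x c).run s) := by
  rw [run]
  generalize s.var (boundVar b) = m at h
  induction m with
  | zero => simpa
  | succ m ih =>
    rw [List.range_succ, List.foldl_append]
    exact h m (by omega) _ (ih fun i hi => h i (by omega))

/-- A frame condition: which names change is read off the syntax, so that `decide` or `simp` settles
it for concrete commands. -/
theorem run_var (c : Cmd) (s : Store) {x : ℕ} (hx : x ∉ c.varsChanged) :
    (c.run s).var x = s.var x := by
  induction c generalizing s with
  | assign y t => simp_all [run, varsChanged]
  | fill b a y t => simp [run]
  | seq c d ihc ihd =>
    simp only [varsChanged, List.mem_append, not_or] at hx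
    rw [run, ihd _ hx.2, ihc _ hx.1]
  | ite t c d ihc ihd =>
    simp only [varsChanged, List.mem_append, not_or] at hx
    rw [run]; split
    · exact ihc s hx.1
    · exact ihd s hx.2
  | loop b y c ih =>
    simp only [varsChanged, List.mem_cons, not_or] at hx
    refine run_loop_induct (fun _ s' => s'.var x = s.var x) rfl fun i _ s' hs' => ?_
    rw [ih _ hx.2, Store.setVar_var, if_neg hx.1, hs']

theorem run_arr (c : Cmd) (s : Store) {a : ℕ} (ha : a ∉ c.arrsChanged) :
    (c.run s).arr a = s.arr a := by
  induction c generalizing s with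
  | assign y t => simp [run]
  | fill b a y t => simp_all [run, arrsChanged]
  | seq c d ihc ihd =>
    simp only [arrsChanged, List.mem_append, not_or] at ha
    rw [run, ihd _ ha.2, ihc _ ha.1]
  | ite t c d ihc ihd =>
    simp only [arrsChanged, List.mem_append, not_or] at ha
    rw [run]; split
    · exact ihc s ha.1
    · exact ihd s ha.2
  | loop b y c ih =>
    refine run_loop_induct (fun _ s' => s'.arr a = s.arr a) rfl fun i _ s' hs' => ?_
    rw [ih _ ha, Store.setVar_arr, hs']

theorem Wf.two_le_of_mem {V : ℕ} {c : Cmd} (hc : c.Wf V) {x : ℕ} (hx : x ∈ c.varsChanged) :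
    2 ≤ x := by
  induction c with
  | assign y t => simp only [varsChanged, List.mem_singleton] at hx; exact hx ▸ hc.1.1
  | fill b a y t => simp [varsChanged] at hx
  | seq c d ihc ihd =>
    simp only [varsChanged, List.mem_append] at hx
    exact hx.elim (ihc hc.1) (ihd hc.2)
  | ite t c d ihc ihd =>
    simp only [varsChanged, List.mem_append] at hx
    exact hx.elim (ihc hc.2.1) (ihd hc.2.2)
  | loop b y c ih =>
    simp only [varsChanged, List.mem_cons] at hx
    exact hx.elim (fun h => h ▸ hc.1.1) (ih hc.2)

theorem Wf.run_var {V : ℕ} {c : Cmd} (hc : c.Wf V) (s : Store) {x : ℕ} (hx : x < 2) :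
    (c.run s).var x = s.var x :=
  c.run_var s fun h => by have := hc.two_le_of_mem h; omega

/-- The program for a command; the variables from `d` on and the array `V` are used for
intermediate results. -/
def compile (V : ℕ) : Cmd → ℕ → Program
  | assign x t, d => .seq (t.compile d) (.assign x (.var d))
  | fill b a x t, d => .seq (.assign d (.var x))
      (.seq (forLoop b x (d + 1) (.seq (t.compile (d + 3)) (.write V (.var x) (.var (d + 3)))))
      (.seq (forLoop b x (d + 1) (.write a (.var x) (.read V (.var x)))) (.assign x (.var d))))
  | seq c c', d => .seq (c.compile V d) (c'.compile V d)
  | ite t c c', d => .seq (t.compile d) (.ite (.var d) (c.compile V d) (c'.compile V d))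
  | loop b x c, d => forLoop b x d (c.compile V (d + 2))

/-- The compiled program runs in a store that agrees with the abstract one only below `V`;
everything above is scratch space, of which the part from `V` to `d` belongs to enclosing loops and
must survive. -/
theorem exec_compile {V : ℕ} (hV : 2 ≤ V) (c : Cmd) (hc : c.Wf V) (d : ℕ) (hd : V ≤ d)
    {s s₀ : Store} (hs : Agree V s₀ s) : ∃ s' τ, Exec (c.compile V d) s₀ s' τ ∧
      τ ≤ c.cost (s.var 0 + s.var 1) ∧ Agree V s' (c.run s) ∧
      ∀ y, V ≤ y → y < d → s'.var y = s₀.var y := by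
  induction c generalizing d s s₀ with
  | assign x t =>
    obtain ⟨⟨hx2, hxV⟩, ht⟩ := hc
    obtain ⟨s1, τ1, e1, t1, v1, f1, a1⟩ := t.exec_compile hV ht d hd s₀
    rw [hs.1 0 (by omega), hs.1 1 (by omega)] at t1
    refine ⟨_, _, .seq e1 (.assign _ _ _), by simp only [cost, Expr.cost]; omega, ⟨?_, ?_⟩, ?_⟩
    · intro y hy
      simp only [run, Store.setVar_var, Expr.eval]
      split
      · rw [v1, t.eval_congr hV ht hs]
      · rw [f1 y (by omega), hs.1 y hy]
    · intro a ha
      simp [run, a1, hs.2 a ha]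
    · intro y hy hyd
      simp [show y ≠ x by omega, f1 y hyd]
  | fill b a x t =>
    obtain ⟨⟨hx2, hxV⟩, haV, ht⟩ := hc
    have hb := boundVar_lt_two b
    have h0 := hs.1 0 (by omega)
    have h1 := hs.1 1 (by omega)
    -- The term may read the array that is being filled. So the new values first go to the scratch
    -- array `V`, and a second loop copies them.
    obtain ⟨s1, τ1, e1, t1, v1, w1, f1, a1⟩ := exec_forLoop (b := b) (x := x) (d := d + 1)
      (p := .seq (t.compile (d + 3)) (.write V (.var x) (.var (d + 3))))
      (T := t.cost (s.var 0 + s.var 1) + 3) (m := s.var (boundVar b))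
      (I := fun i s1 => s1.var d = s₀.var x ∧ (∀ j < i, s1.arr V j = t.eval (s.setVar x j)) ∧
        (∀ y < d, y ≠ x → s1.var y = s₀.var y) ∧ ∀ a < V, s1.arr a = s₀.arr a)
      (by
        rintro i s1 z ⟨h1, h2, h3, h4⟩
        refine ⟨by simpa using h1, by simpa using h2, fun y hy hyx => ?_, by simpa using h4⟩
        rw [Store.setVar_var, if_neg (by omega), h3 y hy hyx])
      (by
        rintro i s1 z ⟨h1, h2, h3, h4⟩
        refine ⟨?_, by simpa using h2, fun y hy hyx => ?_, by simpa using h4⟩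
        · rw [Store.setVar_var, if_neg (by omega), h1]
        · rw [Store.setVar_var, if_neg (by omega), h3 y hy hyx])
      (by
        rintro i hi s1 ⟨g1, g2, g3, g4⟩
        obtain ⟨s2, τ2, e2, t2, v2, f2, a2⟩ :=
          t.exec_compile hV ht (d + 3) (by omega) (s1.setVar x i)
        have ag : Agree V (s1.setVar x i) (s.setVar x i) := by
          refine ⟨fun y hy => ?_, fun a ha => by simp [g4 a ha, hs.2 a ha]⟩
          simp only [Store.setVar_var]
          split
          · rfl
          · rw [g3 y (by omega) ‹_›, hs.1 y hy]
        rw [ag.1 0 (by omega), ag.1 1 (by omega)] at t2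
        simp only [Store.setVar_var, if_neg (show (0 : ℕ) ≠ x by omega),
          if_neg (show (1 : ℕ) ≠ x by omega)] at t2
        have hx : s2.var x = i := by simp [f2 x (by omega)]
        refine ⟨_, _, .seq e2 (.write _ _ _ _), by simp only [Expr.cost]; omega, ?_, ?_, ?_, ?_, ?_,
          ?_⟩
        · simp [f2 (d + 1), show d + 1 ≠ x by omega]
        · simp [f2 (d + 2), show d + 2 ≠ x by omega]
        · simp [f2 d, show d ≠ x by omega, g1]
        · intro j hj
          simp only [Store.setArr_arr, if_true, Expr.eval, Function.update_apply, hx, v2]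
          split
          · rename_i h; rw [h, t.eval_congr hV ht ag]
          · rw [a2]; exact g2 j (by omega)
        · intro y hy hyx
          simp [f2 y (by omega), hyx, g3 y hy hyx]
        · intro a ha
          simp [Store.setArr_arr, ha.ne, a2, g4 a ha])
      (s := s₀.setVar d (s₀.var x))
      (by simp [show boundVar b ≠ d by omega, hs.boundVar hV b])
      ⟨by simp, by simp, fun y hy hyx => by rw [Store.setVar_var, if_neg (by omega)],
        fun a ha => rfl⟩
    obtain ⟨s2, τ2, e2, t2, v2, w2, f2, a2, b2⟩ := exec_forLoop (b := b) (x := x) (d := d + 1)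
      (p := .write a (.var x) (.read V (.var x)))
      (T := 4) (m := s.var (boundVar b))
      (I := fun i s1 => s1.var d = s₀.var x ∧
        (∀ j < s.var (boundVar b), s1.arr V j = t.eval (s.setVar x j)) ∧
        (∀ y < d, y ≠ x → s1.var y = s₀.var y) ∧ (∀ a' < V, a' ≠ a → s1.arr a' = s₀.arr a') ∧
        ∀ j, s1.arr a j = if j < i then t.eval (s.setVar x j) else s₀.arr a j)
      (by
        rintro i s1 z ⟨h1, h2, h3, h4⟩
        refine ⟨by simpa using h1, by simpa using h2, fun y hy hyx => ?_, by simpa using h4⟩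
        rw [Store.setVar_var, if_neg (by omega), h3 y hy hyx])
      (by
        rintro i s1 z ⟨h1, h2, h3, h4⟩
        refine ⟨?_, by simpa using h2, fun y hy hyx => ?_, by simpa using h4⟩
        · rw [Store.setVar_var, if_neg (by omega), h1]
        · rw [Store.setVar_var, if_neg (by omega), h3 y hy hyx])
      (by
        rintro i hi s1 ⟨g1, g2, g3, g4, g5⟩
        refine ⟨_, _, .write _ _ _ _, by simp [Expr.cost], ?_, ?_, ?_, ?_, ?_, ?_, ?_⟩
        · simp [show d + 1 ≠ x by omega]
        · simp [show d + 2 ≠ x by omega]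
        · simp [show d ≠ x by omega, g1]
        · intro j hj
          simp only [Store.setArr_arr, if_neg (show V ≠ a by omega)]
          exact g2 j hj
        · intro y hy hyx
          simp [hyx, g3 y hy hyx]
        · intro a' ha' hne
          simp [Store.setArr_arr, hne, g4 a' ha' hne]
        · intro j
          simp only [Store.setArr_arr, if_true, Expr.eval, Function.update_apply,
            Store.setVar_var, Store.setVar_arr]
          by_cases hj : j = i
          · simp [hj, g2 i hi]
          · simp [hj, g5, show j < i + 1 ↔ j < i by omega])
      (s := s1)
      (by rw [f1 _ (by omega) (by omega), hs.boundVar hV b])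
      ⟨v1, w1, f1, fun a' ha' _ => a1 a' ha', fun j => by simp [a1 a haV]⟩
    refine ⟨_, _, .seq (.assign _ _ _) (.seq e1 (.seq e2 (.assign _ _ _))), ?_, ⟨?_, ?_⟩, ?_⟩
    · simp only [cost, Expr.cost]
      have := boundVar_le b s
      have h1 := Nat.mul_le_mul_right (t.cost (s.var 0 + s.var 1) + 31) this
      rw [add_assoc _ 3 12, show 3 + 12 = 15 from rfl] at t1
      have h2 : s.var (boundVar b) * (t.cost (s.var 0 + s.var 1) + 31) =
        s.var (boundVar b) * (t.cost (s.var 0 + s.var 1) + 15) +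
          s.var (boundVar b) * (4 + 12) := by ring
      omega
    · intro y hy
      simp only [run, Store.setArray_var, Store.setVar_var, Expr.eval, v2]
      split
      · rename_i h; rw [h, hs.1 x hxV]
      · rw [f2 y (by omega) ‹_›, hs.1 y hy]
    · intro a' ha'
      simp only [run, Store.setArray_arr, Store.setVar_arr]
      split
      · rename_i h
        subst h
        funext j
        rw [b2, hs.2 a' ha']
      · rw [a2 a' ha' ‹_›, hs.2 a' ha']
    · intro y hy hyd
      simp [show y ≠ x by omega, f2 y hyd]
  | seq c c' ih ih' =>
    obtain ⟨s1, τ1, e1, t1, ag1, f1⟩ := ih hc.1 d hd hs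
    obtain ⟨s2, τ2, e2, t2, ag2, f2⟩ := ih' hc.2 d hd ag1
    rw [hc.1.run_var s (by omega), hc.1.run_var s (by omega)] at t2
    exact ⟨s2, _, .seq e1 e2, by simp only [cost]; omega, ag2,
      fun y hy hyd => (f2 y hy hyd).trans (f1 y hy hyd)⟩
  | ite t c c' ih ih' =>
    obtain ⟨s1, τ1, e1, t1, v1, f1, a1⟩ := t.exec_compile hV hc.1 d hd s₀
    rw [hs.1 0 (by omega), hs.1 1 (by omega)] at t1
    have ag : Agree V s1 s :=
      ⟨fun x hx => (f1 x (by omega)).trans (hs.1 x hx), fun a ha => by rw [a1, hs.2 a ha]⟩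
    rw [t.eval_congr hV hc.1 hs] at v1
    by_cases h : t.eval s = 0
    · obtain ⟨s2, τ2, e2, t2, ag2, f2⟩ := ih' hc.2.2 d hd ag
      refine ⟨s2, _, .seq e1 (.ite_false (by simp [Expr.eval, v1, h]) e2),
        by simp only [cost, Expr.cost]; omega, by simpa [run, h] using ag2,
        fun y hy hyd => (f2 y hy hyd).trans (f1 y hyd)⟩
    · obtain ⟨s2, τ2, e2, t2, ag2, f2⟩ := ih hc.2.1 d hd ag
      refine ⟨s2, _, .seq e1 (.ite_true (by simp [Expr.eval, v1, h]) e2),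
        by simp only [cost, Expr.cost]; omega, by simpa [run, h] using ag2,
        fun y hy hyd => (f2 y hy hyd).trans (f1 y hyd)⟩
  | loop b x c ih =>
    obtain ⟨⟨hx2, hxV⟩, hcW⟩ := hc
    let S : ℕ → Store := fun i => (List.range i).foldl (fun s i => c.run (s.setVar x i)) s
    have hS : ∀ i, S (i + 1) = c.run ((S i).setVar x i) := fun i => by
      simp only [S, List.range_succ, List.foldl_append, List.foldl_cons, List.foldl_nil]
    have hSv : ∀ y < 2, ∀ i, (S i).var y = s.var y := by
      intro y hy i
      induction i with
      | zero => rfl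
      | succ i ih => rw [hS, hcW.run_var _ hy, Store.setVar_var, if_neg (by omega), ih]
    obtain ⟨s1, τ1, e1, t1, ag, f1⟩ := exec_forLoop (b := b) (x := x) (d := d)
      (p := c.compile V (d + 2)) (T := c.cost (s.var 0 + s.var 1)) (m := s.var (boundVar b))
      (I := fun i s1 => Agree V s1 (S i) ∧ ∀ y, V ≤ y → y < d → s1.var y = s₀.var y)
      (by
        rintro i s1 z ⟨h1, h2⟩
        refine ⟨⟨fun y hy => ?_, h1.2⟩, fun y hy hyd => ?_⟩
        · rw [Store.setVar_var, if_neg (by omega), h1.1 y hy]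
        · rw [Store.setVar_var, if_neg (by omega), h2 y hy hyd])
      (by
        rintro i s1 z ⟨h1, h2⟩
        refine ⟨⟨fun y hy => ?_, h1.2⟩, fun y hy hyd => ?_⟩
        · rw [Store.setVar_var, if_neg (by omega), h1.1 y hy]
        · rw [Store.setVar_var, if_neg (by omega), h2 y hy hyd])
      (by
        rintro i hi s1 ⟨h1, h2⟩
        obtain ⟨s2, τ2, e2, t2, ag2, f2⟩ := ih hcW (d + 2) (by omega) (h1.setVar x i)
        simp only [Store.setVar_var, if_neg (show (0 : ℕ) ≠ x by omega),
          if_neg (show (1 : ℕ) ≠ x by omega), hSv 0 (by omega), hSv 1 (by omega)] at t2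
        refine ⟨s2, τ2, e2, t2, ?_, ?_, by rw [hS]; exact ag2, fun y hy hyd => ?_⟩
        · rw [f2 d (by omega) (by omega), Store.setVar_var, if_neg (by omega)]
        · rw [f2 (d + 1) (by omega) (by omega), Store.setVar_var, if_neg (by omega)]
        · rw [f2 y hy (by omega), Store.setVar_var, if_neg (by omega), h2 y hy hyd])
      (s := s₀) (hs.boundVar hV b) ⟨hs, fun _ _ _ => rfl⟩
    refine ⟨s1, τ1, e1, t1.trans ?_, ag, f1⟩
    simp only [cost]
    have := Nat.mul_le_mul_right (c.cost (s.var 0 + s.var 1) + 12) (boundVar_le b s)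
    omega

end Cmd

/-! ### Polynomial running time of compiled commands. -/

/-- The function `f` is bounded by a polynomial. -/
def PolyBounded (f : ℕ → ℕ) : Prop := ∃ C e, ∀ m, f m ≤ C * (m + 1) ^ e

namespace PolyBounded

theorem const (a : ℕ) : PolyBounded fun _ => a := ⟨a, 0, fun _ => by simp⟩

theorem id : PolyBounded fun m => m := ⟨1, 1, fun _ => by simp⟩

theorem add {f g : ℕ → ℕ} (hf : PolyBounded f) (hg : PolyBounded g) :
    PolyBounded fun m => f m + g m := by
  obtain ⟨C, e, hf⟩ := hf
  obtain ⟨C', e', hg⟩ := hg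
  refine ⟨C + C', e + e', fun m => (Nat.add_le_add (hf m) (hg m)).trans ?_⟩
  rw [add_mul]
  gcongr <;> omega

theorem mul {f g : ℕ → ℕ} (hf : PolyBounded f) (hg : PolyBounded g) :
    PolyBounded fun m => f m * g m := by
  obtain ⟨C, e, hf⟩ := hf
  obtain ⟨C', e', hg⟩ := hg
  refine ⟨C * C', e + e', fun m => (Nat.mul_le_mul (hf m) (hg m)).trans (le_of_eq ?_)⟩
  ring

end PolyBounded

/-- The nesting depth of sums is fixed by the syntax, and each level contributes one factor, the
bound on the number of rounds. -/
theorem Term.polyBounded_cost (t : Term) : PolyBounded t.cost := by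
  induction t with
  | lit m => exact .const 2
  | var x => exact .const 2
  | read a i ih => exact ih.add (.const 3)
  | plus t u iht ihu => exact (iht.add ihu).add (.const 4)
  | minus t u iht ihu => exact (iht.add ihu).add (.const 4)
  | ite c t u ihc iht ihu => exact ((ihc.add iht).add ihu).add (.const 2)
  | sum b x t ih => exact (PolyBounded.id.mul (ih.add (.const 16))).add (.const 12)

theorem Cmd.polyBounded_cost (c : Cmd) : PolyBounded c.cost := by
  induction c with
  | assign x t => exact t.polyBounded_cost.add (.const 2)
  | fill b a x t => exact (PolyBounded.id.mul (t.polyBounded_cost.add (.const 31))).add (.const 16)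
  | seq c d ihc ihd => exact ihc.add ihd
  | ite t c d ihc ihd => exact ((t.polyBounded_cost.add ihc).add ihd).add (.const 2)
  | loop b x c ih => exact (PolyBounded.id.mul (ih.add (.const 12))).add (.const 6)

end RAM

/-! ## Walks, cores and components -/

namespace ConnIn

variable {V : Type*} {E : V → V → Prop}

/-- `p 0, …, p d` is a walk inside `A`. -/
def IsWalk (E : V → V → Prop) (A : Set V) (d : ℕ) (p : ℕ → V) : Prop :=
  (∀ i ≤ d, p i ∈ A) ∧ ∀ i < d, E (p i) (p (i + 1))

/-- There is a walk of length `d` from `u` to `v` inside `A`. -/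
def Walk (E : V → V → Prop) (A : Set V) (d : ℕ) (u v : V) : Prop :=
  ∃ p, IsWalk E A d p ∧ p 0 = u ∧ p d = v

theorem IsWalk.walk {A : Set V} {d : ℕ} {p : ℕ → V} (hp : IsWalk E A d p) {i j : ℕ} (hij : i ≤ j)
    (hj : j ≤ d) : Walk E A (j - i) (p i) (p j) :=
  ⟨fun m => p (i + m), ⟨fun m hm => hp.1 _ (by omega), fun m hm => hp.2 _ (by omega)⟩, rfl,
    by simp only [Nat.add_sub_cancel' hij]⟩

theorem Walk.zero {A : Set V} {v : V} (hv : v ∈ A) : Walk E A 0 v v :=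
  ⟨fun _ => v, ⟨fun _ _ => hv, fun _ h => absurd h (by omega)⟩, rfl, rfl⟩

theorem Walk.mem_left {A : Set V} {d : ℕ} {u v : V} (h : Walk E A d u v) : u ∈ A := by
  obtain ⟨p, hp, rfl, -⟩ := h
  exact hp.1 0 (by omega)

theorem Walk.mem_right {A : Set V} {d : ℕ} {u v : V} (h : Walk E A d u v) : v ∈ A := by
  obtain ⟨p, hp, -, rfl⟩ := h
  exact hp.1 d le_rfl

theorem Walk.mono {A B : Set V} (hAB : A ⊆ B) {d : ℕ} {u v : V} (h : Walk E A d u v) :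
    Walk E B d u v := by
  obtain ⟨p, hp, h1, h2⟩ := h
  exact ⟨p, ⟨fun i hi => hAB (hp.1 i hi), hp.2⟩, h1, h2⟩

theorem Walk.trans {A : Set V} {d d' : ℕ} {u v w : V} (h : Walk E A d u v)
    (h' : Walk E A d' v w) : Walk E A (d + d') u w := by
  obtain ⟨p, hp, rfl, hpv⟩ := h
  obtain ⟨q, hq, hqv, rfl⟩ := h'
  refine ⟨fun i => if i ≤ d then p i else q (i - d), ⟨fun i hi => ?_, fun i hi => ?_⟩, ?_, ?_⟩
  · simp only
    split
    · exact hp.1 i ‹_›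
    · exact hq.1 _ (by omega)
  · simp only
    rcases lt_trichotomy i d with h | rfl | h
    · rw [if_pos h.le, if_pos (by omega)]; exact hp.2 i h
    · rw [if_pos le_rfl, if_neg (by omega), hpv, ← hqv, Nat.add_sub_cancel_left]
      exact hq.2 0 (by omega)
    · rw [if_neg (by omega), if_neg (by omega), show i + 1 - d = i - d + 1 by omega]
      exact hq.2 _ (by omega)
  · simp
  · by_cases h : d' = 0
    · subst h; simp [hpv, hqv]
    · simp [h]

theorem Walk.edge {A : Set V} {u v : V} (hu : u ∈ A) (hv : v ∈ A) (h : E u v) :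
    Walk E A 1 u v := by
  refine ⟨fun i => if i = 0 then u else v, ⟨fun i _ => ?_, fun i hi => ?_⟩, by simp, by simp⟩
  · simp only; split <;> assumption
  · obtain rfl : i = 0 := by omega
    simpa

theorem walk_succ {A : Set V} {d : ℕ} {u v : V} :
    Walk E A (d + 1) u v ↔ v ∈ A ∧ ∃ w, Walk E A d u w ∧ E w v := by
  constructor
  · rintro h
    refine ⟨h.mem_right, ?_⟩
    obtain ⟨p, hp, rfl, rfl⟩ := h
    exact ⟨p d, by simpa using hp.walk (Nat.zero_le d) (by omega), hp.2 d (by omega)⟩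
  · rintro ⟨hv, w, hw, h⟩
    exact hw.trans (.edge hw.mem_right hv h)

/-- The vertices on closed walks inside `A` of length at most `l`. -/
def onCycle (E : V → V → Prop) (A : Set V) (l : ℕ) : Set V :=
  {v | ∃ d, 1 ≤ d ∧ d ≤ l ∧ Walk E A d v v}

/-- The vertices reachable inside `A` from closed walks inside `A` of length at most `l`. -/
def core (E : V → V → Prop) (A : Set V) (l : ℕ) : Set V :=
  {v | ∃ u ∈ onCycle E A l, ∃ d, Walk E A d u v}

theorem core_subset {A : Set V} {l : ℕ} : core E A l ⊆ A := fun _ ⟨_, _, _, h⟩ => h.mem_right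

theorem core_mono {A B : Set V} (hAB : A ⊆ B) {l l' : ℕ} (hl : l ≤ l') :
    core E A l ⊆ core E B l' := by
  rintro v ⟨u, ⟨d, h1, h2, h3⟩, d', h4⟩
  exact ⟨u, ⟨d, h1, h2.trans hl, h3.mono hAB⟩, d', h4.mono hAB⟩

theorem onCycle_subset_core {A : Set V} {l : ℕ} : onCycle E A l ⊆ core E A l :=
  fun v hv => ⟨v, hv, 0, by obtain ⟨d, -, -, h⟩ := hv; exact .zero h.mem_left⟩

theorem Walk.mem_core {A : Set V} {l d : ℕ} {u v : V} (h : Walk E A d u v)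
    (hu : u ∈ core E A l) : v ∈ core E A l := by
  obtain ⟨w, hw, d', h'⟩ := hu
  exact ⟨w, hw, d' + d, h'.trans h⟩

theorem Walk.restrict_core {A : Set V} {l d : ℕ} {u v : V} (h : Walk E A d u v)
    (hu : u ∈ core E A l) : Walk E (core E A l) d u v := by
  obtain ⟨p, hp, rfl, rfl⟩ := h
  exact ⟨p, ⟨fun i hi => (hp.walk (Nat.zero_le i) hi).mem_core hu, hp.2⟩, rfl, rfl⟩

/-- Walks that start in the core never leave it, so the closed walks that generate it and the walks
from them survive the restriction. -/
theorem core_core (A : Set V) (l : ℕ) : core E (core E A l) l = core E A l := by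
  refine core_subset.antisymm ?_
  rintro v ⟨u, hu, d', h'⟩
  have hu' := onCycle_subset_core hu
  obtain ⟨d, h1, h2, h3⟩ := hu
  exact ⟨u, ⟨d, h1, h2, h3.restrict_core hu'⟩, d', h'.restrict_core hu'⟩

/-- The in-neighbour is the last but one vertex of a walk from a closed walk or, if that walk is
trivial, of the closed walk itself. -/
theorem exists_pred_of_mem_core {A : Set V} {l : ℕ} {v : V} (hv : v ∈ core E A l) :
    ∃ u ∈ core E A l, E u v := by
  obtain ⟨u, hu, d', h'⟩ := hv
  have hu' := onCycle_subset_core hu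
  rcases d' with _ | d'
  · obtain ⟨p, hp, rfl, rfl⟩ := h'
    obtain ⟨d, h1, h2, h3⟩ := hu
    obtain ⟨d, rfl⟩ : ∃ e, d = e + 1 := ⟨d - 1, by omega⟩
    obtain ⟨-, w, hw, hE⟩ := walk_succ.1 h3
    exact ⟨w, hw.mem_core hu', hE⟩
  · obtain ⟨-, w, hw, hE⟩ := walk_succ.1 h'
    exact ⟨w, hw.mem_core hu', hE⟩

/-- Going back from `v` along in-neighbours, some vertex repeats within |V| steps; this yields a
closed walk from which `v` is reachable. -/
theorem subset_core_of_forall_pred [Finite V] {S : Set V} (hS : ∀ v ∈ S, ∃ u ∈ S, E u v) {l : ℕ}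
    (hl : Nat.card V ≤ l) : S ⊆ core E S l := by
  intro v hv
  choose! f hf using hS
  have hmem : ∀ i, f^[i] v ∈ S := fun i => by
    induction i with
    | zero => exact hv
    | succ i ih => rw [Function.iterate_succ_apply']; exact (hf _ ih).1
  have hwalk : ∀ d i, Walk E S d (f^[i + d] v) (f^[i] v) := fun d => by
    induction d with
    | zero => exact fun i => .zero (hmem i)
    | succ d ih =>
      intro i
      refine walk_succ.2 ⟨hmem i, f^[i + 1] v, by simpa [add_right_comm, add_assoc] using ih (i + 1),
        ?_⟩
      rw [Function.iterate_succ_apply']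
      exact (hf _ (hmem i)).2
  have hni : ¬ Function.Injective fun i : Fin (Nat.card V + 1) => f^[i] v := fun h => by
    have := Nat.card_le_card_of_injective _ h
    simp at this
  simp only [Function.Injective, not_forall] at hni
  obtain ⟨i, j, hij, hne⟩ := hni
  wlog h : (i : ℕ) < j generalizing i j
  · exact this j i hij.symm (Ne.symm hne) (by omega)
  refine ⟨f^[j] v, ⟨j - i, by omega, by omega, ?_⟩, j, by simpa using hwalk j 0⟩
  have := hwalk (j - i) i
  rw [Nat.add_sub_cancel' h.le] at this
  have hij' : f^[i] v = f^[j] v := hij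
  rwa [hij'] at this

/-! ### Minimal cores and their size. -/

/-- `Y` is an inclusion-minimal set whose core has at least `k` vertices. -/
structure IsMinimalCore (E : V → V → Prop) (k l : ℕ) (Y : Set V) : Prop where
  le_ncard : k ≤ (core E Y l).ncard
  lt : ∀ v ∈ Y, (core E (Y \ {v}) l).ncard < k

namespace IsMinimalCore

variable [Finite V] {k l : ℕ} {Y : Set V}

/-- This is the form in which minimality is used: a missing vertex v could be deleted from `Y`, as
`Z` would survive in the core of the rest. -/
theorem eq_of_subset (hY : IsMinimalCore E k l Y) {Z : Set V} (hZY : Z ⊆ Y)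
    (hZ : Z ⊆ core E Z l) (hk : k ≤ Z.ncard) : Z = Y := by
  by_contra hne
  obtain ⟨v, hv, hvZ⟩ := Set.exists_of_ssubset (hZY.ssubset_of_ne hne)
  have h1 : Z ⊆ core E (Y \ {v}) l :=
    hZ.trans (core_mono (Set.subset_sdiff_singleton hZY hvZ) le_rfl)
  exact absurd (hk.trans (Set.ncard_le_ncard h1)) (not_le.2 (hY.lt v hv))

theorem core_eq (hY : IsMinimalCore E k l Y) : core E Y l = Y :=
  hY.eq_of_subset core_subset (core_core Y l).ge hY.le_ncard

/-- Among the subsets of `Y` that are their own core and have fewer than `k` elements, let Z be a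
largest one. Any larger subset of `Y` that is its own core is all of `Y`. Adding an out-neighbour of
Z enlarges it by one vertex, adding a closed walk by at most `l`. -/
theorem ncard_le (hY : IsMinimalCore E k l Y) : Y.ncard ≤ k + l := by
  by_cases hk0 : k = 0
  · have : (∅ : Set V) = Y := hY.eq_of_subset (Set.empty_subset _) (Set.empty_subset _) (by omega)
    simp [← this]
  obtain ⟨Z, ⟨hZY, hZ, hZk⟩, hmax⟩ := Set.Finite.exists_maximalFor Set.ncard
    {Z : Set V | Z ⊆ Y ∧ Z ⊆ core E Z l ∧ Z.ncard < k} (Set.toFinite _)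
    ⟨∅, Set.empty_subset _, Set.empty_subset _, by simpa using Nat.pos_of_ne_zero hk0⟩
  have key : ∀ Z', Z' ⊆ Y → Z' ⊆ core E Z' l → Z.ncard < Z'.ncard → Z' = Y := by
    intro Z' h1 h2 h3
    refine hY.eq_of_subset h1 h2 (by_contra fun h => ?_)
    exact absurd (hmax ⟨h1, h2, by omega⟩ h3.le) (by omega)
  by_cases hcl : ∃ u ∈ Z, ∃ v ∈ Y, v ∉ Z ∧ E u v
  · obtain ⟨u, hu, v, hv, hvZ, hE⟩ := hcl
    have h1 : insert v Z = Y := by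
      refine key _ (Set.insert_subset hv hZY) ?_ ?_
      · have h2 : Z ⊆ core E (insert v Z) l := hZ.trans (core_mono (Set.subset_insert _ _) le_rfl)
        refine Set.insert_subset ?_ h2
        exact (Walk.edge (Set.mem_insert_of_mem _ hu) (Set.mem_insert _ _) hE).mem_core (h2 hu)
      · rw [Set.ncard_insert_of_notMem hvZ]; omega
    rw [← h1, Set.ncard_insert_of_notMem hvZ]; omega
  · push Not at hcl
    have hne : ∃ y ∈ Y, y ∉ Z := by
      by_contra h
      push Not at h
      have := Set.ncard_le_ncard h
      have := hY.le_ncard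
      rw [hY.core_eq] at this
      omega
    obtain ⟨y, hy, hyZ⟩ := hne
    rw [← hY.core_eq] at hy
    obtain ⟨u, ⟨d, hd1, hdl, p, hp, hp0, hpd⟩, e, q, hq, hq0, hqe⟩ := hy
    -- No arc inside `Y` leaves Z, so a walk that ends outside Z also starts outside.
    have huZ : u ∉ Z := by
      intro hu
      have : ∀ i ≤ e, q i ∈ Z := fun i => by
        induction i with
        | zero => intro _; rwa [hq0]
        | succ i ih =>
          intro hi
          by_contra hn
          exact hcl _ (ih (by omega)) _ (hq.1 _ hi) hn (hq.2 i (by omega))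
      exact hyZ (hqe ▸ this e le_rfl)
    have hI : (p '' Set.Iio d).ncard ≤ d :=
      (Set.ncard_image_le (Set.toFinite _)).trans (by simp)
    have hp' : ∀ i ≤ d, p i ∈ p '' Set.Iio d := by
      intro i hi
      by_cases h : i = d
      · exact ⟨0, by simp; omega, by rw [h, hp0, hpd]⟩
      · exact ⟨i, by simp; omega, rfl⟩
    have h1 : Z ∪ p '' Set.Iio d = Y := by
      refine key _ (Set.union_subset hZY ?_) (Set.union_subset
        (hZ.trans (core_mono Set.subset_union_left le_rfl)) ?_) ?_
      · rintro _ ⟨i, hi, rfl⟩; exact hp.1 i (by simp at hi; omega)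
      · have hw : IsWalk E (Z ∪ p '' Set.Iio d) d p := ⟨fun i hi => .inr (hp' i hi), hp.2⟩
        have h0 : p 0 ∈ core E (Z ∪ p '' Set.Iio d) l := by
          refine onCycle_subset_core ⟨d, hd1, hdl, ?_⟩
          have := hw.walk (Nat.zero_le d) le_rfl
          rw [hpd, ← hp0] at this
          simpa using this
        rintro _ ⟨i, hi, rfl⟩
        exact (hw.walk (Nat.zero_le i) (by simp at hi; omega)).mem_core h0
      · refine Set.ncard_lt_ncard (Set.ssubset_iff_subset_ne.2 ⟨Set.subset_union_left, fun h => ?_⟩)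
          (Set.toFinite _)
        refine huZ (h ▸ .inr ⟨0, by simp; omega, hp0⟩)
    rw [← h1]
    exact (Set.ncard_union_le _ _).trans (by omega)

end IsMinimalCore

/-! ### Connectedness and components of the underlying graph. -/

/-- Adjacency in the underlying undirected graph, inside `A`. -/
def UAdj (E : V → V → Prop) (A : Set V) (u v : V) : Prop := u ∈ A ∧ v ∈ A ∧ (E u v ∨ E v u)

/-- `A` induces a connected underlying graph. -/
def Conn (E : V → V → Prop) (A : Set V) : Prop :=
  ∀ u ∈ A, ∀ v ∈ A, Relation.ReflTransGen (UAdj E A) u v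

/-- The component of `v` in the underlying graph induced by `A`. -/
def comp (E : V → V → Prop) (A : Set V) (v : V) : Set V :=
  {w | v ∈ A ∧ Relation.ReflTransGen (UAdj E A) v w}

theorem UAdj.symm {A : Set V} {u v : V} (h : UAdj E A u v) : UAdj E A v u :=
  ⟨h.2.1, h.1, h.2.2.symm⟩

theorem UAdj.mono {A B : Set V} (hAB : A ⊆ B) {u v : V} (h : UAdj E A u v) : UAdj E B u v :=
  ⟨hAB h.1, hAB h.2.1, h.2.2⟩

theorem uReach_symm {A : Set V} {u v : V} (h : Relation.ReflTransGen (UAdj E A) u v) :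
    Relation.ReflTransGen (UAdj E A) v u :=
  haveI : Std.Symm (UAdj E A) := ⟨fun _ _ => UAdj.symm⟩
  Relation.ReflTransGen.stdSymm.symm _ _ h

theorem uReach_mono {A B : Set V} (hAB : A ⊆ B) {u v : V}
    (h : Relation.ReflTransGen (UAdj E A) u v) : Relation.ReflTransGen (UAdj E B) u v :=
  Relation.ReflTransGen.mono (fun _ _ => UAdj.mono hAB) _ _ h

theorem comp_subset {A : Set V} {v : V} : comp E A v ⊆ A := by
  rintro w ⟨hv, h⟩
  rcases Relation.ReflTransGen.cases_tail h with rfl | ⟨x, -, hx⟩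
  · exact hv
  · exact hx.2.1

theorem self_mem_comp {A : Set V} {v : V} (hv : v ∈ A) : v ∈ comp E A v := ⟨hv, .refl⟩

theorem mem_comp_of_uAdj {A : Set V} {v x y : V} (hx : x ∈ comp E A v) (h : UAdj E A x y) :
    y ∈ comp E A v := ⟨hx.1, hx.2.tail h⟩

theorem uReach_comp {A : Set V} {v w : V} (hw : w ∈ comp E A v) :
    Relation.ReflTransGen (UAdj E (comp E A v)) v w := by
  obtain ⟨hv, h⟩ := hw
  induction h with
  | refl => exact .refl
  | tail h1 h2 ih => exact ih.tail ⟨⟨hv, h1⟩, ⟨hv, h1.tail h2⟩, h2.2.2⟩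

theorem conn_comp (A : Set V) (v : V) : Conn E (comp E A v) :=
  fun _ hu _ hw => (uReach_symm (uReach_comp hu)).trans (uReach_comp hw)

theorem Conn.subset_comp {A X : Set V} (hX : Conn E X) (hXA : X ⊆ A) {v : V} (hv : v ∈ X) :
    X ⊆ comp E A v := fun w hw => ⟨hXA hv, uReach_mono hXA (hX v hv w hw)⟩

theorem conn_union {A S : Set V} {r : V} (hr : r ∈ A) (hA : Conn E A)
    (hS : ∀ x ∈ S, ∃ u ∈ A, E u x ∨ E x u) : Conn E (A ∪ S) := by
  have h : ∀ x ∈ A ∪ S, Relation.ReflTransGen (UAdj E (A ∪ S)) r x := by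
    rintro x (hx | hx)
    · exact uReach_mono Set.subset_union_left (hA r hr x hx)
    · obtain ⟨u, hu, h⟩ := hS x hx
      exact (uReach_mono Set.subset_union_left (hA r hr u hu)).tail ⟨.inl hu, .inr hx, h⟩
  exact fun u hu v hv => (uReach_symm (h u hu)).trans (h v hv)

/-- A walk that stays inside `A` stays inside a component. -/
theorem Walk.mem_comp {A : Set V} {d : ℕ} {u v : V} (h : Walk E A d u v) : v ∈ comp E A u := by
  induction d generalizing v with
  | zero => obtain ⟨p, hp, rfl, rfl⟩ := h; exact self_mem_comp (hp.1 0 le_rfl)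
  | succ d ih =>
    obtain ⟨hv, w, hw, hE⟩ := walk_succ.1 h
    exact mem_comp_of_uAdj (ih hw) ⟨hw.mem_right, hv, .inl hE⟩

/-- There are disjoint sets `X` and `Z` such that `X` is connected with at least `k₁` vertices and
`Z` has minimum in-degree at least `1` and at least `k₂` vertices. -/
def HasPair (E : V → V → Prop) (k₁ k₂ : ℕ) : Prop :=
  ∃ X Z : Set V, Disjoint X Z ∧ Conn E X ∧ k₁ ≤ X.ncard ∧ (∀ v ∈ Z, ∃ u ∈ Z, E u v) ∧ k₂ ≤ Z.ncard

theorem hasPair_of_disjoint_core {A X : Set V} {l k₁ k₂ : ℕ} (hXA : Disjoint X A) (hX : Conn E X)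
    (h₁ : k₁ ≤ X.ncard) (h₂ : k₂ ≤ (core E A l).ncard) : HasPair E k₁ k₂ :=
  ⟨X, core E A l, hXA.mono_right core_subset, hX, h₁, fun _ => exists_pred_of_mem_core, h₂⟩

end ConnIn

/-! ### Shortest cycles and bypasses. -/

namespace ConnIn

variable {V : Type*} {E : V → V → Prop}

/-- `c` runs periodically through the vertices of a closed walk of length `l` in `A`, none of which
lies on a shorter closed walk of `A`. -/
structure IsShortestCycle (E : V → V → Prop) (A : Set V) (l : ℕ) (c : ℤ → V) : Prop where
  pos : 0 < l
  periodic : Function.Periodic c (l : ℤ)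
  adj : ∀ i, E (c i) (c (i + 1))
  mem : ∀ i, c i ∈ A
  not_walk : ∀ i d, 1 ≤ d → d < l → ¬ Walk E A d (c i) (c i)

namespace IsShortestCycle

variable {A : Set V} {l : ℕ} {c : ℤ → V}

theorem apply_add_mul (hc : IsShortestCycle E A l c) (i t : ℤ) : c (i + t * l) = c i :=
  hc.periodic.int_mul t i

theorem walk (hc : IsShortestCycle E A l c) (i : ℤ) (m : ℕ) : Walk E A m (c i) (c (i + m)) := by
  induction m with
  | zero => simpa using Walk.zero (hc.mem i)
  | succ m ih =>
    refine walk_succ.2 ⟨hc.mem _, _, ih, ?_⟩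
    have := hc.adj (i + m)
    rwa [add_assoc] at this

theorem exists_offset (hc : IsShortestCycle E A l c) {v : V} (hv : v ∈ Set.range c) (q : ℤ) :
    ∃ o : ℤ, 0 ≤ o ∧ o < l ∧ v = c (q + o) := by
  obtain ⟨z, rfl⟩ := hv
  have hl : (0 : ℤ) < l := by exact_mod_cast hc.pos
  refine ⟨(z - q) % l, Int.emod_nonneg _ hl.ne', Int.emod_lt_of_pos _ hl, ?_⟩
  rw [← hc.apply_add_mul (q + (z - q) % l) ((z - q) / l)]
  congr 1
  have := Int.emod_add_mul_ediv (z - q) l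
  linarith [mul_comm (l : ℤ) ((z - q) / l)]

/-- A walk cannot advance on a shortest cycle faster than the cycle itself. -/
theorem exists_shift (hc : IsShortestCycle E A l c) {d : ℕ} {i j : ℤ}
    (h : Walk E A d (c i) (c j)) : ∃ e t : ℤ, 0 ≤ e ∧ e ≤ d ∧ j = i + e + t * l := by
  have hl : (0 : ℤ) < l := by exact_mod_cast hc.pos
  have h0 := Int.emod_nonneg (j - i) hl.ne'
  have h1 := Int.emod_lt_of_pos (j - i) hl
  have h2 := Int.emod_add_mul_ediv (j - i) l
  refine ⟨(j - i) % l, (j - i) / l, h0, ?_, by linarith [mul_comm (l : ℤ) ((j - i) / l)]⟩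
  by_contra hlt
  push Not at hlt
  generalize (j - i) % l = e at *
  generalize (j - i) / l = t at *
  obtain ⟨e, rfl⟩ := Int.eq_ofNat_of_zero_le h0
  -- If the walk were shorter than the distance e from `c i` to `c j` on the cycle, returning along
  -- the cycle would close it to a walk of length d + l - e < l.
  have hw := h.trans (hc.walk j (l - e))
  have : j + ((l - e : ℕ) : ℤ) = i + (t + 1) * l := by
    rw [Nat.cast_sub (by omega)]
    linarith [mul_comm (l : ℤ) t]
  rw [this, hc.apply_add_mul] at hw
  exact hc.not_walk i _ (by omega) (by omega) hw

theorem eq_add_mul (hc : IsShortestCycle E A l c) {i j : ℤ} (h : c i = c j) :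
    ∃ t : ℤ, j = i + t * l := by
  obtain ⟨e, t, h1, h2, h3⟩ := hc.exists_shift (i := i) (j := j) (d := 0)
    (by rw [← h]; exact .zero (hc.mem i))
  obtain rfl : e = 0 := by push_cast at h2; omega
  exact ⟨t, by linarith⟩

theorem eq_of_abs_lt (hc : IsShortestCycle E A l c) {i j : ℤ} (h : c i = c j)
    (hij : |i - j| < l) : i = j := by
  obtain ⟨t, rfl⟩ := hc.eq_add_mul h
  have ht : t = 0 := by
    by_contra ht
    have h1 : 1 ≤ |t| := Int.one_le_abs ht
    rw [show i - (i + t * l) = -(t * l) by ring, abs_neg, abs_mul, Nat.abs_cast] at hij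
    nlinarith
  simp [ht]

theorem le_ncard_range [Finite V] (hc : IsShortestCycle E A l c) : l ≤ (Set.range c).ncard := by
  have hinj : Function.Injective fun i : Fin l => c (i : ℤ) := by
    intro i j h
    have := hc.eq_of_abs_lt h (by rw [abs_lt]; constructor <;> omega)
    exact Fin.ext (by exact_mod_cast this)
  have := Set.ncard_le_ncard (s := Set.range fun i : Fin l => c (i : ℤ)) (t := Set.range c)
    (by rintro _ ⟨i, rfl⟩; exact ⟨_, rfl⟩)
  rwa [← Set.image_univ, Set.ncard_image_of_injective _ hinj, Set.ncard_univ, Nat.card_fin] at this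

/-- The vertices at distance at most `r` from `x` on the cycle. -/
def near (c : ℤ → V) (r : ℕ) (x : V) : Set V := {y | ∃ i j : ℤ, c i = x ∧ c j = y ∧ |i - j| ≤ r}

theorem near_comm {r : ℕ} {x y : V} : y ∈ near c r x ↔ x ∈ near c r y :=
  ⟨fun ⟨i, j, h1, h2, h3⟩ => ⟨j, i, h2, h1, by rwa [abs_sub_comm]⟩,
    fun ⟨i, j, h1, h2, h3⟩ => ⟨j, i, h2, h1, by rwa [abs_sub_comm]⟩⟩

theorem ncard_near_le (hc : IsShortestCycle E A l c) (r : ℕ) (x : V) :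
    (near c r x).ncard ≤ 2 * r + 1 := by
  by_cases hx : x ∈ Set.range c
  · obtain ⟨q, rfl⟩ := hx
    have hsub : near c r (c q) ⊆ (fun j : ℕ => c (q - r + j)) '' Set.Iio (2 * r + 1) := by
      rintro y ⟨i, j, h1, rfl, h3⟩
      obtain ⟨t, rfl⟩ := hc.eq_add_mul h1.symm
      rw [abs_le] at h3
      refine ⟨(j - t * l - (q - r)).toNat, by simp only [Set.mem_Iio]; omega, ?_⟩
      simp only
      rw [Int.toNat_of_nonneg (by omega), ← hc.apply_add_mul _ t]
      congr 1
      ring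
    have hfin : ((fun j : ℕ => c (q - r + j)) '' Set.Iio (2 * r + 1)).Finite :=
      (Set.finite_Iio _).image _
    refine (Set.ncard_le_ncard hsub hfin).trans ((Set.ncard_image_le (Set.finite_Iio _)).trans ?_)
    simp
  · rw [show near c r x = ∅ from Set.eq_empty_of_forall_notMem
      fun y ⟨i, _, h, _⟩ => hx ⟨i, h⟩]
    simp

end IsShortestCycle

/-- The core of `Y` is too large to lie in `core E A (l - 1)`. A vertex outside the latter is
reached from a closed walk in `Y` whose vertices also lie outside. So this walk has length exactly
`l`, and its `l` vertices are distinct. As `k ≤ l`, they form a large enough core on their own, and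
minimality makes them all of `Y`. -/
theorem exists_isShortestCycle {A Y : Set V} {k l : ℕ} [Finite V] (hY : IsMinimalCore E k l Y)
    (hYA : Y ⊆ A) (hl : 0 < l) (hkl : k ≤ l) (hlt : (core E A (l - 1)).ncard < k) :
    ∃ c, IsShortestCycle E A l c ∧ Set.range c = Y := by
  obtain ⟨y, hy, hyW⟩ := Set.exists_mem_notMem_of_ncard_lt_ncard (hlt.trans_le hY.le_ncard)
  obtain ⟨u, ⟨d, hd1, hdl, p, hp, hp0, hpd⟩, e, huy⟩ := hy
  have hlA : ∀ i ≤ d, p i ∉ core E A (l - 1) := by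
    intro i hi h
    have h2 : Walk E A e (p d) y := by rw [hpd]; exact huy.mono hYA
    exact hyW (Walk.mem_core (((hp.walk hi le_rfl).mono hYA).trans h2) h)
  have hdl' : d = l := by
    by_contra hne
    refine hlA 0 (Nat.zero_le _) (onCycle_subset_core ⟨d, hd1, by omega, ?_⟩)
    have := (hp.walk (Nat.zero_le d) le_rfl).mono hYA
    rw [hpd, ← hp0] at this
    simpa using this
  subst hdl'
  have hdZ : (0 : ℤ) < d := by exact_mod_cast hl
  have hper : Function.Periodic (fun i : ℤ => p (i % d).toNat) (d : ℤ) := fun i => by simp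
  have hlt' : ∀ i : ℤ, (i % d).toNat < d := fun i => by
    have := Int.emod_lt_of_pos i hdZ
    omega
  have hc : IsShortestCycle E A d fun i : ℤ => p (i % d).toNat := by
    refine ⟨hl, hper, fun i => ?_, fun i => hYA (hp.1 _ (hlt' i).le), fun i e he1 he h => ?_⟩
    · have h0 := Int.emod_nonneg i hdZ.ne'
      have h1 := hlt' i
      have h2 : (i + 1) % d = (i % d + 1) % d := by simp
      by_cases h3 : (i % d).toNat + 1 < d
      · rw [h2, Int.emod_eq_of_lt (a := i % d + 1) (by omega) (by omega),
          Int.toNat_add h0 (by omega)]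
        exact hp.2 _ h1
      · have h4 : i % d + 1 = d := by omega
        rw [h2, h4, Int.emod_self, Int.toNat_zero, hp0, ← hpd]
        have := hp.2 _ h1
        rwa [show (i % d).toNat + 1 = d by omega] at this
    · exact hlA _ (hlt' i).le (onCycle_subset_core ⟨e, he1, by omega, h⟩)
  refine ⟨_, hc, hY.eq_of_subset ?_ ?_ (hkl.trans hc.le_ncard_range)⟩
  · rintro _ ⟨i, rfl⟩; exact hp.1 _ (hlt' i).le
  · set c := fun i : ℤ => p (i % d).toNat with hcdef
    have hc' : IsShortestCycle E (Set.range c) d c := ⟨hl, hper, hc.adj, fun i => ⟨i, rfl⟩,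
      fun i e h1 h2 h => hc.not_walk i e h1 h2 (h.mono (Set.range_subset_iff.2 hc.mem))⟩
    rintro _ ⟨i, rfl⟩
    refine onCycle_subset_core ⟨d, hd1, le_rfl, ?_⟩
    have := hc'.walk i d
    rwa [hper i] at this

/-- The walk `p` bypasses the vertex `x` of the cycle `c` with vertex set `Y`: it leads from the
vertex `a` steps before `x` to the vertex `b` steps behind `x`, with no inner vertex in `Y`. -/
structure IsBypass (E : V → V → Prop) (A Y : Set V) (c : ℤ → V) (k : ℕ) (x : V) (a b : ℤ) (d : ℕ)
    (p : ℕ → V) : Prop where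
  one_le_left : 1 ≤ a
  one_le_right : 1 ≤ b
  add_le : a + b ≤ k
  one_le : 1 ≤ d
  le : d ≤ k
  isWalk : IsWalk E A d p
  notMem : ∀ i, 0 < i → i < d → p i ∉ Y
  ends : ∀ q, c q = x → p 0 = c (q - a) ∧ p d = c (q + b)

/-- The core that avoids `x` is too large for `core E A (l - 1)`, so there is a closed walk that
avoids `x` and has no vertex on a closed walk shorter than `l`. It comes back to the cycle within
every `k₁` steps and never advances faster than the cycle itself. Hence it can go on forever only by
jumping over `x`. -/
theorem exists_isBypass [Finite V] {A : Set V} {k₁ k₂ l n : ℕ} {c : ℤ → V}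
    (hc : IsShortestCycle E A l c) (hW : (core E A (l - 1)).ncard < k₂) (hkl : k₁ < l)
    (hcomp : ∀ v, (comp E (Set.range c)ᶜ v).ncard < k₁) {x : V} (hx : x ∈ Set.range c)
    (hfree : k₂ ≤ (core E (A \ {x}) n).ncard) :
    ∃ a b d p, IsBypass E A (Set.range c) c k₁ x a b d p := by
  have hl : (0 : ℤ) < l := by exact_mod_cast hc.pos
  obtain ⟨q, rfl⟩ := hx
  obtain ⟨y, hy, hyW⟩ := Set.exists_mem_notMem_of_ncard_lt_ncard (hW.trans_le hfree)
  obtain ⟨u, ⟨D, hD1, -, p, hp, hp0, hpD⟩, e, huy⟩ := hy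
  have hsub : A \ {c q} ⊆ A := Set.sdiff_subset
  have hpW : ∀ i ≤ D, p i ∉ core E A (l - 1) := by
    intro i hi h
    have h2 : Walk E A e (p D) y := by rw [hpD]; exact huy.mono hsub
    exact hyW (Walk.mem_core (((hp.walk hi le_rfl).mono hsub).trans h2) h)
  -- The closed walk is traversed periodically; outside `core E A (l - 1)` it cannot repeat a vertex
  -- within fewer than l steps.
  obtain ⟨g, hgdef⟩ : ∃ g : ℕ → V, ∀ i, g i = p (i % D) := ⟨_, fun _ => rfl⟩
  have hgA : ∀ i, g i ∈ A \ {c q} := fun i => hgdef i ▸ hp.1 _ (Nat.mod_lt _ hD1).le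
  have hgW : ∀ i, g i ∉ core E A (l - 1) := fun i => hgdef i ▸ hpW _ (Nat.mod_lt _ hD1).le
  have hgE : ∀ i, E (g i) (g (i + 1)) := by
    intro i
    have h1 := Nat.mod_lt i hD1
    have h2 : (i + 1) % D = (i % D + 1) % D := by simp
    rw [hgdef, hgdef, h2]
    by_cases h3 : i % D + 1 < D
    · rw [Nat.mod_eq_of_lt h3]; exact hp.2 _ h1
    · have h4 : i % D + 1 = D := by omega
      rw [h4, Nat.mod_self, hp0, ← hpD]
      have := hp.2 _ h1
      rwa [h4] at this
  have hgw : ∀ i d, IsWalk E A d fun m => g (i + m) :=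
    fun i d => ⟨fun m _ => hsub (hgA _), fun m _ => hgE _⟩
  have hgne : ∀ i d, 1 ≤ d → d < l → g i ≠ g (i + d) := by
    intro i d h1 h2 h
    refine hgW i (onCycle_subset_core ⟨d, h1, by omega, _, hgw i d, rfl, h.symm⟩)
  -- Otherwise k₁ consecutive vertices, distinct since k₁ < l, lie in one component off the cycle.
  have hvisit : ∀ i, ∃ j, j < k₁ ∧ g (i + j) ∈ Set.range c := by
    intro i
    by_contra hno
    push Not at hno
    have hin : ∀ j < k₁, g (i + j) ∈ comp E (Set.range c)ᶜ (g i) := by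
      intro j hj
      have : IsWalk E (Set.range c)ᶜ j fun m => g (i + m) :=
        ⟨fun m hm => hno m (by omega), fun m _ => hgE _⟩
      exact Walk.mem_comp ⟨_, this, rfl, rfl⟩
    have hinj : Set.InjOn (fun j => g (i + j)) (Set.Iio k₁) := by
      intro s hs t ht h
      by_contra hne
      wlog hst : s < t generalizing s t
      · exact this ht hs h.symm (Ne.symm hne) (by omega)
      simp only [Set.mem_Iio] at hs ht
      refine hgne (i + s) (t - s) (by omega) (by omega) ?_
      rw [show i + s + (t - s) = i + t by omega]
      exact h
    have := Set.ncard_le_ncard (s := (fun j => g (i + j)) '' Set.Iio k₁)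
      (by rintro _ ⟨j, hj, rfl⟩; exact hin j hj) (Set.toFinite _)
    rw [hinj.ncard_image, show (Set.Iio k₁).ncard = k₁ by simp] at this
    have := hcomp (g i)
    omega
  have hoff : ∀ i, g i ∈ Set.range c → ∃ o : ℤ, 0 < o ∧ o < l ∧ g i = c (q + o) := by
    intro i hi
    obtain ⟨o, h1, h2, h3⟩ := hc.exists_offset hi q
    refine ⟨o, lt_of_le_of_ne h1 ?_, h2, h3⟩
    rintro rfl
    exact (hgA i).2 (by simpa using h3)
  -- Offsets are measured from `x`, which is avoided, so they are strictly between 0 and l. The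
  -- bypass starts at a visit with the greatest offset and ends at the next visit.
  obtain ⟨o, ⟨ho0, hol, i, hi⟩, hmax⟩ := Int.exists_greatest_of_bdd
    (P := fun o => 0 < o ∧ o < l ∧ ∃ i, g i = c (q + o)) ⟨l, fun z hz => hz.2.1.le⟩ (by
      obtain ⟨j, -, hj⟩ := hvisit 0
      obtain ⟨o, h1, h2, h3⟩ := hoff _ hj
      exact ⟨o, h1, h2, _, h3⟩)
  classical
  have hex : ∃ j, g (i + 1 + j) ∈ Set.range c := (hvisit (i + 1)).imp fun _ h => h.2
  have hjk : Nat.find hex < k₁ := by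
    obtain ⟨j, h1, h2⟩ := hvisit (i + 1)
    exact (Nat.find_min' hex h2).trans_lt h1
  have hjs := Nat.find_spec hex
  have hjm : ∀ m < Nat.find hex, g (i + 1 + m) ∉ Set.range c := fun m hm => Nat.find_min hex hm
  generalize Nat.find hex = j at *
  obtain ⟨o', ho'0, ho'l, hj⟩ := hoff _ hjs
  have ho' : o' ≤ o := hmax o' ⟨ho'0, ho'l, _, hj⟩
  have hij : i + 1 + j = i + (j + 1) := by omega
  obtain ⟨s, t, hs0, hsd, hst⟩ := hc.exists_shift (d := j + 1) (i := q + o) (j := q + o')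
    ⟨_, hgw i (j + 1), hi, by rw [← hj, hij]⟩
  push_cast at hsd
  -- The walk advances by s ≤ j + 1 < l, but from the greatest offset o it arrives at o' ≤ o.
  -- Equality would close a walk shorter than l. So it has passed the end of the period, where `x`
  -- is, exactly once.
  have ht : t = -1 ∧ s ≠ 0 := by
    have h1 : o' = o + s + t * l := by linarith
    have hsl : s < l := by omega
    constructor
    · by_contra hne
      rcases lt_or_gt_of_ne hne with h | h
      · nlinarith
      · have h0 : t = 0 := by
          by_contra h0
          have : 1 ≤ t := by omega
          nlinarith
        subst h0
        have : o' = o := by linarith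
        refine hgne i (j + 1) (by omega) (by omega) ?_
        rw [← hij, hj, hi, this]
    · rintro rfl
      rcases lt_trichotomy t 0 with h | h | h
      · nlinarith
      · subst h
        have : o' = o := by linarith
        refine hgne i (j + 1) (by omega) (by omega) ?_
        rw [← hij, hj, hi, this]
      · nlinarith
  obtain ⟨rfl, hs⟩ := ht
  -- The distances l - o and o' of the two ends from `x` add up to s ≤ j + 1 ≤ k₁.
  refine ⟨l - o, o', j + 1, fun m => g (i + m), by omega, by omega, ?_, by omega, by omega,
    hgw i _, ?_, ?_⟩
  · have : o' = o + s - l := by linarith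
    omega
  · intro m hm0 hm
    have := hjm (m - 1) (by omega)
    rwa [show i + 1 + (m - 1) = i + m by omega] at this
  · intro q' hq'
    obtain ⟨t, rfl⟩ := hc.eq_add_mul hq'.symm
    constructor
    · have := hc.apply_add_mul (q + o) (t - 1)
      simp only [add_zero]
      rw [hi, ← this]
      congr 1; ring
    · rw [← hij, hj, ← hc.apply_add_mul (q + o') t]
      congr 1; ring

end ConnIn

/-! ### Many candidates imply a pair. -/

namespace ConnIn

variable {V : Type*} {E : V → V → Prop}

/-- Greedy choice: each chosen element excludes at most `D` elements of `F`. -/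
theorem exists_subset_pairwise_notMem [Finite V] (N : V → Set V) {D : ℕ} (hD : 0 < D)
    (hN : ∀ x, (N x).ncard ≤ D) (hsymm : ∀ x y, y ∈ N x → x ∈ N y) (m : ℕ) (F : Set V)
    (hself : ∀ x ∈ F, x ∈ N x) (hF : m * D ≤ F.ncard) :
    ∃ S ⊆ F, S.ncard = m ∧ ∀ x ∈ S, ∀ y ∈ S, x ≠ y → y ∉ N x := by
  induction m generalizing F with
  | zero => exact ⟨∅, Set.empty_subset _, by simp, by simp⟩
  | succ m ih =>
    have h1 : (m + 1) * D = m * D + D := by ring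
    obtain ⟨x, hx⟩ : F.Nonempty := Set.nonempty_of_ncard_ne_zero (by omega)
    have h2 := Set.le_ncard_sdiff (N x) F
    have h3 := hN x
    obtain ⟨S, hS, hm, hp⟩ := ih (F \ N x) (fun y hy => hself y hy.1) (by omega)
    have hxS : x ∉ S := fun h => (hS h).2 (hself x hx)
    refine ⟨insert x S, Set.insert_subset hx (hS.trans Set.sdiff_subset), ?_, ?_⟩
    · rw [Set.ncard_insert_of_notMem hxS, hm]
    · rintro y (rfl | hy) z (rfl | hz) hne
      · exact absurd rfl hne
      · exact (hS hz).2
      · exact fun h => (hS hy).2 (hsymm _ _ h)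
      · exact hp y hy z hz hne

/-- If many vertices of a minimal core `Y` that are adjacent to one component of the rest can
individually be avoided, then there is a pair as wanted. -/
theorem hasPair_of_many [Finite V] {A Y F : Set V} {k₁ k₂ l n : ℕ} {r : V}
    (hY : IsMinimalCore E k₂ l Y) (hYA : Y ⊆ A) (hlt : ∀ l' < l, (core E A l').ncard < k₂)
    (hF : ∀ x ∈ F, x ∈ Y ∧ (∃ u ∈ comp E Yᶜ r, E u x ∨ E x u) ∧
      k₂ ≤ (core E (A \ {x}) n).ncard)
    (hM : 2 * k₂ + 2 * k₁ * (4 * k₁ + 1) < F.ncard) : HasPair E k₁ k₂ := by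
  by_cases hcomp : ∃ v, k₁ ≤ (comp E Yᶜ v).ncard
  · obtain ⟨v, hv⟩ := hcomp
    exact hasPair_of_disjoint_core (disjoint_compl_left.mono_left comp_subset)
      (conn_comp _ _) hv hY.le_ncard
  push Not at hcomp
  have hk₁ : 0 < k₁ := (Nat.zero_le _).trans_lt (hcomp r)
  -- The candidates lie in `Y`, and |Y| ≤ k₂ + l.
  have hl : k₂ + 2 * k₁ * (4 * k₁ + 1) < l := by
    have h1 : F.ncard ≤ Y.ncard := Set.ncard_le_ncard fun x hx => (hF x hx).1
    have h2 := hY.ncard_le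
    omega
  have hl2 : 2 * k₁ < l := by nlinarith
  obtain ⟨c, hc, rfl⟩ := exists_isShortestCycle hY hYA (by omega) (by omega) (hlt _ (by omega))
  have hby : ∀ x ∈ F, ∃ a b d p, IsBypass E A (Set.range c) c k₁ x a b d p := fun x hx =>
    exists_isBypass hc (hlt _ (by omega)) (by omega) hcomp (hF x hx).1 (hF x hx).2.2
  choose! a b d p hp using hby
  have hself : ∀ x ∈ F, x ∈ IsShortestCycle.near c (2 * k₁) x := by
    intro x hx
    obtain ⟨q, hq⟩ := (hF x hx).1
    exact ⟨q, q, hq, hq, by simp⟩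
  -- A ball of radius 2k₁ on the cycle has at most 4k₁ + 1 vertices. The choice of 2k₁ centres
  -- allows for the loss of fewer than k₁ of them below.
  obtain ⟨S, hSF, hSm, hS⟩ := exists_subset_pairwise_notMem (IsShortestCycle.near c (2 * k₁))
    (D := 4 * k₁ + 1) (by omega) (fun x => (hc.ncard_near_le _ x).trans (by omega))
    (fun x y => IsShortestCycle.near_comm.1) (2 * k₁) F hself (by omega)
  set K := comp E (Set.range c)ᶜ r with hK
  -- the chosen vertices whose bypasses meet the component
  set B := {x ∈ S | ∃ i, 0 < i ∧ i < d x ∧ p x i ∈ K} with hB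
  -- Bypasses of different chosen vertices meet K in different vertices. Through a common one there
  -- would be a walk of at most 2k₁ steps from shortly before x to shortly behind y; since it is not
  -- faster than the cycle, x and y would be within distance 2k₁.
  have hBK : B.ncard ≤ K.ncard := by
    have hex : ∀ x ∈ B, ∃ i, 0 < i ∧ i < d x ∧ p x i ∈ K := fun x hx => hx.2
    choose! i hi0 hid hiK using hex
    refine Set.ncard_le_ncard_of_injOn (fun x => p x (i x)) hiK ?_ (Set.toFinite _)
    intro x hx y hy hxy
    by_contra hne
    have hbx := hp x (hSF hx.1)
    have hby := hp y (hSF hy.1)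
    obtain ⟨q, hq⟩ := (hF x (hSF hx.1)).1
    obtain ⟨q', hq'⟩ := (hF y (hSF hy.1)).1
    have hw1 := hbx.isWalk.walk (Nat.zero_le _) (hid x hx).le
    have hw2 := hby.isWalk.walk (hid y hy).le le_rfl
    simp only at hxy
    rw [← hxy] at hw2
    have hw := hw1.trans hw2
    rw [(hbx.ends q hq).1, (hby.ends q' hq').2] at hw
    obtain ⟨e, t, he0, hed, ht⟩ := hc.exists_shift hw
    have h1 := hid x hx
    have h2 := hid y hy
    have h3 := hbx.le
    have h4 := hby.le
    have h5 := hbx.one_le_left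
    have h6 := hbx.one_le_right
    have h7 := hby.one_le_left
    have h8 := hby.one_le_right
    have h9 := hbx.add_le
    have h10 := hby.add_le
    refine hS x hx.1 y hy.1 hne ⟨q, q' - t * l, hq, ?_, ?_⟩
    · rw [← hq', ← hc.apply_add_mul (q' - t * l) t]
      congr 1
      ring
    · have h11 : q - (q' - t * l) = a x + b y - e := by linarith
      rw [h11, abs_le]
      push_cast at *
      omega
  have hSB : k₁ ≤ (S \ B).ncard := by
    have h1 := Set.le_ncard_sdiff B S
    have h2 : K.ncard < k₁ := hcomp r
    omega
  have hSB2 : (S \ B).ncard ≤ 2 * k₁ := hSm ▸ Set.ncard_le_ncard Set.sdiff_subset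
  have hTF : S \ B ⊆ F := Set.sdiff_subset.trans hSF
  -- the bypassed vertices are far apart, also from their own copies
  have hfar : ∀ q q' : ℤ, c q ∈ S \ B → c q' ∈ S \ B → |q - q'| ≤ 2 * k₁ → q = q' := by
    intro q q' hq hq' h
    by_cases hne : c q = c q'
    · exact hc.eq_of_abs_lt hne (by omega)
    · exact absurd ⟨q, q', rfl, rfl, by exact_mod_cast h⟩ (hS _ hq.1 _ hq'.1 hne)
  -- No bypass starts strictly inside a stretch of the cycle that is skipped by a bypass.
  have hend : ∀ q, c q ∈ S \ B → ∀ q', c q' ∈ S \ B →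
      ¬ (q' - a (c q') < q - a (c q) ∧ q - a (c q) < q' + b (c q')) := by
    rintro q hq q' hq' ⟨h1, h2⟩
    have hbx := hp _ (hTF hq)
    have hby := hp _ (hTF hq')
    have h3 := hbx.add_le
    have h4 := hby.add_le
    have h5 := hbx.one_le_left
    have h6 := hbx.one_le_right
    have h7 := hby.one_le_left
    have h8 := hby.one_le_right
    obtain rfl := hfar q q' hq hq' (by rw [abs_le]; constructor <;> omega)
    omega
  -- The rerouted cycle consists of the cycle vertices that are not skipped and of the inner
  -- vertices of the bypasses.
  set Z₁ := {v | ∃ i : ℤ, c i = v ∧ ∀ q, c q ∈ S \ B → ¬ (q - a (c q) < i ∧ i < q + b (c q))}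
    with hZ₁
  set Z₂ := {v | ∃ x ∈ S \ B, ∃ i, 0 < i ∧ i < d x ∧ p x i = v} with hZ₂
  have hstart : ∀ x ∈ S \ B, p x 0 ∈ Z₁ := by
    intro x hx
    obtain ⟨q, rfl⟩ := (hF x (hTF hx)).1
    exact ⟨q - a (c q), ((hp _ (hTF hx)).ends q rfl).1.symm, hend q hx⟩
  have hprev : ∀ x ∈ S \ B, ∀ i, i < d x → p x i ∈ Z₁ ∪ Z₂ := by
    intro x hx i hi
    rcases Nat.eq_zero_or_pos i with rfl | h
    · exact .inl (hstart x hx)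
    · exact .inr ⟨x, hx, i, h, hi, rfl⟩
  refine ⟨K ∪ (S \ B), Z₁ ∪ Z₂, ?_, ?_, ?_, ?_, ?_⟩
  · rw [Set.disjoint_left]
    rintro v (hv | hv) (⟨i, rfl, hi⟩ | ⟨x, hx, i, hi0, hid, rfl⟩)
    · exact comp_subset hv ⟨i, rfl⟩
    · exact hx.2 ⟨hx.1, i, hi0, hid, hv⟩
    · have h5 := (hp _ (hTF hv)).one_le_left
      have h6 := (hp _ (hTF hv)).one_le_right
      exact hi i hv ⟨by omega, by omega⟩
    · exact (hp _ (hTF hx)).notMem i hi0 hid (hF _ (hTF hv)).1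
  · obtain ⟨x, hx⟩ : (S \ B).Nonempty := Set.nonempty_of_ncard_ne_zero (by omega)
    obtain ⟨u, hu, -⟩ := (hF x (hTF hx)).2.1
    exact conn_union hu (conn_comp _ _) fun x hx => (hF x (hTF hx)).2.1
  · exact hSB.trans (Set.ncard_le_ncard Set.subset_union_right)
  · rintro v (⟨i, rfl, hi⟩ | ⟨x, hx, i, hi0, hid, rfl⟩)
    · by_cases hi' : ∀ q, c q ∈ S \ B → ¬ (q - a (c q) < i - 1 ∧ i - 1 < q + b (c q))
      · refine ⟨c (i - 1), .inl ⟨i - 1, rfl, hi'⟩, ?_⟩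
        have := hc.adj (i - 1)
        rwa [sub_add_cancel] at this
      -- If the predecessor on the cycle is skipped but `c i` is not, then `c i` is the end of a
      -- bypass, and its predecessor there serves.
      · push Not at hi'
        obtain ⟨q, hq, h1, h2⟩ := hi'
        have hbx := hp _ (hTF hq)
        have h3 := hi q hq
        obtain rfl : i = q + b (c q) := by omega
        have h4 := hbx.one_le
        refine ⟨p (c q) (d (c q) - 1), hprev _ hq _ (by omega), ?_⟩
        rw [← (hbx.ends q rfl).2]
        have := hbx.isWalk.2 (d (c q) - 1) (by omega)
        rwa [Nat.sub_add_cancel h4] at this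
    · refine ⟨p x (i - 1), hprev x hx _ (by omega), ?_⟩
      have := (hp _ (hTF hx)).isWalk.2 (i - 1) (by omega)
      rwa [Nat.sub_add_cancel hi0] at this
  · have hsub : Set.range c \ (⋃ x ∈ S \ B, IsShortestCycle.near c (2 * k₁) x) ⊆ Z₁ := by
      rintro _ ⟨⟨i, rfl⟩, hi⟩
      refine ⟨i, rfl, fun q hq h => hi ?_⟩
      have hbx := hp _ (hTF hq)
      have h3 := hbx.add_le
      have h5 := hbx.one_le_left
      have h6 := hbx.one_le_right
      simp only [Set.mem_iUnion]
      refine ⟨c q, hq, q, i, rfl, rfl, ?_⟩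
      rw [abs_le]
      push_cast
      constructor <;> omega
    have hcard : (⋃ x ∈ S \ B, IsShortestCycle.near c (2 * k₁) x).ncard ≤
        (S \ B).ncard * (4 * k₁ + 1) := by
      have hfin : (S \ B).Finite := Set.toFinite _
      rw [Set.ncard_eq_toFinset_card _ hfin]
      have h1 : ⋃ x ∈ S \ B, IsShortestCycle.near c (2 * k₁) x =
        ⋃ x ∈ hfin.toFinset, IsShortestCycle.near c (2 * k₁) x := by simp
      rw [h1]
      refine (Finset.set_ncard_biUnion_le _ _).trans ?_
      refine (Finset.sum_le_card_nsmul _ _ (4 * k₁ + 1)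
        fun x _ => (hc.ncard_near_le _ x).trans (by omega)).trans (by simp)
    have h1 := Set.le_ncard_sdiff (⋃ x ∈ S \ B, IsShortestCycle.near c (2 * k₁) x) (Set.range c)
    have h2 := Set.ncard_le_ncard (hsub.trans (Set.subset_union_left (t := Z₂)))
    have h3 := hc.le_ncard_range
    have h4 := Nat.mul_le_mul_right (4 * k₁ + 1) hSB2
    omega

end ConnIn

/-! ### Partitions of digraphs and pairs. -/

namespace ConnIn

variable {V : Type*}

theorem one_le_minInDegree_iff (D : Digraph V) : 1 ≤ D.minInDegree ↔ ∀ v, ∃ u, D.Adj u v := by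
  simp [Digraph.minInDegree, le_iInf_iff, Set.one_le_encard_iff_nonempty, Set.Nonempty]

theorem one_le_minInDegree_induce_iff (D : Digraph V) (U : Set V) :
    1 ≤ (D.induce U).minInDegree ↔ ∀ v ∈ U, ∃ u ∈ U, D.Adj u v := by
  rw [one_le_minInDegree_iff]
  simp [Digraph.induce]

theorem isConnected_induce_iff (D : Digraph V) (U : Set V) :
    (D.induce U).IsConnected ↔ Conn D.Adj U := by
  have h : ∀ u v : U, (D.induce U).toSimpleGraphInclusive.Reachable u v ↔
      Relation.ReflTransGen (UAdj D.Adj U) (u : V) v := by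
    intro u v
    rw [SimpleGraph.reachable_iff_reflTransGen]
    constructor
    · intro h
      refine Relation.ReflTransGen.lift Subtype.val (fun a b hab => ?_) _ _ h
      simp only [Digraph.toSimpleGraphInclusive, SimpleGraph.fromRel_adj] at hab
      exact ⟨a.2, b.2, hab.2⟩
    · obtain ⟨u, hu⟩ := u
      obtain ⟨v, hv⟩ := v
      intro h
      simp only at h
      induction h with
      | refl => exact .refl
      | tail h1 h2 ih =>
        -- A loop of the digraph is a step of `UAdj`, but not an edge of the simple graph.
        by_cases hne : (⟨_, h2.1⟩ : U) = ⟨_, h2.2.1⟩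
        · rw [← hne]; exact ih h2.1
        · refine (ih h2.1).tail ?_
          simp only [Digraph.toSimpleGraphInclusive, SimpleGraph.fromRel_adj]
          exact ⟨hne, h2.2.2⟩
  constructor
  · intro hc u hu v hv
    exact (h ⟨u, hu⟩ ⟨v, hv⟩).1 (hc _ _)
  · intro hc u v
    exact (h u v).2 (hc u u.2 v v.2)

theorem hasPair_of_isConnInPartition [Fintype V] [DecidableEq V] {D : Digraph V} {k₁ k₂ : ℕ}
    {V₁ V₂ : Finset V} (h : D.IsConnInPartition k₁ k₂ V₁ V₂) : HasPair D.Adj k₁ k₂ :=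
  ⟨V₁, V₂, by exact_mod_cast h.disjoint, (isConnected_induce_iff D V₁).1 h.connected,
    by simpa using h.le_card_left,
    (one_le_minInDegree_induce_iff D V₂).1 h.one_le_minInDegree, by simpa using h.le_card_right⟩

/-- A pair as in `HasPair` extends to a partition, if every vertex has an in-neighbour. -/
theorem exists_isConnInPartition [Fintype V] [DecidableEq V] {D : Digraph V} {k₁ k₂ : ℕ}
    (hD : 1 ≤ D.minInDegree) (h : HasPair D.Adj k₁ k₂) :
    ∃ V₁ V₂ : Finset V, D.IsConnInPartition k₁ k₂ V₁ V₂ := by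
  classical
  rw [one_le_minInDegree_iff] at hD
  obtain ⟨X₀, Z₀, h₀⟩ := h
  -- For a pair with X ∪ Z largest, no arc leaves X ∪ Z: its head could join the part that contains
  -- its tail.
  obtain ⟨⟨X, Z⟩, ⟨hd, hX, hX1, hZ, hZ1⟩, hmax⟩ := Set.Finite.exists_maximalFor
    (fun q : Set V × Set V => (q.1 ∪ q.2).ncard)
    {q | Disjoint q.1 q.2 ∧ Conn D.Adj q.1 ∧ k₁ ≤ q.1.ncard ∧ (∀ v ∈ q.2, ∃ u ∈ q.2, D.Adj u v) ∧
      k₂ ≤ q.2.ncard} (Set.toFinite _) ⟨(X₀, Z₀), h₀⟩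
  have hmax' : ∀ X' Z', X ∪ Z ⊆ X' ∪ Z' → Disjoint X' Z' → Conn D.Adj X' → k₁ ≤ X'.ncard →
      (∀ v ∈ Z', ∃ u ∈ Z', D.Adj u v) → k₂ ≤ Z'.ncard → X' ∪ Z' = X ∪ Z := by
    intro X' Z' h1 h2 h3 h4 h5 h6
    have := @hmax (X', Z') ⟨h2, h3, h4, h5, h6⟩ (Set.ncard_le_ncard h1)
    exact (Set.eq_of_subset_of_ncard_le h1 this).symm
  have hZv : ∀ u ∈ Z, ∀ v, D.Adj u v → v ∈ X ∪ Z := by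
    intro u hu v huv
    by_contra hv
    have hvX : v ∉ X := fun h => hv (.inl h)
    have := hmax' X (insert v Z) (Set.union_subset_union_right _ (Set.subset_insert _ _))
      (Set.disjoint_insert_right.2 ⟨hvX, hd⟩) hX hX1 (by
        rintro w (rfl | hw)
        · exact ⟨u, .inr hu, huv⟩
        · obtain ⟨x, hx, hxw⟩ := hZ w hw
          exact ⟨x, .inr hx, hxw⟩)
      (hZ1.trans (Set.ncard_le_ncard (Set.subset_insert _ _)))
    exact hv (this ▸ .inr (.inl rfl))
  have hXv : ∀ u ∈ X, ∀ v, D.Adj u v → v ∈ X ∪ Z := by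
    intro u hu v huv
    by_contra hv
    have hvZ : v ∉ Z := fun h => hv (.inr h)
    have := hmax' (X ∪ {v}) Z (Set.union_subset_union_left _ Set.subset_union_left)
      (by rw [Set.disjoint_union_left]; exact ⟨hd, by simpa⟩)
      (conn_union hu hX (by rintro w rfl; exact ⟨u, hu, .inl huv⟩))
      (hX1.trans (Set.ncard_le_ncard Set.subset_union_left)) hZ hZ1
    exact hv (this ▸ .inl (.inr rfl))
  -- A vertex outside X ∪ Z thus has its in-neighbours outside X. So X and its complement form a
  -- pair as well, and by maximality X ∪ Z is everything.
  have huniv : X ∪ Xᶜ = X ∪ Z := by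
    refine hmax' X Xᶜ (by simp) disjoint_compl_right hX hX1 ?_
      (hZ1.trans (Set.ncard_le_ncard hd.subset_compl_left))
    intro v hv
    by_cases hvZ : v ∈ Z
    · obtain ⟨u, hu, h⟩ := hZ v hvZ
      exact ⟨u, Set.disjoint_right.1 hd hu, h⟩
    · obtain ⟨u, hu⟩ := hD v
      refine ⟨u, fun huX => ?_, hu⟩
      exact (hXv u huX v hu).elim hv hvZ
  rw [Set.union_compl_self] at huniv
  refine ⟨X.toFinset, Z.toFinset, by simpa using hd, ?_, ?_, ?_, ?_, ?_⟩
  · rw [← Finset.coe_inj]; simp [← huniv]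
  · rw [Set.coe_toFinset, isConnected_induce_iff]; exact hX
  · rw [Set.coe_toFinset, one_le_minInDegree_induce_iff]; exact hZ
  · rwa [← Set.ncard_eq_toFinset_card']
  · rwa [← Set.ncard_eq_toFinset_card']

/-- The connected part of a pair can be shrunk to any smaller positive size. -/
theorem HasPair.exists_ncard_eq [Finite V] {E : V → V → Prop} {k₁ k₂ l : ℕ} (h : HasPair E k₁ k₂)
    (hk : 0 < k₁) (hl : Nat.card V ≤ l) :
    ∃ (X : Set V) (r : V), r ∈ X ∧ Conn E X ∧ X.ncard = k₁ ∧ k₂ ≤ (core E Xᶜ l).ncard := by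
  obtain ⟨X, Z, hd, hX, hX1, hZ, hZ1⟩ := h
  -- Grow from a single vertex: while U is not all of X, connectedness of X gives an edge of X that
  -- leaves U.
  have hgrow : ∀ m, 1 ≤ m → m ≤ X.ncard → ∃ U ⊆ X, ∃ r ∈ U, Conn E U ∧ U.ncard = m := by
    intro m hm
    induction m, hm using Nat.le_induction with
    | base =>
      intro h
      obtain ⟨r, hr⟩ : X.Nonempty := Set.nonempty_of_ncard_ne_zero (by omega)
      refine ⟨{r}, by simpa, r, rfl, ?_, by simp⟩
      rintro _ rfl _ rfl
      exact .refl
    | succ m hm ih =>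
      intro hmX
      obtain ⟨U, hUX, r, hr, hU, hUm⟩ := ih (by omega)
      obtain ⟨y, hyX, hyU⟩ := Set.exists_mem_notMem_of_ncard_lt_ncard (s := U) (t := X) (by omega)
      have hstep : ∃ u ∈ U, ∃ v ∈ X, v ∉ U ∧ (E u v ∨ E v u) := by
        by_contra hno
        push Not at hno
        have : ∀ w, Relation.ReflTransGen (UAdj E X) r w → w ∈ U := by
          intro w hw
          induction hw with
          | refl => exact hr
          | tail h1 h2 ih =>
            by_contra hw
            have := hno _ ih _ h2.2.1 hw
            exact h2.2.2.elim this.1 this.2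
        exact hyU (this y (hX r (hUX hr) y hyX))
      obtain ⟨u, hu, v, hv, hvU, huv⟩ := hstep
      refine ⟨U ∪ {v}, Set.union_subset hUX (by simpa), r, .inl hr,
        conn_union hu hU (by rintro x rfl; exact ⟨u, hu, huv⟩), ?_⟩
      rw [Set.union_singleton, Set.ncard_insert_of_notMem hvU, hUm]
  obtain ⟨U, hUX, r, hr, hU, hUm⟩ := hgrow k₁ hk hX1
  refine ⟨U, r, hr, hU, hUm, hZ1.trans (Set.ncard_le_ncard ?_)⟩
  exact (subset_core_of_forall_pred hZ hl).trans
    (core_mono (fun z hz hzU => Set.disjoint_left.1 hd (hUX hzU) hz) le_rfl)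

end ConnIn

/-! ### Iterated closures, pruning, and one step of the search. -/

namespace ConnIn

section Closure

variable {V : Type*} [Finite V]

/-- A round that adds nothing makes all later rounds stationary, and every round before it adds an
element. -/
theorem iterate_eq_of_card_le (F : Set V → Set V) (hF : ∀ S, S ⊆ F S) (S : Set V) {m : ℕ}
    (hm : Nat.card V ≤ m) : F (F^[m] S) = F^[m] S := by
  have hfix : ∀ i j, F (F^[i] S) = F^[i] S → F (F^[i + j] S) = F^[i + j] S := by
    intro i j h
    rw [add_comm, Function.iterate_add_apply]
    have : F^[j] (F^[i] S) = F^[i] S := Function.iterate_fixed h j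
    rw [this, h]
  by_contra hne
  have hcard : ∀ i ≤ m + 1, i ≤ (F^[i] S).ncard := by
    intro i
    induction i with
    | zero => simp
    | succ i ih =>
      intro hi
      have h1 := ih (by omega)
      rw [Function.iterate_succ_apply']
      have : F^[i] S ⊂ F (F^[i] S) := by
        refine (hF _).ssubset_of_ne fun h => hne ?_
        have := hfix i (m - i) h.symm
        rwa [Nat.add_sub_cancel' (by omega)] at this
      have := Set.ncard_lt_ncard this
      omega
  have h1 := hcard (m + 1) le_rfl
  have h2 := Set.ncard_le_card (F^[m + 1] S)
  omega

/-- Closing a set under a relation, in as many rounds as there are elements. -/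
theorem iterate_closure (R : V → V → Prop) (S : Set V) {m : ℕ} (hm : Nat.card V ≤ m) :
    (fun S => S ∪ {v | ∃ u ∈ S, R u v})^[m] S = {v | ∃ u ∈ S, Relation.ReflTransGen R u v} := by
  set F : Set V → Set V := fun S => S ∪ {v | ∃ u ∈ S, R u v} with hF
  apply Set.Subset.antisymm
  · clear hm
    induction m with
    | zero => exact fun v hv => ⟨v, hv, .refl⟩
    | succ m ih =>
      rw [Function.iterate_succ_apply']
      rintro v (hv | ⟨u, hu, huv⟩)
      · exact ih hv
      · obtain ⟨w, hw, h⟩ := ih hu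
        exact ⟨w, hw, h.tail huv⟩
  · have hfix := iterate_eq_of_card_le F (fun S => Set.subset_union_left) S hm
    rintro v ⟨u, hu, h⟩
    induction h with
    | refl =>
      clear hm hfix
      induction m with
      | zero => exact hu
      | succ m ih => rw [Function.iterate_succ_apply']; exact .inl ih
    | tail h1 h2 ih => rw [← hfix]; exact .inr ⟨_, ih, h2⟩

end Closure

theorem mem_core_iff_reflTransGen {V : Type*} {E : V → V → Prop} {A : Set V} {l : ℕ} {v : V} :
    v ∈ core E A l ↔ ∃ u ∈ onCycle E A l, Relation.ReflTransGen (fun u v => v ∈ A ∧ E u v) u v := by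
  constructor
  · rintro ⟨u, hu, d, h⟩
    refine ⟨u, hu, ?_⟩
    induction d generalizing v with
    | zero => obtain ⟨p, -, rfl, rfl⟩ := h; exact .refl
    | succ d ih =>
      obtain ⟨hv, w, hw, hE⟩ := walk_succ.1 h
      exact (ih hw).tail ⟨hv, hE⟩
  · rintro ⟨u, hu, h⟩
    induction h with
    | refl => exact onCycle_subset_core hu
    | tail h1 h2 ih => exact (Walk.edge (core_subset ih) h2.1 h2.2).mem_core ih

section Step

variable {n : ℕ} (E : Fin n → Fin n → Prop)

/-- The result of removing the vertices `0, 1, …` from `A` one after the other, as long as the core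
keeps at least `k` vertices. -/
noncomputable def prune (k l : ℕ) (A : Set (Fin n)) : ℕ → Set (Fin n)
  | 0 => A
  | i + 1 => {v ∈ prune k l A i | ¬ ((v : ℕ) = i ∧
      k ≤ (core E {w ∈ prune k l A i | (w : ℕ) ≠ i} l).ncard)}

theorem prune_succ_subset (k l : ℕ) (A : Set (Fin n)) (i : ℕ) :
    prune E k l A (i + 1) ⊆ prune E k l A i := fun _ hv => hv.1

theorem prune_subset (k l : ℕ) (A : Set (Fin n)) (i : ℕ) : prune E k l A i ⊆ A := by
  induction i with
  | zero => exact subset_rfl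
  | succ i ih => exact (prune_succ_subset E k l A i).trans ih

/-- One pass suffices: a vertex that had to be kept remains indispensable when the set shrinks,
because cores are monotone. -/
theorem isMinimalCore_prune {k l : ℕ} {A : Set (Fin n)} (hA : k ≤ (core E A l).ncard) :
    IsMinimalCore E k l (prune E k l A n) := by
  have h : ∀ i, k ≤ (core E (prune E k l A i) l).ncard ∧
      ∀ v ∈ prune E k l A i, (v : ℕ) < i → (core E (prune E k l A i \ {v}) l).ncard < k := by
    intro i
    induction i with
    | zero => exact ⟨hA, fun v _ hv => absurd hv (by omega)⟩
    | succ i ih =>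
      obtain ⟨h1, h2⟩ := ih
      by_cases hk : k ≤ (core E {w ∈ prune E k l A i | (w : ℕ) ≠ i} l).ncard
      · have heq : prune E k l A (i + 1) = {w ∈ prune E k l A i | (w : ℕ) ≠ i} := by
          simp [prune, hk]
        refine ⟨heq ▸ hk, fun v hv hvi => ?_⟩
        have hv' := hv
        rw [heq] at hv'
        have h3 : (v : ℕ) ≠ i := hv'.2
        exact (Set.ncard_le_ncard (core_mono (Set.sdiff_subset_sdiff_left
          (prune_succ_subset E k l A i)) le_rfl)).trans_lt (h2 v hv'.1 (by omega))
      · have heq : prune E k l A (i + 1) = prune E k l A i := by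
          simp [prune, hk]
        rw [heq]
        refine ⟨h1, fun v hv hvi => ?_⟩
        by_cases hvi' : (v : ℕ) < i
        · exact h2 v hv hvi'
        · have : prune E k l A i \ {v} = {w ∈ prune E k l A i | (w : ℕ) ≠ i} := by
            ext w
            simp only [Set.mem_sdiff, Set.mem_singleton_iff, Set.mem_ofPred_eq, Fin.ext_iff]
            rw [show (v : ℕ) = i by omega]
          rw [this]
          omega
  exact ⟨(h n).1, fun v hv => (h n).2 v hv v.2⟩

/-- The least length of closed walks that give a core with at least `k` vertices. -/
noncomputable def minLength (k : ℕ) (A : Set (Fin n)) : ℕ := sInf {l | k ≤ (core E A l).ncard}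

/-- The minimal core that avoids `P`. -/
noncomputable def minCore (k : ℕ) (P : Set (Fin n)) : Set (Fin n) :=
  prune E k (minLength E k Pᶜ) Pᶜ n

/-- The candidates for the next vertex of a connected set that contains `r` and `P`. -/
def candidates (N k : ℕ) (r : Fin n) (P : Set (Fin n)) : Set (Fin n) :=
  {v | v ∈ minCore E k P ∧ (∃ u ∈ comp E (minCore E k P)ᶜ r, E u v ∨ E v u) ∧
    k ≤ (core E {w | w ∉ P ∧ w ≠ v} N).ncard}

/-- The number of elements of `C` before `v`. -/
noncomputable def rank (C : Set (Fin n)) (v : Fin n) : ℕ := {u | u < v ∧ u ∈ C}.ncard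

theorem rank_lt_rank {C : Set (Fin n)} {u v : Fin n} (hu : u ∈ C) (huv : u < v) :
    rank C u < rank C v := by
  refine Set.ncard_lt_ncard ((Set.ssubset_iff_of_subset ?_).2 ⟨u, ⟨huv, hu⟩, ?_⟩) (Set.toFinite _)
  · exact fun w hw => ⟨hw.1.trans huv, hw.2⟩
  · exact fun h => lt_irrefl _ h.1

theorem rank_lt_ncard {C : Set (Fin n)} {v : Fin n} (hv : v ∈ C) : rank C v < C.ncard :=
  Set.ncard_lt_ncard ((Set.ssubset_iff_of_subset fun _ hw => hw.2).2
    ⟨v, hv, fun h => lt_irrefl _ h.1⟩) (Set.toFinite _)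

theorem rank_inj {C : Set (Fin n)} {u v : Fin n} (hu : u ∈ C) (hv : v ∈ C)
    (h : rank C u = rank C v) : u = v := by
  rcases lt_trichotomy u v with h' | h' | h'
  · exact absurd h (rank_lt_rank hu h').ne
  · exact h'
  · exact absurd h (rank_lt_rank hv h').ne'

/-- The step that starts from `P` finds a pair. -/
def Accepts (N M k₁ k₂ : ℕ) (r : Fin n) (P : Set (Fin n)) : Prop :=
  (∃ v, k₁ ≤ (comp E (minCore E k₂ P)ᶜ v).ncard) ∨ M < (candidates E N k₂ r P).ncard

variable {E} {N M k₁ k₂ : ℕ} {r : Fin n} {P : Set (Fin n)}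

theorem minLength_spec (h : ∃ l, k₂ ≤ (core E Pᶜ l).ncard) :
    IsMinimalCore E k₂ (minLength E k₂ Pᶜ) (minCore E k₂ P) ∧
      ∀ l < minLength E k₂ Pᶜ, (core E Pᶜ l).ncard < k₂ :=
  ⟨isMinimalCore_prune E (Nat.sInf_mem h), fun l hl => by
    by_contra h'
    have hmem : l ∈ {l | k₂ ≤ (core E Pᶜ l).ncard} := not_lt.1 h'
    exact absurd (Nat.sInf_le hmem) (not_le.2 hl)⟩

/-- Soundness does not require `P` to be part of a solution, so a wrong guess cannot cause a wrong
answer. -/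
theorem Accepts.hasPair (hM : 2 * k₂ + 2 * k₁ * (4 * k₁ + 1) ≤ M)
    (hfound : ∃ l, k₂ ≤ (core E Pᶜ l).ncard) (h : Accepts E N M k₁ k₂ r P) :
    HasPair E k₁ k₂ := by
  obtain ⟨hY, hl⟩ := minLength_spec hfound
  rcases h with ⟨v, hv⟩ | h
  · exact hasPair_of_disjoint_core (disjoint_compl_left.mono_left comp_subset)
      (conn_comp _ _) hv hY.le_ncard
  · refine hasPair_of_many hY (prune_subset _ _ _ _ _) hl (F := candidates E N k₂ r P) (r := r)
      (n := N) (fun x hx => ⟨hx.1, hx.2.1, ?_⟩) (by omega)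
    convert hx.2.2 using 3
    ext w
    simp

/-- As long as the set `P` is part of a connected set `X` of the right size, a step accepts or finds
the next vertex of `X`. -/
theorem accepts_or_exists_candidate {X : Set (Fin n)} (hX : Conn E X) (hk₁ : k₁ ≤ X.ncard)
    (hr : r ∈ X) (hrP : r ∈ P) (hPX : P ⊆ X) {l : ℕ} (hlN : l ≤ N)
    (hXl : k₂ ≤ (core E Xᶜ l).ncard) :
    Accepts E N M k₁ k₂ r P ∨ ∃ v ∈ candidates E N k₂ r P, v ∈ X ∧ v ∉ P ∧
      rank (candidates E N k₂ r P) v < M := by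
  have hYP : minCore E k₂ P ⊆ Pᶜ := prune_subset _ _ _ _ _
  by_cases hXY : Disjoint X (minCore E k₂ P)
  · exact .inl (.inl ⟨r, hk₁.trans (Set.ncard_le_ncard (hX.subset_comp hXY.subset_compl_right hr))⟩)
  by_cases hM : M < (candidates E N k₂ r P).ncard
  · exact .inl (.inr hM)
  refine .inr ?_
  -- Without an edge of X from the component of r to the minimal core, X explored from r never
  -- leaves that component, although X meets the minimal core.
  suffices h : ∃ u ∈ comp E (minCore E k₂ P)ᶜ r, ∃ v ∈ X, v ∈ minCore E k₂ P ∧ (E u v ∨ E v u) by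
    obtain ⟨u, hu, v, hvX, hvY, huv⟩ := h
    have hv : v ∈ candidates E N k₂ r P := by
      refine ⟨hvY, ⟨u, hu, huv⟩, hXl.trans (Set.ncard_le_ncard (core_mono ?_ hlN))⟩
      exact fun w hw => ⟨fun h => hw (hPX h), fun h => hw (h ▸ hvX)⟩
    exact ⟨v, hv, hvX, hYP hvY, (rank_lt_ncard hv).trans_le (not_lt.1 hM)⟩
  by_contra hno
  push Not at hno
  have hrY : r ∉ minCore E k₂ P := fun h => hYP h hrP
  have hall : ∀ w, Relation.ReflTransGen (UAdj E X) r w → w ∈ comp E (minCore E k₂ P)ᶜ r := by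
    intro w hw
    induction hw with
    | refl => exact self_mem_comp hrY
    | @tail b w h1 h2 ih =>
      have hwY : w ∉ minCore E k₂ P := fun hwY => by
        have := hno _ ih _ h2.2.1 hwY
        exact h2.2.2.elim this.1 this.2
      exact mem_comp_of_uAdj ih ⟨comp_subset ih, hwY, h2.2.2⟩
  refine hXY (Set.disjoint_left.2 fun w hw hwY => ?_)
  exact comp_subset (hall w (hX r hr w hw)) hwY

end Step

end ConnIn

/-! ## The algorithm -/

namespace RAM

namespace Term

/-- Conjunction. -/
def and (t u : Term) : Term := .ite t u (.lit 0)

/-- Disjunction. -/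
def or (t u : Term) : Term := .plus t u

/-- Negation. -/
def not (t : Term) : Term := .minus (.lit 1) t

/-- Comparison. -/
def lt (t u : Term) : Term := .minus u t

/-- Equality. -/
def eq (t u : Term) : Term := not (.plus (.minus t u) (.minus u t))

/-- Existence of a vertex. -/
def ex (x : ℕ) (t : Term) : Term := .sum true x t

/-- The number of vertices with a property. -/
def count (x : ℕ) (t : Term) : Term := .sum true x (.ite t (.lit 1) (.lit 0))

/-- The product, provided that the first factor is at most the value of variable `0`. -/
def mul (t u : Term) : Term := .sum false 25 (.ite (lt (.var 25) t) u (.lit 0))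

/-- Adjacency of vertices, read off the input. -/
def adj (x y : ℕ) : Term := .read 0 (.plus (.lit 3) (.plus (.read 1 (.var x)) (.var y)))

/-- The term, as a test, succeeds. -/
def Holds (s : Store) (t : Term) : Prop := t.eval s ≠ 0

variable {s : Store} {t u : Term}

@[simp] theorem eval_lit (m : ℕ) : (Term.lit m).eval s = m := rfl

@[simp] theorem eval_var (x : ℕ) : (Term.var x).eval s = s.var x := rfl

@[simp] theorem eval_read (a : ℕ) (t : Term) : (Term.read a t).eval s = s.arr a (t.eval s) := rfl

open Classical in
@[simp] theorem eval_ite {c : Term} :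
    (Term.ite c t u).eval s = if Holds s c then t.eval s else u.eval s := by
  simp only [eval, Holds]
  congr

@[simp] theorem holds_and : Holds s (and t u) ↔ Holds s t ∧ Holds s u := by
  simp only [Holds, and, eval]; split <;> simp_all

@[simp] theorem holds_or : Holds s (or t u) ↔ Holds s t ∨ Holds s u := by
  simp only [Holds, or, eval]; omega

@[simp] theorem holds_not : Holds s (not t) ↔ ¬ Holds s t := by
  simp only [Holds, not, eval]; omega

@[simp] theorem holds_lt : Holds s (lt t u) ↔ t.eval s < u.eval s := by
  simp only [Holds, lt, eval]; omega

@[simp] theorem holds_eq : Holds s (eq t u) ↔ t.eval s = u.eval s := by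
  simp only [Holds, eq, not, eval]; omega

@[simp] theorem holds_read (a : ℕ) : Holds s (.read a t) ↔ s.arr a (t.eval s) ≠ 0 := Iff.rfl

@[simp] theorem holds_var (x : ℕ) : Holds s (.var x) ↔ s.var x ≠ 0 := Iff.rfl

theorem holds_ex {n x : ℕ} (hn : s.var 1 = n) :
    Holds s (ex x t) ↔ ∃ i : Fin n, Holds (s.setVar x i) t := by
  subst hn
  simp [Holds, ex, eval, boundVar, Finset.sum_eq_zero_iff, Fin.exists_iff]

theorem eval_count {n x : ℕ} (hn : s.var 1 = n) :
    (count x t).eval s = {i : Fin n | Holds (s.setVar x i) t}.ncard := by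
  classical
  subst hn
  have h : (count x t).eval s =
      ∑ i ∈ Finset.range (s.var 1), if Holds (s.setVar x i) t then 1 else 0 := by
    simp only [count, eval, boundVar, if_true, Holds]
    exact Finset.sum_congr rfl fun i _ => by congr
  rw [h, Finset.sum_range (fun i => if Holds (s.setVar x i) t then 1 else 0), Finset.sum_boole,
    Set.ncard_eq_toFinset_card']
  simp

end Term

/-- The set of vertices that an array describes. -/
def Store.set (n : ℕ) (s : Store) (a : ℕ) : Set (Fin n) := {v | s.arr a v ≠ 0}

theorem Store.set_congr {n : ℕ} {s s' : Store} {a : ℕ} (h : s'.arr a = s.arr a) :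
    s'.set n a = s.set n a := by simp [Store.set, h]

@[simp] theorem Store.set_setVar (n : ℕ) (s : Store) (a x m : ℕ) :
    (s.setVar x m).set n a = s.set n a := rfl

theorem Cmd.run_seq (c d : Cmd) (s : Store) : (seq c d).run s = d.run (c.run s) := rfl

theorem Cmd.set_run_fill {n : ℕ} {s : Store} (hn : s.var 1 = n) (a x : ℕ) (t : Term) :
    ((fill true a x t).run s).set n a = {v : Fin n | Term.Holds (s.setVar x v) t} := by
  ext v
  simp [Store.set, run, boundVar, hn, Term.Holds]

/-- The store holds the input: variable `1` is the number `n` of vertices, and the arrays `0`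
and `1` contain the adjacency matrix and the offsets of its rows. -/
structure Store.HasInput (n : ℕ) (E : Fin n → Fin n → Prop) (s : Store) : Prop where
  var_one : s.var 1 = n
  le : n ≤ s.var 0
  adj : ∀ u v : Fin n, s.arr 0 (3 + (s.arr 1 u + v)) ≠ 0 ↔ E u v

namespace Store.HasInput

variable {n : ℕ} {E : Fin n → Fin n → Prop} {s : Store}

theorem congr (h : s.HasInput n E) {s' : Store} (h0 : s'.var 0 = s.var 0)
    (h1 : s'.var 1 = s.var 1) (h2 : s'.arr 0 = s.arr 0) (h3 : s'.arr 1 = s.arr 1) :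
    s'.HasInput n E :=
  ⟨h1.trans h.var_one, h0 ▸ h.le, by rw [h2, h3]; exact h.adj⟩

theorem setVar (h : s.HasInput n E) {x : ℕ} (hx : 2 ≤ x) (m : ℕ) : (s.setVar x m).HasInput n E :=
  h.congr (by rw [Store.setVar_var, if_neg (by omega)])
    (by rw [Store.setVar_var, if_neg (by omega)]) rfl rfl

theorem run (h : s.HasInput n E) {V : ℕ} {c : Cmd} (hc : c.Wf V) (h0 : 0 ∉ c.arrsChanged)
    (h1 : 1 ∉ c.arrsChanged) : (c.run s).HasInput n E :=
  h.congr (hc.run_var s (by omega)) (hc.run_var s (by omega)) (c.run_arr s h0) (c.run_arr s h1)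

theorem holds_adj (h : s.HasInput n E) {x y : ℕ} {u v : Fin n} (hx : s.var x = u)
    (hy : s.var y = v) : Term.Holds s (.adj x y) ↔ E u v := by
  rw [← h.adj, Term.adj, Term.holds_read]
  simp [Term.eval, hx, hy]

end Store.HasInput

end RAM

/-! ### Commands for closures and cores. -/

namespace ConnIn

open RAM RAM.Cmd

/-- Close the set in array `a` under the relation that `t` describes between the variables `17`
and `16`. -/
def closeCmd (a : ℕ) (t : Term) : Cmd :=
  loop false 15 (fill true a 16 (.or (.read a (.var 16)) (.ex 17 (.and (.read a (.var 17)) t))))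

/-- The term has to describe `R` in all stores that occur during the loop, and these differ from `s`
only in variable `15` and array `a`. The number of rounds is at least `n`, as `iterate_closure`
demands. -/
theorem set_run_closeCmd {n : ℕ} {s : Store} {a : ℕ} {t : Term} {R : Fin n → Fin n → Prop}
    (hn : s.var 1 = n) (hN : n ≤ s.var 0)
    (ht : ∀ s' : Store, (∀ x, x ≠ 15 → s'.var x = s.var x) → (∀ b, b ≠ a → s'.arr b = s.arr b) →
      ∀ u v : Fin n, Term.Holds ((s'.setVar 16 v).setVar 17 u) t ↔ R u v) :
    ((closeCmd a t).run s).set n a = {v | ∃ u ∈ s.set n a, Relation.ReflTransGen R u v} := by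
  rw [← iterate_closure R _ (m := s.var 0) (by simpa using hN)]
  refine (run_loop_induct (b := false) (x := 15)
    (I := fun i s' => (∀ x, x ≠ 15 → s'.var x = s.var x) ∧ (∀ b, b ≠ a → s'.arr b = s.arr b) ∧
      s'.set n a = (fun S => S ∪ {v | ∃ u ∈ S, R u v})^[i] (s.set n a))
    ⟨fun _ _ => rfl, fun _ _ => rfl, rfl⟩ ?_).2.2
  rintro i - s' ⟨h1, h2, h3⟩
  have hv : ∀ x, x ≠ 15 → (s'.setVar 15 i).var x = s.var x := fun x hx => by simp [hx, h1 x hx]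
  refine ⟨fun x hx => by simp [run, hx, h1 x hx], fun b hb => by simp [run, hb, h2 b hb], ?_⟩
  have h1' : (s'.setVar 15 i).var 1 = n := (hv 1 (by omega)).trans hn
  rw [set_run_fill h1', Function.iterate_succ_apply', ← h3]
  ext v
  have hadj := ht (s'.setVar 15 i) hv h2
  simp only [Set.mem_ofPred_eq, Term.holds_or, Term.holds_and, Term.holds_read,
    Term.holds_ex (s := (s'.setVar 15 i).setVar 16 v) (by simpa using h1'), hadj, Set.mem_union]
  simp [Store.set]

/-- Compute in array `5` the core of the set in array `3` for closed walks whose length is at most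
the value of variable `8`. -/
def coreCmd : Cmd :=
  seq (fill true 5 16 (.lit 0)) (seq
    (loop true 14 (seq (fill true 4 16 (.and (.eq (.var 16) (.var 14)) (.read 3 (.var 16))))
      (loop false 15 (seq
        (fill true 4 16 (.and (.read 3 (.var 16)) (.ex 17 (.and (.read 4 (.var 17)) (.adj 17 16)))))
        (fill true 5 16 (.or (.read 5 (.var 16)) (.and (.eq (.var 16) (.var 14))
          (.and (.read 4 (.var 14)) (.lt (.var 15) (.var 8))))))))))
    (closeCmd 5 (.and (.read 3 (.var 16)) (.adj 17 16))))

/-- For every start v₀ the inner loop keeps in array `4` the vertices reached by walks of exactly j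
steps and marks v₀ in array `5` if it returns after at most `s.var 8` steps; `hl` ensures that there
are enough rounds. Closing under arcs then turns `onCycle` into `core`. -/
theorem set_run_coreCmd {n : ℕ} {E : Fin n → Fin n → Prop} {s : Store} (hs : s.HasInput n E)
    (hl : s.var 8 ≤ s.var 0) : (coreCmd.run s).set n 5 = core E (s.set n 3) (s.var 8) := by
  obtain ⟨A, hA⟩ : ∃ A, A = s.set n 3 := ⟨_, rfl⟩
  obtain ⟨l, hl'⟩ : ∃ l, l = s.var 8 := ⟨_, rfl⟩
  rw [← hA, ← hl']
  rw [coreCmd, run_seq, run_seq]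
  set s1 := (fill true 5 16 (.lit 0)).run s with hs1
  set c2 := loop true 14 (seq (fill true 4 16 (.and (.eq (.var 16) (.var 14)) (.read 3 (.var 16))))
      (loop false 15 (seq
        (fill true 4 16 (.and (.read 3 (.var 16)) (.ex 17 (.and (.read 4 (.var 17)) (.adj 17 16)))))
        (fill true 5 16 (.or (.read 5 (.var 16)) (.and (.eq (.var 16) (.var 14))
          (.and (.read 4 (.var 14)) (.lt (.var 15) (.var 8))))))))) with hc2
  have hI1 : s1.HasInput n E := hs.congr rfl rfl rfl rfl
  have hA1 : s1.set n 3 = A := hA ▸ rfl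
  have hl1 : s1.var 8 = l := hl' ▸ rfl
  have key : (c2.run s1).HasInput n E ∧ (c2.run s1).set n 3 = A ∧
      (c2.run s1).set n 5 = onCycle E A l := by
    suffices h : (c2.run s1).HasInput n E ∧ (c2.run s1).set n 3 = A ∧
        (c2.run s1).var 8 = l ∧ (c2.run s1).var 0 = s.var 0 ∧
        (c2.run s1).set n 5 = {v ∈ onCycle E A l | (v : ℕ) < s1.var 1} by
      refine ⟨h.1, h.2.1, h.2.2.2.2.trans ?_⟩
      ext v
      have := hI1.var_one
      simp only [Set.mem_ofPred_eq, and_iff_left_iff_imp]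
      intro
      omega
    refine run_loop_induct (I := fun i s' => s'.HasInput n E ∧ s'.set n 3 = A ∧ s'.var 8 = l ∧
      s'.var 0 = s.var 0 ∧ s'.set n 5 = {v ∈ onCycle E A l | (v : ℕ) < i})
      ⟨hI1, hA1, hl1, rfl, ?_⟩ ?_
    · ext v
      simp [hs1, set_run_fill hs.var_one, Term.Holds]
    rintro i hi s' ⟨h1, h2, h3, h0, h4⟩
    rw [boundVar, if_pos rfl, hI1.var_one] at hi
    obtain ⟨v₀, rfl⟩ : ∃ v₀ : Fin n, i = v₀ := ⟨⟨i, hi⟩, rfl⟩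
    rw [run_seq]
    set s2 := (fill true 4 16 (.and (.eq (.var 16) (.var 14)) (.read 3 (.var 16)))).run
      (s'.setVar 14 v₀) with hs2
    have hI2 : s2.HasInput n E := h1.congr rfl rfl rfl rfl
    have h24 : s2.set n 4 = {w | Walk E A 0 v₀ w} := by
      rw [hs2, set_run_fill (by simpa using h1.var_one)]
      ext w
      simp only [Set.mem_ofPred_eq, Term.holds_and, Term.holds_eq, Term.holds_read, Term.eval_var]
      have : w ∈ A ↔ s'.arr 3 w ≠ 0 := by rw [← h2]; rfl
      simp only [Store.setVar_var, Store.setVar_arr, if_true, if_neg (show (14 : ℕ) ≠ 16 by omega),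
        ← this]
      constructor
      · rintro ⟨h5, h6⟩
        rw [← Fin.ext h5]
        exact .zero h6
      · rintro ⟨p, hp, h5, h6⟩
        obtain rfl : v₀ = w := h5.symm.trans h6
        exact ⟨rfl, h5 ▸ hp.1 0 le_rfl⟩
    have inner := run_loop_induct (b := false) (x := 15) (s := s2)
      (c := seq
        (fill true 4 16 (.and (.read 3 (.var 16)) (.ex 17 (.and (.read 4 (.var 17)) (.adj 17 16)))))
        (fill true 5 16 (.or (.read 5 (.var 16)) (.and (.eq (.var 16) (.var 14))
          (.and (.read 4 (.var 14)) (.lt (.var 15) (.var 8)))))))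
      (I := fun j s3 => s3.HasInput n E ∧ s3.set n 3 = A ∧ s3.var 8 = l ∧ s3.var 14 = v₀ ∧
        s3.var 0 = s.var 0 ∧ s3.set n 4 = {w | Walk E A j v₀ w} ∧
        s3.set n 5 = {v | (v ∈ onCycle E A l ∧ v < v₀) ∨
          (v = v₀ ∧ ∃ d, 1 ≤ d ∧ d ≤ l ∧ d ≤ j ∧ Walk E A d v₀ v₀)})
      ⟨hI2, h2, h3, rfl, h0, h24, by
        have : s2.set n 5 = s'.set n 5 := rfl
        rw [this, h4]
        ext v
        simp only [Set.mem_ofPred_eq, Fin.lt_def]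
        constructor
        · exact .inl
        · rintro (h | ⟨-, d, h1, -, h2, -⟩)
          · exact h
          · omega⟩ ?_
    · obtain ⟨k1, k2, k3, k4, k5, k6, k7⟩ := inner
      refine ⟨k1, k2, k3, k5, k7.trans ?_⟩
      ext v
      simp only [Set.mem_ofPred_eq, Fin.lt_def]
      have hb : s2.var (boundVar false) = s.var 0 := h0
      constructor
      · rintro (⟨h5, h6⟩ | ⟨rfl, d, h5, h6, -, h7⟩)
        · exact ⟨h5, by omega⟩
        · exact ⟨⟨d, h5, h6, h7⟩, by omega⟩
      · rintro ⟨h5, h6⟩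
        by_cases h7 : (v : ℕ) < v₀
        · exact .inl ⟨h5, h7⟩
        · obtain rfl : v = v₀ := Fin.ext (by omega)
          obtain ⟨d, h8, h9, h10⟩ := h5
          exact .inr ⟨rfl, d, h8, h9, by omega, h10⟩
    · rintro j - s3 ⟨k1, k2, k3, k4, k5, k6, k7⟩
      rw [run_seq]
      set s4 := (fill true 4 16 (.and (.read 3 (.var 16)) (.ex 17 (.and (.read 4 (.var 17))
        (.adj 17 16))))).run (s3.setVar 15 j) with hs4
      have hI4 : s4.HasInput n E := k1.congr rfl rfl rfl rfl
      have h44 : s4.set n 4 = {w | Walk E A (j + 1) v₀ w} := by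
        rw [hs4, set_run_fill (by simpa using k1.var_one)]
        ext w
        have hw : w ∈ A ↔ s3.arr 3 w ≠ 0 := by rw [← k2]; rfl
        have hu : ∀ u : Fin n, Walk E A j v₀ u ↔ s3.arr 4 u ≠ 0 := fun u => by
          have : u ∈ s3.set n 4 ↔ Walk E A j v₀ u := by rw [k6]; exact Iff.rfl
          exact this.symm
        have hI : ∀ u : Fin n, (((s3.setVar 15 j).setVar 16 w).setVar 17 u).HasInput n E :=
          fun u => ((k1.setVar (by omega) _).setVar (by omega) _).setVar (by omega) _
        have hadj : ∀ u : Fin n, Term.Holds (((s3.setVar 15 j).setVar 16 w).setVar 17 u)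
            (.adj 17 16) ↔ E u w := fun u => (hI u).holds_adj (by simp) (by simp)
        simp only [Set.mem_ofPred_eq, Term.holds_and, Term.holds_read, Term.eval_var,
          Term.holds_ex (s := (s3.setVar 15 j).setVar 16 w) (by simpa using k1.var_one), hadj,
          walk_succ, hw, hu]
        simp
      refine ⟨hI4.congr rfl rfl rfl rfl, k2, k3, k4, k5, h44, ?_⟩
      rw [set_run_fill hI4.var_one]
      have hv0 : Walk E A (j + 1) v₀ v₀ ↔ s4.arr 4 v₀ ≠ 0 := by
        have : v₀ ∈ s4.set n 4 ↔ Walk E A (j + 1) v₀ v₀ := by rw [h44]; exact Iff.rfl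
        exact this.symm
      have h45 : ∀ v : Fin n, s4.arr 5 v ≠ 0 ↔ v ∈ s3.set n 5 := fun v => Iff.rfl
      have v14 : s4.var 14 = v₀ := k4
      have v8 : s4.var 8 = l := k3
      have v15 : s4.var 15 = j := rfl
      ext v
      simp only [Set.mem_ofPred_eq, Term.holds_or, Term.holds_and, Term.holds_read,
        Term.holds_eq, Term.holds_lt, Term.eval_var, Store.setVar_var, Store.setVar_arr, if_true,
        if_neg (show (14 : ℕ) ≠ 16 by omega), if_neg (show (8 : ℕ) ≠ 16 by omega),
        if_neg (show (15 : ℕ) ≠ 16 by omega), v14, v8, v15, h45, k7, ← hv0, ← Fin.ext_iff]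
      constructor
      · rintro ((h | ⟨h5, d, h6, h7, h8, h9⟩) | ⟨h5, h6, h7⟩)
        · exact .inl h
        · exact .inr ⟨h5, d, h6, h7, by omega, h9⟩
        · exact .inr ⟨h5, j + 1, by omega, by omega, le_rfl, h6⟩
      · rintro (h | ⟨h5, d, h6, h7, h8, h9⟩)
        · exact .inl (.inl h)
        · by_cases hd : d ≤ j
          · exact .inl (.inr ⟨h5, d, h6, h7, hd, h9⟩)
          · obtain rfl : d = j + 1 := by omega
            exact .inr ⟨h5, h9, by omega⟩
  obtain ⟨k1, k2, k3⟩ := key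
  rw [set_run_closeCmd (R := fun u v => v ∈ A ∧ E u v) k1.var_one k1.le, k3]
  · ext v
    rw [mem_core_iff_reflTransGen]
    rfl
  · intro s' h1 h2 u v
    have hI : ((s'.setVar 16 v).setVar 17 u).HasInput n E :=
      ((k1.congr (h1 0 (by omega)) (h1 1 (by omega)) (h2 0 (by omega)) (h2 1 (by omega))).setVar
        (by omega) _).setVar (by omega) _
    rw [Term.holds_and, hI.holds_adj (u := u) (v := v) (by simp) (by simp), ← k2]
    simp [Store.set, h2 3]

end ConnIn

namespace RAM

namespace Term

theorem eval_count_read {n : ℕ} {s : Store} (hn : s.var 1 = n) (x a : ℕ) :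
    (count x (.read a (.var x))).eval s = (s.set n a).ncard := by
  rw [eval_count hn]
  simp [Store.set]

theorem holds_ite {s : Store} {c t u : Term} :
    Holds s (.ite c t u) ↔ (Holds s c ∧ Holds s t) ∨ (¬ Holds s c ∧ Holds s u) := by
  unfold Holds
  rw [eval]
  split <;> simp_all

end Term

theorem Cmd.run_ite_pos {s : Store} {t : Term} (h : Term.Holds s t) (c d : Cmd) :
    (ite t c d).run s = c.run s := if_pos h

theorem Cmd.run_ite_neg {s : Store} {t : Term} (h : ¬ Term.Holds s t) (c d : Cmd) :
    (ite t c d).run s = d.run s := if_neg h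

end RAM

/-! ### Commands for minimal cores, components and candidates. -/

namespace ConnIn

open RAM RAM.Cmd

variable {n : ℕ} {E : Fin n → Fin n → Prop} {s : Store}

theorem run_coreCmd_var (s : Store) {x : ℕ} (h1 : x ≠ 14) (h2 : x ≠ 15) :
    (coreCmd.run s).var x = s.var x :=
  coreCmd.run_var s (by simp [coreCmd, closeCmd, varsChanged, h1, h2])

theorem run_coreCmd_arr (s : Store) {a : ℕ} (h1 : a ≠ 4) (h2 : a ≠ 5) :
    (coreCmd.run s).arr a = s.arr a :=
  coreCmd.run_arr s (by simp [coreCmd, closeCmd, arrsChanged, h1, h2])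

theorem hasInput_run_coreCmd (hs : s.HasInput n E) : (coreCmd.run s).HasInput n E :=
  hs.congr (run_coreCmd_var s (by omega) (by omega)) (run_coreCmd_var s (by omega) (by omega))
    (run_coreCmd_arr s (by omega) (by omega)) (run_coreCmd_arr s (by omega) (by omega))

/-- The set in array `5` has at least as many elements as variable `3` says. -/
def enoughTerm : Term := .not (.lt (.count 17 (.read 5 (.var 17))) (.var 3))

theorem holds_enoughTerm (hn : s.var 1 = n) :
    Term.Holds s enoughTerm ↔ s.var 3 ≤ (s.set n 5).ncard := by
  rw [enoughTerm, Term.holds_not, Term.holds_lt, Term.eval_count_read hn, not_lt]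
  rfl

/-- Find the least length of closed walks that give a large core of the complement of the set in
array `2`; put it into variable `10`, and `1` into variable `9` if there is one. -/
def searchCmd : Cmd :=
  seq (fill true 3 16 (.not (.read 2 (.var 16)))) (seq (assign 9 (.lit 0))
    (loop false 18 (seq (assign 8 (.var 18)) (seq coreCmd
      (ite (.and (.not (.var 9)) enoughTerm) (seq (assign 10 (.var 18)) (assign 9 (.lit 1)))
        (assign 9 (.var 9)))))))

/-- All lengths below `s.var 0` are tried in increasing order; the flag in variable `9` makes the
first success final, so variable `10` keeps the least length. -/
theorem run_searchCmd (hs : s.HasInput n E) {k : ℕ} (hk : s.var 3 = k) {P : Set (Fin n)}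
    (hP : s.set n 2 = P) :
    ((searchCmd.run s).var 9 = 0 ∧ ∀ l < s.var 0, (core E Pᶜ l).ncard < k) ∨
    ((searchCmd.run s).var 9 ≠ 0 ∧ (searchCmd.run s).var 10 < s.var 0 ∧
      (searchCmd.run s).var 10 = minLength E k Pᶜ ∧
      k ≤ (core E Pᶜ ((searchCmd.run s).var 10)).ncard) := by
  have hfill : ((fill true 3 16 (.not (.read 2 (.var 16)))).run s).set n 3 = Pᶜ := by
    rw [set_run_fill hs.var_one, ← hP]
    ext v
    simp [Store.set]
  have key := run_loop_induct (b := false) (x := 18)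
    (c := seq (assign 8 (.var 18)) (seq coreCmd
      (ite (.and (.not (.var 9)) enoughTerm) (seq (assign 10 (.var 18)) (assign 9 (.lit 1)))
        (assign 9 (.var 9)))))
    (s := (assign 9 (.lit 0)).run ((fill true 3 16 (.not (.read 2 (.var 16)))).run s))
    (I := fun i s' => s'.HasInput n E ∧ s'.var 0 = s.var 0 ∧ s'.var 3 = k ∧ s'.set n 3 = Pᶜ ∧
      ((s'.var 9 = 0 ∧ ∀ l < i, (core E Pᶜ l).ncard < k) ∨
      (s'.var 9 ≠ 0 ∧ s'.var 10 < i ∧ k ≤ (core E Pᶜ (s'.var 10)).ncard ∧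
        ∀ l < s'.var 10, (core E Pᶜ l).ncard < k)))
    ⟨hs.congr rfl rfl rfl rfl, rfl, hk, hfill, .inl ⟨rfl, fun l hl => absurd hl (by omega)⟩⟩ ?_
  · have hrun : (loop false 18 (seq (assign 8 (.var 18)) (seq coreCmd
      (ite (.and (.not (.var 9)) enoughTerm) (seq (assign 10 (.var 18)) (assign 9 (.lit 1)))
        (assign 9 (.var 9)))))).run ((assign 9 (.lit 0)).run
        ((fill true 3 16 (.not (.read 2 (.var 16)))).run s)) = searchCmd.run s := rfl
    rw [hrun] at key
    obtain ⟨-, -, -, -, h | ⟨h1, h2, h3, h4⟩⟩ := key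
    · exact .inl h
    · refine .inr ⟨h1, h2, ?_, h3⟩
      have hmem : (searchCmd.run s).var 10 ∈ {l | k ≤ (core E Pᶜ l).ncard} := h3
      refine le_antisymm ?_ (Nat.sInf_le hmem)
      by_contra hlt
      have h5 : k ≤ (core E Pᶜ (minLength E k Pᶜ)).ncard := Nat.sInf_mem ⟨_, hmem⟩
      exact absurd (h4 _ (not_le.1 hlt)) (not_lt.2 h5)
  · rintro i hi s' ⟨h1, h2, h3, h4, h5⟩
    rw [run_seq, run_seq]
    set s1 := (assign 8 (.var 18)).run (s'.setVar 18 i) with hs1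
    have hI1 : s1.HasInput n E := h1.congr rfl rfl rfl rfl
    have hcore : (coreCmd.run s1).set n 5 = core E Pᶜ i := by
      rw [set_run_coreCmd hI1]
      · rw [← h4]; rfl
      · have h6 : s1.var 8 = i := rfl
        have h7 : s1.var 0 = s'.var 0 := rfl
        rw [h6, h7, h2]
        exact hi.le
    set s2 := coreCmd.run s1 with hs2
    have hI2 : s2.HasInput n E := hasInput_run_coreCmd hI1
    have v0 : s2.var 0 = s.var 0 := (run_coreCmd_var s1 (by omega) (by omega)).trans h2
    have v3 : s2.var 3 = k := (run_coreCmd_var s1 (by omega) (by omega)).trans h3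
    have v9 : s2.var 9 = s'.var 9 := run_coreCmd_var s1 (by omega) (by omega)
    have v10 : s2.var 10 = s'.var 10 := run_coreCmd_var s1 (by omega) (by omega)
    have v18 : s2.var 18 = i := run_coreCmd_var s1 (by omega) (by omega)
    have a3 : s2.set n 3 = Pᶜ :=
      (Store.set_congr (run_coreCmd_arr s1 (by omega) (by omega))).trans h4
    have hcond : Term.Holds s2 (.and (.not (.var 9)) enoughTerm) ↔
        s'.var 9 = 0 ∧ k ≤ (core E Pᶜ i).ncard := by
      rw [Term.holds_and, holds_enoughTerm hI2.var_one, hcore, v3]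
      simp [v9]
    by_cases hc : s'.var 9 = 0 ∧ k ≤ (core E Pᶜ i).ncard
    · have hrun : (ite (.and (.not (.var 9)) enoughTerm) (seq (assign 10 (.var 18))
          (assign 9 (.lit 1))) (assign 9 (.var 9))).run s2 = (s2.setVar 10 i).setVar 9 1 := by
        rw [run_ite_pos (hcond.2 hc)]
        simp [run, v18]
      rw [hrun]
      refine ⟨hI2.congr rfl rfl rfl rfl, v0, v3, a3, .inr ⟨by simp, by simp, by simpa using hc.2, ?_⟩⟩
      rcases h5 with h5 | h5
      · simpa using h5.2
      · exact absurd hc.1 h5.1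
    · have hrun : (ite (.and (.not (.var 9)) enoughTerm) (seq (assign 10 (.var 18))
          (assign 9 (.lit 1))) (assign 9 (.var 9))).run s2 = s2.setVar 9 (s'.var 9) := by
        rw [run_ite_neg fun h => hc (hcond.1 h)]
        simp [run, v9]
      rw [hrun]
      refine ⟨hI2.congr rfl rfl rfl rfl, v0, v3, a3, ?_⟩
      rcases h5 with ⟨h5, h6⟩ | ⟨h5, h6, h7, h8⟩
      · refine .inl ⟨by simpa using h5, fun l hl => ?_⟩
        rcases Nat.lt_succ_iff_lt_or_eq.1 hl with h | rfl
        · exact h6 l h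
        · exact not_le.1 fun h => hc ⟨h5, h⟩
      · refine .inr ⟨by simpa using h5, ?_, by simpa [v10] using h7, by simpa [v10] using h8⟩
        simp only [Store.setVar_var, v10]
        simp only [show (10 : ℕ) ≠ 9 by omega, if_false]
        omega

/-- Compute in array `6` a minimal core that avoids the set in array `2`, for the length in variable
`10`. -/
def pruneCmd : Cmd :=
  seq (assign 8 (.var 10)) (seq (fill true 6 16 (.not (.read 2 (.var 16))))
    (loop true 19 (seq
      (fill true 3 16 (.and (.read 6 (.var 16)) (.not (.eq (.var 16) (.var 19))))) (seq coreCmd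
        (fill true 6 16
          (.and (.read 6 (.var 16)) (.not (.and (.eq (.var 16) (.var 19)) enoughTerm))))))))

theorem set_run_pruneCmd (hs : s.HasInput n E) {k l : ℕ} (hk : s.var 3 = k) (hl : s.var 10 = l)
    (hlN : l ≤ s.var 0) {P : Set (Fin n)} (hP : s.set n 2 = P) :
    (pruneCmd.run s).set n 6 = prune E k l Pᶜ n := by
  rw [pruneCmd, run_seq, run_seq]
  set s0 := (fill true 6 16 (.not (.read 2 (.var 16)))).run ((assign 8 (.var 10)).run s) with hs0
  have hI0 : s0.HasInput n E := hs.congr rfl rfl rfl rfl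
  have hfill : s0.set n 6 = Pᶜ := by
    rw [hs0, set_run_fill (by simpa [run] using hs.var_one), ← hP]
    ext v
    simp [Store.set, run]
  have hb : s0.var (boundVar true) = n := hI0.var_one
  rw [show prune E k l Pᶜ n = prune E k l Pᶜ (s0.var (boundVar true)) by rw [hb]]
  refine (run_loop_induct (b := true) (x := 19)
    (I := fun i s' => s'.HasInput n E ∧ s'.var 0 = s.var 0 ∧ s'.var 3 = k ∧ s'.var 8 = l ∧
      s'.set n 6 = prune E k l Pᶜ i)
    ⟨hI0, rfl, hk, hl, hfill⟩ ?_).2.2.2.2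
  rintro i hi s' ⟨h1, h2, h3, h4, h5⟩
  rw [run_seq, run_seq]
  set s1 := (fill true 3 16 (.and (.read 6 (.var 16)) (.not (.eq (.var 16) (.var 19))))).run
    (s'.setVar 19 i) with hs1
  have hI1 : s1.HasInput n E := h1.congr rfl rfl rfl rfl
  have h13 : s1.set n 3 = {w ∈ prune E k l Pᶜ i | (w : ℕ) ≠ i} := by
    rw [hs1, set_run_fill (by simpa using h1.var_one), ← h5]
    ext v
    simp [Store.set]
  have hcore : (coreCmd.run s1).set n 5 = core E {w ∈ prune E k l Pᶜ i | (w : ℕ) ≠ i} l := by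
    have h6 : s1.var 8 = l := h4
    have h7 : s1.var 0 = s.var 0 := h2
    rw [set_run_coreCmd hI1 (by rw [h6, h7]; exact hlN), h13, h6]
  set s2 := coreCmd.run s1 with hs2
  have hI2 : s2.HasInput n E := hasInput_run_coreCmd hI1
  have v0 : s2.var 0 = s.var 0 := (run_coreCmd_var s1 (by omega) (by omega)).trans h2
  have v3 : s2.var 3 = k := (run_coreCmd_var s1 (by omega) (by omega)).trans h3
  have v8 : s2.var 8 = l := (run_coreCmd_var s1 (by omega) (by omega)).trans h4
  have v19 : s2.var 19 = i := run_coreCmd_var s1 (by omega) (by omega)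
  have a6 : s2.set n 6 = prune E k l Pᶜ i :=
    (Store.set_congr (run_coreCmd_arr s1 (by omega) (by omega))).trans h5
  refine ⟨hI2.congr rfl rfl rfl rfl, v0, v3, v8, ?_⟩
  rw [set_run_fill hI2.var_one, prune, ← hcore]
  ext v
  have hv : v ∈ prune E k l Pᶜ i ↔ s2.arr 6 v ≠ 0 := by rw [← a6]; rfl
  simp only [Set.mem_ofPred_eq, hv, Term.holds_and, Term.holds_not,
    holds_enoughTerm (s := s2.setVar 16 v) (by simpa using hI2.var_one), Term.holds_eq]
  simp [v3, v19]

/-- Compute in array `7` the component of the vertex in variable `20` in the complement of the set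
in array `6`. -/
def compCmd : Cmd :=
  seq (fill true 7 16 (.and (.eq (.var 16) (.var 20)) (.not (.read 6 (.var 16)))))
    (closeCmd 7 (.and (.and (.not (.read 6 (.var 17))) (.not (.read 6 (.var 16))))
      (.or (.adj 17 16) (.adj 16 17))))

theorem set_run_compCmd (hs : s.HasInput n E) {v : Fin n} (hv : s.var 20 = v) :
    (compCmd.run s).set n 7 = comp E (s.set n 6)ᶜ v := by
  rw [compCmd, run_seq]
  set s1 := (fill true 7 16 (.and (.eq (.var 16) (.var 20)) (.not (.read 6 (.var 16))))).run s
    with hs1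
  have hI1 : s1.HasInput n E := hs.congr rfl rfl rfl rfl
  rw [set_run_closeCmd (R := UAdj E (s.set n 6)ᶜ) hI1.var_one hI1.le]
  · have h7 : s1.set n 7 = {u | u = v ∧ v ∉ s.set n 6} := by
      rw [hs1, set_run_fill hs.var_one]
      ext u
      simp only [Set.mem_ofPred_eq, Term.holds_and, Term.holds_eq, Term.holds_not, Term.holds_read,
        Term.eval_var, Store.setVar_var, Store.setVar_arr, if_true,
        if_neg (show (20 : ℕ) ≠ 16 by omega), hv, ← Fin.ext_iff]
      constructor
      · rintro ⟨rfl, h⟩; exact ⟨rfl, h⟩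
      · rintro ⟨rfl, h⟩; exact ⟨rfl, h⟩
    rw [h7]
    ext w
    constructor
    · rintro ⟨u, ⟨rfl, h1⟩, h2⟩; exact ⟨h1, h2⟩
    · rintro ⟨h1, h2⟩; exact ⟨v, ⟨rfl, h1⟩, h2⟩
  · intro s' h1 h2 u w
    have hI : ((s'.setVar 16 w).setVar 17 u).HasInput n E :=
      ((hI1.congr (h1 0 (by omega)) (h1 1 (by omega)) (h2 0 (by omega)) (h2 1 (by omega))).setVar
        (by omega) _).setVar (by omega) _
    have h6 : s'.arr 6 = s.arr 6 := (h2 6 (by omega)).trans (by simp [hs1, run])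
    simp only [Term.holds_and, Term.holds_or, Term.holds_not,
      hI.holds_adj (x := 17) (y := 16) (u := u) (v := w) (by simp) (by simp),
      hI.holds_adj (x := 16) (y := 17) (u := w) (v := u) (by simp) (by simp)]
    simp [Store.set, UAdj, h6, and_assoc]

theorem run_compCmd_var (s : Store) {x : ℕ} (h : x ≠ 15) : (compCmd.run s).var x = s.var x :=
  compCmd.run_var s (by simp [compCmd, closeCmd, varsChanged, h])

theorem run_compCmd_arr (s : Store) {a : ℕ} (h : a ≠ 7) : (compCmd.run s).arr a = s.arr a :=
  compCmd.run_arr s (by simp [compCmd, closeCmd, arrsChanged, h])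

theorem hasInput_run_compCmd (hs : s.HasInput n E) : (compCmd.run s).HasInput n E :=
  hs.congr (run_compCmd_var s (by omega)) (run_compCmd_var s (by omega))
    (run_compCmd_arr s (by omega)) (run_compCmd_arr s (by omega))

/-- Accept if the complement of the set in array `6` has a component that is large enough; compute
in array `7` its component of the vertex in variable `6`. -/
def compsCmd : Cmd :=
  seq (loop true 20 (seq compCmd
    (assign 5 (.or (.var 5) (.not (.lt (.count 17 (.read 7 (.var 17))) (.var 2)))))))
    (seq (assign 20 (.var 6)) compCmd)

theorem run_compsCmd (hs : s.HasInput n E) {k : ℕ} (hk : s.var 2 = k) {r : Fin n}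
    (hr : s.var 6 = r) {Y : Set (Fin n)} (hY : s.set n 6 = Y) :
    ((compsCmd.run s).var 5 ≠ 0 ↔ s.var 5 ≠ 0 ∨ ∃ v, k ≤ (comp E Yᶜ v).ncard) ∧
      (compsCmd.run s).set n 7 = comp E Yᶜ r := by
  rw [compsCmd, run_seq, run_seq]
  set c1 := loop true 20 (seq compCmd
    (assign 5 (.or (.var 5) (.not (.lt (.count 17 (.read 7 (.var 17))) (.var 2)))))) with hc1
  have key : (c1.run s).HasInput n E ∧ (c1.run s).var 2 = k ∧ (c1.run s).set n 6 = Y ∧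
      (c1.run s).var 6 = r ∧ ((c1.run s).var 5 ≠ 0 ↔ s.var 5 ≠ 0 ∨
        ∃ v : Fin n, (v : ℕ) < s.var (boundVar true) ∧ k ≤ (comp E Yᶜ v).ncard) := by
    refine run_loop_induct (I := fun i s' => s'.HasInput n E ∧ s'.var 2 = k ∧ s'.set n 6 = Y ∧
      s'.var 6 = r ∧ (s'.var 5 ≠ 0 ↔ s.var 5 ≠ 0 ∨
        ∃ v : Fin n, (v : ℕ) < i ∧ k ≤ (comp E Yᶜ v).ncard)) ⟨hs, hk, hY, hr, by simp⟩ ?_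
    rintro i hi s' ⟨h1, h2, h3, h4, h5⟩
    rw [boundVar, if_pos rfl, hs.var_one] at hi
    obtain ⟨v₀, rfl⟩ : ∃ v₀ : Fin n, i = v₀ := ⟨⟨i, hi⟩, rfl⟩
    rw [run_seq]
    have hI1 : (s'.setVar 20 v₀).HasInput n E := h1.setVar (by omega) _
    have hcomp : (compCmd.run (s'.setVar 20 v₀)).set n 7 = comp E Yᶜ v₀ := by
      rw [set_run_compCmd hI1 (v := v₀) (by simp), ← h3]; rfl
    set s2 := compCmd.run (s'.setVar 20 v₀) with hs2
    have hI2 : s2.HasInput n E := hasInput_run_compCmd hI1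
    have v2 : s2.var 2 = k := (run_compCmd_var _ (by omega)).trans h2
    have v5 : s2.var 5 = s'.var 5 := run_compCmd_var _ (by omega)
    have v6 : s2.var 6 = r := (run_compCmd_var _ (by omega)).trans h4
    have a6 : s2.set n 6 = Y := (Store.set_congr (run_compCmd_arr _ (by omega))).trans h3
    refine ⟨hI2.congr rfl rfl rfl rfl, v2, a6, v6, ?_⟩
    have : ((assign 5 (.or (.var 5) (.not (.lt (.count 17 (.read 7 (.var 17))) (.var 2))))).run
        s2).var 5 ≠ 0 ↔ s'.var 5 ≠ 0 ∨ k ≤ (comp E Yᶜ v₀).ncard := by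
      rw [run, Store.setVar_var, if_pos rfl]
      change Term.Holds _ _ ↔ _
      rw [Term.holds_or, Term.holds_not, Term.holds_lt, Term.eval_count_read hI2.var_one, hcomp,
        Term.holds_var, Term.eval_var, v5, v2, not_lt]
    rw [this, h5, or_assoc]
    refine or_congr_right ?_
    constructor
    · rintro (⟨v, h6, h7⟩ | h6)
      · exact ⟨v, by omega, h7⟩
      · exact ⟨v₀, by omega, h6⟩
    · rintro ⟨v, h6, h7⟩
      by_cases hv : (v : ℕ) < v₀
      · exact .inl ⟨v, hv, h7⟩
      · obtain rfl : v = v₀ := Fin.ext (by omega)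
        exact .inr h7
  obtain ⟨h1, h2, h3, h4, h5⟩ := key
  set s1 := (assign 20 (.var 6)).run (c1.run s) with hs1
  have hI1 : s1.HasInput n E := h1.congr rfl rfl rfl rfl
  have v20 : s1.var 20 = r := h4
  have a6 : s1.set n 6 = Y := h3
  refine ⟨?_, by rw [set_run_compCmd hI1 v20, a6]⟩
  rw [run_compCmd_var _ (by omega)]
  have : s1.var 5 = (c1.run s).var 5 := rfl
  rw [this, h5]
  refine or_congr_right ?_
  constructor
  · rintro ⟨v, -, h⟩; exact ⟨v, h⟩
  · rintro ⟨v, h⟩; exact ⟨v, hs.var_one.symm ▸ v.2, h⟩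

/-- Compute the candidates in array `8`, and accept if there are many. -/
def candCmd : Cmd :=
  seq (assign 8 (.var 0)) (seq (loop true 22 (seq
    (fill true 3 16 (.and (.not (.read 2 (.var 16))) (.not (.eq (.var 16) (.var 22)))))
    (seq coreCmd (fill true 8 16 (.ite (.eq (.var 16) (.var 22))
      (.and (.read 6 (.var 16)) (.and
        (.ex 17 (.and (.read 7 (.var 17)) (.or (.adj 17 16) (.adj 16 17)))) enoughTerm))
      (.read 8 (.var 16)))))))
    (assign 5 (.or (.var 5) (.lt (.var 4) (.count 17 (.read 8 (.var 17)))))))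

/-- The round for v changes only the entry v of array `8`, so after i rounds the entries below i are
correct. -/
theorem run_candCmd (hs : s.HasInput n E) {k M : ℕ} (hk : s.var 3 = k) (hM : s.var 4 = M)
    {P Y K C : Set (Fin n)} (hP : s.set n 2 = P) (hY : s.set n 6 = Y) (hK : s.set n 7 = K)
    (hC : C = {v | v ∈ Y ∧ (∃ u ∈ K, E u v ∨ E v u) ∧
      k ≤ (core E {w | w ∉ P ∧ w ≠ v} (s.var 0)).ncard}) :
    (candCmd.run s).set n 8 = C ∧ ((candCmd.run s).var 5 ≠ 0 ↔ s.var 5 ≠ 0 ∨ M < C.ncard) := by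
  rw [candCmd, run_seq, run_seq]
  set s0 := (assign 8 (.var 0)).run s with hs0
  set c1 := loop true 22 (seq
    (fill true 3 16 (.and (.not (.read 2 (.var 16))) (.not (.eq (.var 16) (.var 22)))))
    (seq coreCmd (fill true 8 16 (.ite (.eq (.var 16) (.var 22))
      (.and (.read 6 (.var 16)) (.and
        (.ex 17 (.and (.read 7 (.var 17)) (.or (.adj 17 16) (.adj 16 17)))) enoughTerm))
      (.read 8 (.var 16)))))) with hc1
  have key : (c1.run s0).HasInput n E ∧ (c1.run s0).var 0 = s.var 0 ∧ (c1.run s0).var 3 = k ∧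
      (c1.run s0).var 8 = s.var 0 ∧ (c1.run s0).var 4 = M ∧ (c1.run s0).var 5 = s.var 5 ∧
      (c1.run s0).set n 2 = P ∧ (c1.run s0).set n 6 = Y ∧ (c1.run s0).set n 7 = K ∧
      ∀ v : Fin n, (v : ℕ) < s0.var (boundVar true) → (v ∈ (c1.run s0).set n 8 ↔ v ∈ C) := by
    refine run_loop_induct (I := fun i s' => s'.HasInput n E ∧ s'.var 0 = s.var 0 ∧ s'.var 3 = k ∧
      s'.var 8 = s.var 0 ∧ s'.var 4 = M ∧ s'.var 5 = s.var 5 ∧ s'.set n 2 = P ∧ s'.set n 6 = Y ∧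
      s'.set n 7 = K ∧ ∀ v : Fin n, (v : ℕ) < i → (v ∈ s'.set n 8 ↔ v ∈ C))
      ⟨hs.congr rfl rfl rfl rfl, rfl, hk, rfl, hM, rfl, hP, hY, hK,
        fun v hv => absurd hv (by omega)⟩ ?_
    rintro i hi s' ⟨h1, h2, h3, h4, h5, h6, h7, h8, h9, h10⟩
    have hi' : i < n := by
      have : s0.var (boundVar true) = n := hs.var_one
      omega
    obtain ⟨v₀, rfl⟩ : ∃ v₀ : Fin n, i = v₀ := ⟨⟨i, hi'⟩, rfl⟩
    rw [run_seq, run_seq]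
    set s1 := (fill true 3 16 (.and (.not (.read 2 (.var 16)))
      (.not (.eq (.var 16) (.var 22))))).run (s'.setVar 22 v₀) with hs1
    have hI1 : s1.HasInput n E := h1.congr rfl rfl rfl rfl
    have h13 : s1.set n 3 = {w | w ∉ P ∧ w ≠ v₀} := by
      rw [hs1, set_run_fill (by simpa using h1.var_one), ← h7]
      ext v
      simp [Store.set, Fin.ext_iff]
    have hcore : (coreCmd.run s1).set n 5 = core E {w | w ∉ P ∧ w ≠ v₀} (s.var 0) := by
      have e1 : s1.var 8 = s.var 0 := h4
      have e2 : s1.var 0 = s.var 0 := h2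
      rw [set_run_coreCmd hI1 (by rw [e1, e2]), h13, e1]
    set s2 := coreCmd.run s1 with hs2
    have hI2 : s2.HasInput n E := hasInput_run_coreCmd hI1
    have v0 : s2.var 0 = s.var 0 := (run_coreCmd_var s1 (by omega) (by omega)).trans h2
    have v3 : s2.var 3 = k := (run_coreCmd_var s1 (by omega) (by omega)).trans h3
    have v8 : s2.var 8 = s.var 0 := (run_coreCmd_var s1 (by omega) (by omega)).trans h4
    have v4 : s2.var 4 = M := (run_coreCmd_var s1 (by omega) (by omega)).trans h5
    have v5 : s2.var 5 = s.var 5 := (run_coreCmd_var s1 (by omega) (by omega)).trans h6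
    have v22 : s2.var 22 = v₀ := run_coreCmd_var s1 (by omega) (by omega)
    have a2 : s2.set n 2 = P :=
      (Store.set_congr (run_coreCmd_arr s1 (by omega) (by omega))).trans h7
    have a6 : s2.set n 6 = Y :=
      (Store.set_congr (run_coreCmd_arr s1 (by omega) (by omega))).trans h8
    have a7 : s2.set n 7 = K :=
      (Store.set_congr (run_coreCmd_arr s1 (by omega) (by omega))).trans h9
    have a8 : s2.set n 8 = s'.set n 8 :=
      Store.set_congr (run_coreCmd_arr s1 (by omega) (by omega))
    refine ⟨hI2.congr rfl rfl rfl rfl, v0, v3, v8, v4, v5, a2, a6, a7, ?_⟩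
    intro v hv
    rw [set_run_fill hI2.var_one, Set.mem_ofPred_eq, Term.holds_ite, Term.holds_eq]
    simp only [Term.eval_var, Store.setVar_var, if_true, if_neg (show (22 : ℕ) ≠ 16 by omega), v22,
      ← Fin.ext_iff]
    by_cases hvv : v = v₀
    · subst hvv
      have hI : ∀ u : Fin n, ((s2.setVar 16 v).setVar 17 u).HasInput n E :=
        fun u => (hI2.setVar (by omega) _).setVar (by omega) _
      have hadj1 : ∀ u : Fin n, Term.Holds ((s2.setVar 16 v).setVar 17 u) (.adj 17 16) ↔ E u v :=
        fun u => (hI u).holds_adj (by simp) (by simp)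
      have hadj2 : ∀ u : Fin n, Term.Holds ((s2.setVar 16 v).setVar 17 u) (.adj 16 17) ↔ E v u :=
        fun u => (hI u).holds_adj (by simp) (by simp)
      simp only [true_and, not_true_eq_false, false_and, or_false, Term.holds_and, Term.holds_or,
        Term.holds_ex (s := s2.setVar 16 v) (by simpa using hI2.var_one),
        holds_enoughTerm (s := s2.setVar 16 v) (by simpa using hI2.var_one),
        hadj1, hadj2]
      rw [hC, Set.mem_ofPred_eq, ← a6, ← a7, ← hcore]
      simp [v3, Store.set]
    · rw [← h10 v (by have := Fin.val_ne_of_ne hvv; omega), ← a8]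
      simp [hvv, Store.set]
  obtain ⟨h1, h2, h3, h4, h5, h6, h7, h8, h9, h10⟩ := key
  have hset : (c1.run s0).set n 8 = C := by
    ext v
    exact h10 v (lt_of_lt_of_eq v.2 hs.var_one.symm)
  refine ⟨hset, ?_⟩
  rw [run, Store.setVar_var, if_pos rfl]
  change Term.Holds _ _ ↔ _
  rw [Term.holds_or, Term.holds_lt, Term.eval_count_read h1.var_one, hset, Term.holds_var,
    Term.eval_var, h5, h6]

end ConnIn

/-! ### Multiplication, division, and the command for one step. -/

namespace RAM.Term

/-- The product is a sum over i below variable `0` in which the first `t` summands are `u`. Neither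
factor may depend on the summation variable `25`. -/
theorem eval_mul {s : Store} {t u : Term} (ht : ∀ i, t.eval (s.setVar 25 i) = t.eval s)
    (hu : ∀ i, u.eval (s.setVar 25 i) = u.eval s) (hle : t.eval s ≤ s.var 0) :
    (mul t u).eval s = t.eval s * u.eval s := by
  classical
  have h : (mul t u).eval s =
      ∑ i ∈ Finset.range (s.var 0), if i < t.eval s then u.eval s else 0 := by
    simp only [mul, eval, boundVar, Bool.false_eq_true, if_false]
    refine Finset.sum_congr rfl fun i _ => ?_
    have : Holds (s.setVar 25 i) (lt (.var 25) t) ↔ i < t.eval s := by simp [ht]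
    simp only [Holds] at this
    simp only [this, hu]
  rw [h, ← Finset.sum_filter, Finset.sum_const, smul_eq_mul]
  congr 1
  have : (Finset.range (s.var 0)).filter (· < t.eval s) = Finset.range (t.eval s) := by
    ext i; simp; omega
  rw [this, Finset.card_range]

end RAM.Term

namespace ConnIn

open RAM RAM.Cmd

variable {n : ℕ} {E : Fin n → Fin n → Prop} {s : Store}

/-- The quotient of the variables `7` and `4`. -/
def divTerm : Term :=
  .sum false 17 (.ite (.not (.lt (.var 7) (.mul (.plus (.var 17) (.lit 1)) (.var 4))))
    (.lit 1) (.lit 0))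

/-- The quotient counts the i with (i + 1) · `s.var 4` ≤ `s.var 7`; they are all below `s.var 0`. -/
theorem eval_divTerm (h7 : s.var 7 ≤ s.var 0) (h4 : 0 < s.var 4) :
    divTerm.eval s = s.var 7 / s.var 4 := by
  classical
  have h : divTerm.eval s =
      ∑ i ∈ Finset.range (s.var 0), if i < s.var 7 / s.var 4 then 1 else 0 := by
    rw [divTerm, Term.eval]
    simp only [boundVar, Bool.false_eq_true, if_false]
    refine Finset.sum_congr rfl fun i hi => ?_
    rw [Finset.mem_range] at hi
    rw [Term.eval_ite]
    have : Term.Holds (s.setVar 17 i) (.not (.lt (.var 7)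
        (.mul (.plus (.var 17) (.lit 1)) (.var 4)))) ↔ i < s.var 7 / s.var 4 := by
      rw [Term.holds_not, Term.holds_lt, Term.eval_mul (fun j => by simp [Term.eval])
        (fun j => by simp) (by simp [Term.eval]; omega), not_lt,
        ← Nat.add_one_le_iff (n := i), Nat.le_div_iff_mul_le h4]
      simp [Term.eval]
    simp only [this]
    simp
  rw [h, Finset.sum_boole]
  have h1 := Nat.div_le_self (s.var 7) (s.var 4)
  have : (Finset.range (s.var 0)).filter (· < s.var 7 / s.var 4) =
      Finset.range (s.var 7 / s.var 4) := by
    ext i; simp; omega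
  simp [this]

/-- Add to the set in array `2` the candidate whose number is given by the last digit of variable
`7`, and remove that digit. -/
def pickCmd : Cmd :=
  seq (assign 23 divTerm) (seq (assign 24 (.minus (.var 7) (.mul (.var 23) (.var 4))))
    (seq (fill true 2 16 (.or (.read 2 (.var 16)) (.and (.read 8 (.var 16))
      (.eq (.count 17 (.and (.lt (.var 17) (.var 16)) (.read 8 (.var 17)))) (.var 24)))))
    (assign 7 (.var 23))))

theorem run_pickCmd (hs : s.HasInput n E) (h7 : s.var 7 ≤ s.var 0) (h4 : 0 < s.var 4) :
    (pickCmd.run s).set n 2 = s.set n 2 ∪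
      {v ∈ s.set n 8 | rank (s.set n 8) v = s.var 7 % s.var 4} ∧
    (pickCmd.run s).var 7 = s.var 7 / s.var 4 := by
  rw [pickCmd, run_seq, run_seq, run_seq]
  have hs1 : (assign 23 divTerm).run s = s.setVar 23 (s.var 7 / s.var 4) := by
    rw [run, eval_divTerm h7 h4]
  rw [hs1]
  have hs2 : (assign 24 (.minus (.var 7) (.mul (.var 23) (.var 4)))).run
      (s.setVar 23 (s.var 7 / s.var 4)) =
      (s.setVar 23 (s.var 7 / s.var 4)).setVar 24 (s.var 7 % s.var 4) := by
    rw [run, Term.eval, Term.eval_mul (fun j => by simp) (fun j => by simp)]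
    · have := Nat.div_add_mod (s.var 7) (s.var 4)
      rw [mul_comm] at this
      congr 1
      simp
      omega
    · simpa using (Nat.div_le_self _ _).trans h7
  rw [hs2]
  set s2 := (s.setVar 23 (s.var 7 / s.var 4)).setVar 24 (s.var 7 % s.var 4) with hs2
  have hI : s2.HasInput n E := hs.congr rfl rfl rfl rfl
  refine ⟨?_, ?_⟩
  · rw [run, Store.set_setVar, set_run_fill hI.var_one]
    ext v
    simp only [Set.mem_ofPred_eq, Term.holds_or, Term.holds_and, Term.holds_eq,
      Term.eval_count (s := s2.setVar 16 v) (by simpa using hI.var_one), Set.mem_union, rank]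
    simp [Store.set, hs2]
  · simp [run, hs2]

/-- One step of the search. -/
def stepCmd : Cmd :=
  seq searchCmd (ite (.var 9) (seq pruneCmd (seq compsCmd (seq candCmd pickCmd)))
    (assign 9 (.var 9)))

theorem searchCmd_wf : searchCmd.Wf 30 := by
  simp [searchCmd, coreCmd, closeCmd, enoughTerm, Cmd.Wf, Term.Wf, Term.and, Term.or, Term.eq,
    Term.not, Term.lt, Term.ex, Term.adj, Term.count]

theorem pruneCmd_wf : pruneCmd.Wf 30 := by
  simp [pruneCmd, coreCmd, closeCmd, enoughTerm, Cmd.Wf, Term.Wf, Term.and, Term.or, Term.eq,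
    Term.not, Term.lt, Term.ex, Term.adj, Term.count]

theorem compsCmd_wf : compsCmd.Wf 30 := by
  simp [compsCmd, compCmd, closeCmd, Cmd.Wf, Term.Wf, Term.and, Term.or, Term.eq,
    Term.not, Term.lt, Term.ex, Term.adj, Term.count]

theorem candCmd_wf : candCmd.Wf 30 := by
  simp [candCmd, coreCmd, closeCmd, enoughTerm, Cmd.Wf, Term.Wf, Term.and, Term.or, Term.eq,
    Term.not, Term.lt, Term.ex, Term.adj, Term.count]

theorem pickCmd_wf : pickCmd.Wf 30 := by
  simp [pickCmd, divTerm, Cmd.Wf, Term.Wf, Term.and, Term.or, Term.eq,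
    Term.not, Term.lt, Term.mul, Term.count]

theorem stepCmd_wf : stepCmd.Wf 30 :=
  ⟨searchCmd_wf, by simp [Term.Wf], ⟨pruneCmd_wf, compsCmd_wf, candCmd_wf, pickCmd_wf⟩,
    by simp [Cmd.Wf, Term.Wf]⟩

/-- Without a length below `N` that gives a large core, the answer stays as it is. The claim on the
answer holds whatever variable `7` contains; only picking a candidate by its number needs the bounds
for division. -/
theorem run_stepCmd (hs : s.HasInput n E) {k₁ k₂ M N : ℕ} {r : Fin n} {P : Set (Fin n)}
    (h0 : s.var 0 = N) (h2 : s.var 2 = k₁) (h3 : s.var 3 = k₂) (h4 : s.var 4 = M)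
    (h6 : s.var 6 = r) (hP : s.set n 2 = P) :
    ((stepCmd.run s).var 5 = s.var 5 ∧ ∀ l < N, (core E Pᶜ l).ncard < k₂) ∨
    (∃ l, k₂ ≤ (core E Pᶜ l).ncard) ∧
      ((stepCmd.run s).var 5 ≠ 0 ↔ s.var 5 ≠ 0 ∨ Accepts E N M k₁ k₂ r P) ∧
      (s.var 7 ≤ N → 0 < M →
        (stepCmd.run s).set n 2 =
          P ∪ {v ∈ candidates E N k₂ r P | rank (candidates E N k₂ r P) v = s.var 7 % M} ∧
        (stepCmd.run s).var 7 = s.var 7 / M) := by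
  rw [stepCmd, run_seq]
  have key := run_searchCmd hs h3 hP
  rw [h0] at key
  set s1 := searchCmd.run s with hs1
  have hI1 : s1.HasInput n E := hs.run searchCmd_wf (by decide) (by decide)
  have v0 : s1.var 0 = N := (searchCmd.run_var s (by decide)).trans h0
  have v2 : s1.var 2 = k₁ := (searchCmd.run_var s (by decide)).trans h2
  have v3 : s1.var 3 = k₂ := (searchCmd.run_var s (by decide)).trans h3
  have v4 : s1.var 4 = M := (searchCmd.run_var s (by decide)).trans h4
  have v5 : s1.var 5 = s.var 5 := searchCmd.run_var s (by decide)
  have v6 : s1.var 6 = r := (searchCmd.run_var s (by decide)).trans h6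
  have v7 : s1.var 7 = s.var 7 := searchCmd.run_var s (by decide)
  have a2 : s1.set n 2 = P := (Store.set_congr (searchCmd.run_arr s (by decide))).trans hP
  rcases key with ⟨k9, hno⟩ | ⟨k9, k10, hmin, hk⟩
  · left
    rw [run_ite_neg (by simpa using k9)]
    exact ⟨by simp [run, v5], hno⟩
  right
  rw [run_ite_pos (by simpa using k9), run_seq, run_seq, run_seq]
  have hY := set_run_pruneCmd hI1 v3 rfl (by rw [v0]; exact k10.le) a2
  rw [hmin] at hY
  change _ = minCore E k₂ P at hY
  set s2 := pruneCmd.run s1 with hs2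
  have hI2 : s2.HasInput n E := hI1.run pruneCmd_wf (by decide) (by decide)
  have w0 : s2.var 0 = N := (pruneCmd.run_var s1 (by decide)).trans v0
  have w2 : s2.var 2 = k₁ := (pruneCmd.run_var s1 (by decide)).trans v2
  have w3 : s2.var 3 = k₂ := (pruneCmd.run_var s1 (by decide)).trans v3
  have w4 : s2.var 4 = M := (pruneCmd.run_var s1 (by decide)).trans v4
  have w5 : s2.var 5 = s.var 5 := (pruneCmd.run_var s1 (by decide)).trans v5
  have w6 : s2.var 6 = r := (pruneCmd.run_var s1 (by decide)).trans v6
  have w7 : s2.var 7 = s.var 7 := (pruneCmd.run_var s1 (by decide)).trans v7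
  have b2 : s2.set n 2 = P := (Store.set_congr (pruneCmd.run_arr s1 (by decide))).trans a2
  obtain ⟨hc5, hK⟩ := run_compsCmd hI2 w2 w6 hY
  rw [w5] at hc5
  set s3 := compsCmd.run s2 with hs3
  have hI3 : s3.HasInput n E := hI2.run compsCmd_wf (by decide) (by decide)
  have x0 : s3.var 0 = N := (compsCmd.run_var s2 (by decide)).trans w0
  have x3 : s3.var 3 = k₂ := (compsCmd.run_var s2 (by decide)).trans w3
  have x4 : s3.var 4 = M := (compsCmd.run_var s2 (by decide)).trans w4
  have x7 : s3.var 7 = s.var 7 := (compsCmd.run_var s2 (by decide)).trans w7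
  have c2 : s3.set n 2 = P := (Store.set_congr (compsCmd.run_arr s2 (by decide))).trans b2
  have c6 : s3.set n 6 = minCore E k₂ P :=
    (Store.set_congr (compsCmd.run_arr s2 (by decide))).trans hY
  obtain ⟨hC, hd5⟩ := run_candCmd hI3 x3 x4 c2 c6 hK (C := candidates E N k₂ r P)
    (by rw [x0]; rfl)
  set s4 := candCmd.run s3 with hs4
  have hI4 : s4.HasInput n E := hI3.run candCmd_wf (by decide) (by decide)
  have y0 : s4.var 0 = N := (candCmd.run_var s3 (by decide)).trans x0
  have y4 : s4.var 4 = M := (candCmd.run_var s3 (by decide)).trans x4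
  have y7 : s4.var 7 = s.var 7 := (candCmd.run_var s3 (by decide)).trans x7
  have d2 : s4.set n 2 = P := (Store.set_congr (candCmd.run_arr s3 (by decide))).trans c2
  refine ⟨⟨_, hk⟩, ?_, fun h7 hM => ?_⟩
  · rw [pickCmd.run_var s4 (by decide), hd5, hc5, or_assoc]
    rfl
  · have := run_pickCmd hI4 (by rw [y7, y0]; exact h7) (by rw [y4]; exact hM)
    rwa [d2, hC, y7, y4] at this

end ConnIn

/-! ### The guided search and the main loop. -/

namespace ConnIn

open RAM RAM.Cmd

section Guided

variable {n : ℕ} (E : Fin n → Fin n → Prop) (N M k₁ k₂ : ℕ) (r : Fin n)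

/-- The search that starts with the set `P` and is guided by the digits of `σ` in base `M` accepts
after at most `m` extensions of `P`. -/
def Guided : ℕ → Set (Fin n) → ℕ → Prop
  | 0, P, _ => (∃ l < N, k₂ ≤ (core E Pᶜ l).ncard) ∧ Accepts E N M k₁ k₂ r P
  | m + 1, P, σ => (∃ l < N, k₂ ≤ (core E Pᶜ l).ncard) ∧ (Accepts E N M k₁ k₂ r P ∨
      ∃ v ∈ candidates E N k₂ r P, rank (candidates E N k₂ r P) v = σ % M ∧
        Guided m (insert v P) (σ / M))

variable {E N M k₁ k₂ r}

/-- The digits of σ are the ranks of the successive vertices of `X`, the first one being the lowest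
digit. For `m = 0` nothing of `X` is left outside `P`, so the step must accept. -/
theorem exists_guided {X : Set (Fin n)} (hX : Conn E X) (hk₁ : k₁ ≤ X.ncard) (hr : r ∈ X) {l : ℕ}
    (hlN : l < N) (hXl : k₂ ≤ (core E Xᶜ l).ncard) (hM : 0 < M) {m : ℕ} {P : Set (Fin n)} (hrP : r ∈ P)
    (hPX : P ⊆ X) (hm : (X \ P).ncard = m) : ∃ σ < M ^ m, Guided E N M k₁ k₂ r m P σ := by
  induction m generalizing P with
  | zero =>
    refine ⟨0, by simp, ⟨l, hlN, hXl.trans (Set.ncard_le_ncard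
      (core_mono (Set.compl_subset_compl.2 hPX) le_rfl) (Set.toFinite _))⟩, ?_⟩
    refine (accepts_or_exists_candidate hX hk₁ hr hrP hPX hlN.le hXl).resolve_right ?_
    rintro ⟨v, -, hv, hvP, -⟩
    rw [Set.ncard_eq_zero (Set.toFinite _)] at hm
    exact (hm ▸ (⟨hv, hvP⟩ : v ∈ X \ P) : v ∈ (∅ : Set (Fin n)))
  | succ m ih =>
    have hf : ∃ l < N, k₂ ≤ (core E Pᶜ l).ncard := ⟨l, hlN, hXl.trans (Set.ncard_le_ncard
      (core_mono (Set.compl_subset_compl.2 hPX) le_rfl) (Set.toFinite _))⟩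
    rcases accepts_or_exists_candidate (M := M) hX hk₁ hr hrP hPX hlN.le hXl with
      h | ⟨v, hv, hvX, hvP, hvM⟩
    · exact ⟨0, Nat.pow_pos hM, hf, .inl h⟩
    · have hm' : (X \ insert v P).ncard = m := by
        have : X \ insert v P = (X \ P) \ {v} := by
          ext w; simp only [Set.mem_sdiff, Set.mem_insert_iff, Set.mem_singleton_iff]; tauto
        rw [this, Set.ncard_sdiff_singleton_of_mem (show v ∈ X \ P from ⟨hvX, hvP⟩), hm, Nat.add_sub_cancel]
      obtain ⟨σ, hσ, h⟩ := ih (P := insert v P) (Set.mem_insert_of_mem _ hrP)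
        (Set.insert_subset hvX hPX) hm'
      refine ⟨rank (candidates E N k₂ r P) v + M * σ, ?_, hf, .inr ⟨v, hv, ?_, ?_⟩⟩
      · calc rank (candidates E N k₂ r P) v + M * σ < M + M * σ := by omega
          _ = M * (σ + 1) := by ring
          _ ≤ M * M ^ m := Nat.mul_le_mul_left _ hσ
          _ = M ^ (m + 1) := by ring
      · rw [Nat.add_mul_mod_self_left, Nat.mod_eq_of_lt hvM]
      · rwa [Nat.add_mul_div_left _ _ hM, Nat.div_eq_of_lt hvM, zero_add]

end Guided

/-- One search, guided by the value of variable `12`. -/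
def trialCmd : Cmd :=
  seq (assign 7 (.var 12)) (seq (fill true 2 16 (.eq (.var 16) (.var 6))) (loop false 13 stepCmd))

theorem trialCmd_wf : trialCmd.Wf 30 :=
  ⟨by simp [Cmd.Wf, Term.Wf], by simp [Term.Wf, Term.eq, Term.not, Cmd.Wf], by omega, stepCmd_wf⟩

/-- The algorithm, for parameters `k₁`, `k₂`, `M` in the variables `2`, `3`, `4`. The answer is
left in the variable `5`. -/
def mainCmd : Cmd :=
  seq (fill false 1 16 (.mul (.var 16) (.var 1)))
    (seq (assign 5 (.and (.not (.var 2)) (.not (.lt (.var 1) (.var 3)))))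
      (loop true 6 (loop false 12 trialCmd)))

theorem mainCmd_wf : mainCmd.Wf 30 :=
  ⟨by simp [Cmd.Wf, Term.Wf, Term.mul, Term.lt],
    by simp [Cmd.Wf, Term.Wf, Term.and, Term.not, Term.lt], by omega, by omega, trialCmd_wf⟩

/-- The store holds the input and the parameters. -/
structure IsReady {n : ℕ} (E : Fin n → Fin n → Prop) (N M k₁ k₂ : ℕ) (s : Store) : Prop where
  hasInput : s.HasInput n E
  var_zero : s.var 0 = N
  var_two : s.var 2 = k₁
  var_three : s.var 3 = k₂
  var_four : s.var 4 = M

variable {n : ℕ} {E : Fin n → Fin n → Prop} {N M k₁ k₂ : ℕ} {s : Store} {r : Fin n}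

theorem IsReady.setVar (h : IsReady E N M k₁ k₂ s) {x : ℕ} (hx : 5 ≤ x) (m : ℕ) :
    IsReady E N M k₁ k₂ (s.setVar x m) := by
  refine ⟨h.1.setVar (by omega) m, ?_, ?_, ?_, ?_⟩ <;>
    rw [Store.setVar_var, if_neg (by omega)]
  exacts [h.2, h.3, h.4, h.5]

theorem IsReady.run_stepCmd (h : IsReady E N M k₁ k₂ s) : IsReady E N M k₁ k₂ (stepCmd.run s) :=
  ⟨h.1.run stepCmd_wf (by decide) (by decide), (stepCmd_wf.run_var s (by omega)).trans h.2,
    (stepCmd.run_var s (by decide)).trans h.3, (stepCmd.run_var s (by decide)).trans h.4,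
    (stepCmd.run_var s (by decide)).trans h.5⟩

/-- A loop that raises the flag in variable `5` if one of its iterations does. -/
theorem run_loop_flag {b : Bool} {x : ℕ} {c : Cmd} {I : Store → Prop} {Q : Prop} {T : ℕ → Prop}
    (h0 : I s) (h : ∀ i < s.var (boundVar b), ∀ s', I s' → I (c.run (s'.setVar x i)) ∧
      ((c.run (s'.setVar x i)).var 5 ≠ 0 → s'.var 5 ≠ 0 ∨ Q) ∧
      (s'.var 5 ≠ 0 ∨ T i → (c.run (s'.setVar x i)).var 5 ≠ 0)) :
    I ((loop b x c).run s) ∧ (((loop b x c).run s).var 5 ≠ 0 → s.var 5 ≠ 0 ∨ Q) ∧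
      (s.var 5 ≠ 0 ∨ (∃ i < s.var (boundVar b), T i) → ((loop b x c).run s).var 5 ≠ 0) := by
  have := run_loop_induct (b := b) (x := x) (c := c) (s := s)
    (I := fun i s' => I s' ∧ (s'.var 5 ≠ 0 → s.var 5 ≠ 0 ∨ Q) ∧
      (s.var 5 ≠ 0 ∨ (∃ j < i, T j) → s'.var 5 ≠ 0))
    ⟨h0, .inl, by rintro (h | ⟨j, hj, -⟩); exacts [h, absurd hj (by omega)]⟩ ?_
  · exact this
  rintro i hi s' ⟨h1, h2, h3⟩
  obtain ⟨k1, k2, k3⟩ := h i hi s' h1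
  refine ⟨k1, fun h' => ?_, ?_⟩
  · rcases k2 h' with h' | h'
    exacts [h2 h', .inr h']
  · rintro (h' | ⟨j, hj, hT⟩)
    · exact k3 (.inl (h3 (.inl h')))
    · rcases Nat.lt_succ_iff_lt_or_eq.1 hj with hj | rfl
      · exact k3 (.inl (h3 (.inr ⟨j, hj, hT⟩)))
      · exact k3 (.inr hT)

/-- This holds for every content of array `2`, so superfluous or misguided steps do no harm. -/
theorem run_stepCmd_flag (h : IsReady E N M k₁ k₂ s) (h6 : s.var 6 = r)
    (hM : 2 * k₂ + 2 * k₁ * (4 * k₁ + 1) ≤ M) :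
    ((stepCmd.run s).var 5 ≠ 0 → s.var 5 ≠ 0 ∨ HasPair E k₁ k₂) ∧
      (s.var 5 ≠ 0 → (stepCmd.run s).var 5 ≠ 0) := by
  rcases run_stepCmd h.1 h.2 h.3 h.4 h.5 h6 rfl with ⟨h5, -⟩ | ⟨hl, h5, -⟩
  · rw [h5]; exact ⟨.inl, id⟩
  · rw [h5]; exact ⟨Or.imp_right (Accepts.hasPair hM hl), .inl⟩

theorem run_trialCmd (h : IsReady E N M k₁ k₂ s) (h6 : s.var 6 = r) (h12 : s.var 12 ≤ N)
    (hM : 2 * k₂ + 2 * k₁ * (4 * k₁ + 1) ≤ M) (hM0 : 0 < M) (hkN : k₁ ≤ N) :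
    (IsReady E N M k₁ k₂ (trialCmd.run s) ∧ (trialCmd.run s).var 6 = r) ∧
      ((trialCmd.run s).var 5 ≠ 0 → s.var 5 ≠ 0 ∨ HasPair E k₁ k₂) ∧
      (s.var 5 ≠ 0 ∨ (∃ m < k₁, Guided E N M k₁ k₂ r m {r} (s.var 12)) →
        (trialCmd.run s).var 5 ≠ 0) := by
  rw [trialCmd, run_seq, run_seq]
  set s1 := (fill true 2 16 (.eq (.var 16) (.var 6))).run ((assign 7 (.var 12)).run s) with hs1
  have hr1 : IsReady E N M k₁ k₂ s1 :=
    ⟨h.1.congr rfl rfl rfl rfl, h.2, h.3, h.4, h.5⟩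
  have h61 : s1.var 6 = r := h6
  have h51 : s1.var 5 = s.var 5 := rfl
  have h71 : s1.var 7 = s.var 12 := rfl
  have h21 : s1.set n 2 = {r} := by
    rw [hs1, set_run_fill (by simpa [run] using h.1.var_one)]
    ext v
    simp [run, h6, Fin.ext_iff]
  have base := run_loop_flag (s := s1) (b := false) (x := 13) (c := stepCmd)
    (I := fun s' => IsReady E N M k₁ k₂ s' ∧ s'.var 6 = r) (Q := HasPair E k₁ k₂)
    (T := fun _ => False) ⟨hr1, h61⟩ (by
      rintro i - s' ⟨k1, k2⟩
      have k1' := k1.setVar (x := 13) (by omega) i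
      obtain ⟨k3, k4⟩ := run_stepCmd_flag k1' (r := r) (by simpa using k2) hM
      refine ⟨⟨k1'.run_stepCmd, (stepCmd.run_var _ (by decide)).trans (by simpa using k2)⟩,
        fun h' => by simpa using k3 h', fun h' => k4 (by simpa using h')⟩)
  refine ⟨base.1, base.2.1, ?_⟩
  rintro (h' | ⟨m₀, hm₀, hG⟩)
  · exact base.2.2 (.inl h')
  -- As long as the flag is not raised, the remaining digits guide a search with m + i < k₁. After
  -- all N ≥ k₁ rounds this is impossible.
  have key := run_loop_induct (s := s1) (b := false) (x := 13) (c := stepCmd)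
    (I := fun i s' => (IsReady E N M k₁ k₂ s' ∧ s'.var 6 = r) ∧ (s'.var 5 ≠ 0 ∨
      ∃ m, m + i < k₁ ∧ s'.var 7 ≤ N ∧ Guided E N M k₁ k₂ r m (s'.set n 2) (s'.var 7)))
    ⟨⟨hr1, h61⟩, .inr ⟨m₀, hm₀, h71 ▸ h12, by rwa [h21, h71]⟩⟩ ?_
  · rcases key.2 with h' | ⟨m, hm, -⟩
    · exact h'
    · have : s1.var (boundVar false) = N := hr1.2
      omega
  rintro i - s' ⟨⟨k1, k2⟩, k3⟩
  have k1' := k1.setVar (x := 13) (by omega) i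
  have k2' : (s'.setVar 13 i).var 6 = r := by simpa using k2
  refine ⟨⟨k1'.run_stepCmd, (stepCmd.run_var _ (by decide)).trans k2'⟩, ?_⟩
  rcases k3 with k3 | ⟨m, hm, h7, hG⟩
  · exact .inl ((run_stepCmd_flag k1' k2' hM).2 (by simpa using k3))
  have hf : ∃ l < N, k₂ ≤ (core E (s'.set n 2)ᶜ l).ncard := by
    cases m <;> exact hG.1
  rcases run_stepCmd k1'.1 k1'.2 k1'.3 k1'.4 k1'.5 k2' rfl with ⟨-, hno⟩ | ⟨-, k5, k7⟩
  · obtain ⟨l, hl, hl'⟩ := hf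
    exact absurd (hno l hl) (not_lt.2 hl')
  by_cases hA : Accepts E N M k₁ k₂ r (s'.set n 2)
  · exact .inl (k5.2 (.inr hA))
  obtain - | m := m
  · exact absurd hG.2 hA
  obtain ⟨v, hv, hrank, hG⟩ := hG.2.resolve_left hA
  obtain ⟨k8, k9⟩ := k7 (by simpa using h7) hM0
  have h7' : (s'.setVar 13 i).var 7 = s'.var 7 := by simp
  rw [h7'] at k8 k9
  refine .inr ⟨m, by omega, ?_, ?_⟩
  · rw [k9]; exact (Nat.div_le_self _ _).trans h7
  · rw [k9, k8]
    -- Ranks of candidates are distinct, so the digit selects only the vertex v.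
    convert hG using 2
    rw [Set.insert_eq, Set.union_comm, Store.set_setVar]
    congr 1
    ext w
    simp only [Set.mem_ofPred_eq, Set.mem_singleton_iff]
    constructor
    · rintro ⟨hw, hw'⟩
      exact rank_inj hw hv (hw'.trans hrank.symm)
    · rintro rfl
      exact ⟨hv, hrank⟩

/-- For `k₁ = 0` the connected part may be empty and offers no root, so this case is answered at
once by comparing `k₂` with `n`. Otherwise all roots and all σ < `N` are tried. -/
theorem run_mainCmd (h0 : s.var 0 = N) (h1 : s.var 1 = n) (hnN : n < N)
    (hadj : ∀ u v : Fin n, s.arr 0 (3 + (u * n + v)) ≠ 0 ↔ E u v)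
    (h2 : s.var 2 = k₁) (h3 : s.var 3 = k₂) (h4 : s.var 4 = M)
    (hM : 2 * k₂ + 2 * k₁ * (4 * k₁ + 1) ≤ M) (hM0 : 0 < M) (hMN : M ^ k₁ ≤ N) (hkN : k₁ ≤ N) :
    ((mainCmd.run s).var 5 ≠ 0 → (k₁ = 0 ∧ k₂ ≤ n) ∨ HasPair E k₁ k₂) ∧
      ((k₁ = 0 ∧ k₂ ≤ n) ∨ (0 < k₁ ∧ HasPair E k₁ k₂) → (mainCmd.run s).var 5 ≠ 0) := by
  rw [mainCmd, run_seq, run_seq]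
  set s1 := (fill false 1 16 (.mul (.var 16) (.var 1))).run s with hs1
  have hI : s1.HasInput n E := by
    refine ⟨h1, ?_, fun u v => ?_⟩
    · change n ≤ s.var 0
      omega
    · have hu : s1.arr 1 u = u * n := by
        have : (u : ℕ) < s.var 0 := by omega
        rw [hs1, run]
        simp only [Store.setArray_arr, if_true, boundVar, Bool.false_eq_true, if_false, this]
        rw [Term.eval_mul (fun j => by simp) (fun j => by simp) (by simp; omega)]
        simp [h1]
      rw [hu, ← hadj u v]
      rfl
  set s2 := (assign 5 (.and (.not (.var 2)) (.not (.lt (.var 1) (.var 3))))).run s1 with hs2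
  have hr2 : IsReady E N M k₁ k₂ s2 :=
    ⟨hI.congr rfl rfl rfl rfl, h0, h2, h3, h4⟩
  have h52 : s2.var 5 ≠ 0 ↔ k₁ = 0 ∧ k₂ ≤ n := by
    have v1 : s1.var 1 = n := h1
    have v2 : s1.var 2 = k₁ := h2
    have v3 : s1.var 3 = k₂ := h3
    have : s2.var 5 ≠ 0 ↔
        Term.Holds s1 (.and (.not (.var 2)) (.not (.lt (.var 1) (.var 3)))) := by
      rw [hs2, run, Store.setVar_var, if_pos rfl, Term.Holds]
    rw [this, Term.holds_and, Term.holds_not, Term.holds_not, Term.holds_lt, Term.holds_var]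
    simp [v1, v2, v3]
  have outer := run_loop_flag (s := s2) (b := true) (x := 6) (c := loop false 12 trialCmd)
    (I := IsReady E N M k₁ k₂) (Q := HasPair E k₁ k₂)
    (T := fun i => ∃ r : Fin n, i = r ∧ ∃ σ < N, ∃ m < k₁, Guided E N M k₁ k₂ r m {r} σ) hr2 (by
      intro i hi s' hs'
      rw [boundVar, if_pos rfl, hr2.1.var_one] at hi
      obtain ⟨r, rfl⟩ : ∃ r : Fin n, i = r := ⟨⟨i, hi⟩, rfl⟩
      have hs6 := hs'.setVar (x := 6) (by omega) r
      obtain ⟨k1, k2, k3⟩ := run_loop_flag (s := s'.setVar 6 r) (b := false) (x := 12)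
        (c := trialCmd)
        (I := fun s' => IsReady E N M k₁ k₂ s' ∧ s'.var 6 = r) (Q := HasPair E k₁ k₂)
        (T := fun σ => ∃ m < k₁, Guided E N M k₁ k₂ r m {r} σ) ⟨hs6, by simp⟩ (by
          rintro σ hσ t ⟨ht, ht6⟩
          rw [boundVar, if_neg (by simp), hs6.2] at hσ
          obtain ⟨j1, j2, j3⟩ := run_trialCmd (ht.setVar (x := 12) (by omega) σ) (r := r)
            (by simpa using ht6) (by simpa using hσ.le) hM hM0 hkN
          exact ⟨j1, fun h' => by simpa using j2 h', fun h' => j3 (by simpa using h')⟩)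
      refine ⟨k1.1, fun h' => by simpa using k2 h', fun h' => k3 ?_⟩
      refine h'.imp (fun h' => by simpa using h') ?_
      rintro ⟨r', hr', σ, hσ, hT⟩
      obtain rfl := Fin.ext hr'
      exact ⟨σ, by rw [boundVar, if_neg (by simp), hs6.2]; exact hσ, hT⟩)
  rw [h52] at outer
  refine ⟨outer.2.1, fun h' => outer.2.2 (h'.imp id ?_)⟩
  rintro ⟨hk, hP⟩
  obtain ⟨X, r, hr, hX, hX1, hX2⟩ := hP.exists_ncard_eq (l := n) hk (by simp)
  have hm : (X \ {r}).ncard = k₁ - 1 := by rw [Set.ncard_sdiff_singleton_of_mem hr, hX1]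
  obtain ⟨σ, hσ, hG⟩ := exists_guided hX hX1.ge hr hnN hX2 hM0 (Set.mem_singleton r)
    (Set.singleton_subset_iff.2 hr) hm
  -- It takes k₁ - 1 extensions to get from {r} to X, so σ < M ^ (k₁ - 1) ≤ N.
  refine ⟨r, ?_, r, rfl, σ, ?_, k₁ - 1, by omega, hG⟩
  · rw [boundVar, if_pos rfl, hr2.1.var_one]; exact r.2
  · exact hσ.trans_le ((Nat.pow_le_pow_right hM0 (by omega)).trans hMN)

end ConnIn

/-! ### Computing the parameters of the search. -/

namespace RAM

/-- The program that doubles the variable `x` as often as the variable `t` says. -/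
def doubleLoop (x t : ℕ) : Program :=
  .while (.var t) (.seq (.assign x (.plus (.var x) (.var x))) (.assign t (.minus (.var t) (.lit 1))))

theorem exec_doubleLoop {x t : ℕ} (hxt : x ≠ t) {m : ℕ} {s : Store} (hs : s.var t = m) :
    Exec (doubleLoop x t) s ((s.setVar x (s.var x * 2 ^ m)).setVar t 0) (m * 10 + 2) := by
  induction m generalizing s with
  | zero =>
    have h : (s.setVar x (s.var x * 2 ^ 0)).setVar t 0 = s := by
      ext y i
      · simp only [Store.setVar_var]
        split_ifs with h1 h2 <;> simp_all
      · rfl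
    rw [h]
    exact Exec.while_false (e := .var t) hs
  | succ m ih =>
    set s₁ := s.setVar x (s.var x + s.var x) with hs₁
    have h := ih (s := s₁.setVar t m) (by simp)
    have hfin : ((s₁.setVar t m).setVar x ((s₁.setVar t m).var x * 2 ^ m)).setVar t 0 =
        (s.setVar x (s.var x * 2 ^ (m + 1))).setVar t 0 := by
      ext y i
      · simp only [hs₁, Store.setVar_var, if_neg hxt, if_true]
        split_ifs
        · rfl
        · ring
        · rfl
      · rfl
    rw [hfin] at h
    have e₁ : Exec (.assign x (.plus (.var x) (.var x))) s s₁ 4 := Exec.assign x _ s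
    have e₂ : Exec (.assign t (.minus (.var t) (.lit 1))) s₁ (s₁.setVar t m) 4 := by
      have := Exec.assign t (.minus (.var t) (.lit 1)) s₁
      simpa [Expr.eval, Expr.cost, hs₁, hxt.symm, hs] using this
    rw [show (m + 1) * 10 + 2 = (Expr.var t).cost + 1 + (4 + 4) + (m * 10 + 2) by
      rw [Expr.cost]; ring]
    exact Exec.while_true (by simp [Expr.eval, hs]) (e₁.seq e₂) h

/-- The program that reads the input and computes the parameters of the search. -/
def setupProgram : Program :=
  .seq (.assign 1 (.read 0 (.lit 0))) (.seq (.assign 2 (.read 0 (.lit 1)))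
    (.seq (.assign 3 (.read 0 (.lit 2))) (.seq (.assign 4 (.lit 1))
      (.seq (.assign 30 (.plus (.plus (.var 2) (.var 3)) (.lit 6))) (.seq (doubleLoop 4 30)
        (.seq (.assign 31 (.lit 1)) (.seq (.assign 30 (.var 4)) (.seq (doubleLoop 31 30)
          (.assign 0 (.plus (.var 0) (.var 31)))))))))))

/-- Doubling `m` times gives M = 2 ^ m in variable `4`; doubling M times gives the double power that
makes variable `0` large enough to count all sequences of choices. -/
theorem exec_setupProgram {s : Store} {m : ℕ} (hm : m = s.arr 0 1 + s.arr 0 2 + 6) :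
    ∃ s', Exec setupProgram s s' (10 * m + 10 * 2 ^ m + 29) ∧ s'.arr = s.arr ∧
      s'.var 0 = s.var 0 + 2 ^ 2 ^ m ∧ s'.var 1 = s.arr 0 0 ∧ s'.var 2 = s.arr 0 1 ∧
      s'.var 3 = s.arr 0 2 ∧ s'.var 4 = 2 ^ m := by
  have e1 := Exec.assign 1 (.read 0 (.lit 0)) s
  set s1 := s.setVar 1 (Expr.eval s (.read 0 (.lit 0))) with hs1
  have e2 := Exec.assign 2 (.read 0 (.lit 1)) s1
  set s2 := s1.setVar 2 (Expr.eval s1 (.read 0 (.lit 1))) with hs2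
  have e3 := Exec.assign 3 (.read 0 (.lit 2)) s2
  set s3 := s2.setVar 3 (Expr.eval s2 (.read 0 (.lit 2))) with hs3
  have e4 := Exec.assign 4 (.lit 1) s3
  set s4 := s3.setVar 4 (Expr.eval s3 (.lit 1)) with hs4
  have e5 := Exec.assign 30 (.plus (.plus (.var 2) (.var 3)) (.lit 6)) s4
  set s5 := s4.setVar 30 (Expr.eval s4 (.plus (.plus (.var 2) (.var 3)) (.lit 6))) with hs5
  have e6 := exec_doubleLoop (x := 4) (t := 30) (by omega) (s := s5) (m := m)
    (by simp [hm, hs1, hs2, hs3, hs4, hs5, Expr.eval])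
  set s6 := (s5.setVar 4 (s5.var 4 * 2 ^ m)).setVar 30 0 with hs6
  have e7 := Exec.assign 31 (.lit 1) s6
  set s7 := s6.setVar 31 (Expr.eval s6 (.lit 1)) with hs7
  have e8 := Exec.assign 30 (.var 4) s7
  set s8 := s7.setVar 30 (Expr.eval s7 (.var 4)) with hs8
  have e9 := exec_doubleLoop (x := 31) (t := 30) (by omega) (s := s8) (m := 2 ^ m)
    (by simp [hs4, hs5, hs6, hs7, hs8, Expr.eval])
  set s9 := (s8.setVar 31 (s8.var 31 * 2 ^ 2 ^ m)).setVar 30 0 with hs9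
  have e10 := Exec.assign 0 (.plus (.var 0) (.var 31)) s9
  refine ⟨s9.setVar 0 (Expr.eval s9 (.plus (.var 0) (.var 31))), ?_, ?_⟩
  · have e := e1.seq (e2.seq (e3.seq (e4.seq (e5.seq (e6.seq (e7.seq (e8.seq (e9.seq e10))))))))
    simp only [Expr.cost] at e
    refine cast (congrArg (Exec _ _ _) ?_) e
    ring
  · refine ⟨rfl, ?_, ?_, ?_, ?_, ?_⟩ <;>
      simp [hs1, hs2, hs3, hs4, hs5, hs6, hs7, hs8, hs9, Expr.eval]

end RAM

/-! ### The whole program and its running time. -/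

namespace ConnIn

open RAM

/-- With `s` = k₁ + k₂ and M = 2 ^ (s + 6), this yields both 2k₂ + 2k₁(4k₁ + 1) ≤ M and (s + 6)k₁ ≤
M; the latter says that M ^ k₁ ≤ 2 ^ M. -/
theorem sq_add_le (s : ℕ) : s * s + 4 * s + 6 ≤ 6 * 2 ^ s := by
  induction s with
  | zero => simp
  | succ s ih => rw [pow_succ]; nlinarith

theorem computable_bound (C e : ℕ) : Computable fun k : ℕ =>
    51 * 2 ^ 2 ^ (2 * k + 6) + C * (2 ^ 2 ^ (2 * k + 6) + 2) ^ e := by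
  have hpow : Primrec₂ ((· ^ ·) : ℕ → ℕ → ℕ) := Primrec₂.unpaired'.1 Nat.Primrec.pow
  have hG : Primrec fun k : ℕ => 2 ^ 2 ^ (2 * k + 6) :=
    hpow.comp (.const 2) (hpow.comp (.const 2) (Primrec.nat_add.comp
      (Primrec.nat_mul.comp (.const 2) .id) (.const 6)))
  exact (Primrec.nat_add.comp (Primrec.nat_mul.comp (.const 51) hG) (Primrec.nat_mul.comp (.const C)
    (hpow.comp (Primrec.nat_add.comp hG (.const 2)) (.const e)))).to_comp

/-- The program that decides the partition problem. -/
def partitionProgram : Program :=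
  .seq setupProgram (.seq (mainCmd.compile 30 30) (.assign 0 (.var 5)))

theorem exists_exec_partitionProgram {C e : ℕ} (hC : ∀ m, mainCmd.cost m ≤ C * (m + 1) ^ e)
    {n k₁ k₂ k : ℕ} {E : Fin n → Fin n → Prop} {s : Store} (hk₁ : k₁ ≤ k) (hk₂ : k₂ ≤ k)
    (h0 : s.var 0 = n * n + 3) (hn : s.arr 0 0 = n) (h1 : s.arr 0 1 = k₁) (h2 : s.arr 0 2 = k₂)
    (hadj : ∀ u v : Fin n, s.arr 0 (3 + (u * n + v)) ≠ 0 ↔ E u v) :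
    ∃ s' t, Exec partitionProgram s s' t ∧
      t ≤ (51 * 2 ^ 2 ^ (2 * k + 6) + C * (2 ^ 2 ^ (2 * k + 6) + 2) ^ e) * (n * n + 3) ^ e ∧
      (s'.var 0 ≠ 0 → (k₁ = 0 ∧ k₂ ≤ n) ∨ HasPair E k₁ k₂) ∧
      ((k₁ = 0 ∧ k₂ ≤ n) ∨ (0 < k₁ ∧ HasPair E k₁ k₂) → s'.var 0 ≠ 0) := by
  obtain ⟨m, hm⟩ : ∃ m, m = k₁ + k₂ + 6 := ⟨_, rfl⟩
  obtain ⟨s1, e1, a1, v0, v1, v2, v3, v4⟩ := exec_setupProgram (s := s) (m := m) (by rw [h1, h2, hm])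
  rw [h0] at v0
  rw [hn] at v1
  rw [h1] at v2
  rw [h2] at v3
  obtain ⟨s2, τ, e2, ht, ag, -⟩ := mainCmd.exec_compile (by omega) mainCmd_wf 30 le_rfl (s := s1)
    (s₀ := s1) ⟨fun _ _ => rfl, fun _ _ => rfl⟩
  have hmm : m < 2 ^ m := Nat.lt_two_pow_self
  have hmG : 2 ^ m < 2 ^ 2 ^ m := Nat.lt_two_pow_self
  have hmM : 2 ^ m = 64 * 2 ^ (k₁ + k₂) := by rw [hm, pow_add]; ring
  have hsq := sq_add_le (k₁ + k₂)
  have hnn : n ≤ n * n := Nat.le_mul_self n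
  obtain ⟨hs, hc⟩ := run_mainCmd (E := E) v0 v1 (by omega)
    (fun u v => by rw [a1]; exact hadj u v) v2 v3 v4 (by rw [hmM]; nlinarith) (by positivity)
    (by
      rw [← pow_mul]
      refine (Nat.pow_le_pow_right (by omega) ?_).trans (Nat.le_add_left _ _)
      rw [hmM, hm]
      nlinarith) (by omega)
  have h5 : (s2.setVar 0 (Expr.eval s2 (.var 5))).var 0 = (mainCmd.run s1).var 5 := by
    simp [Expr.eval, ag.1 5]
  refine ⟨_, _, e1.seq (e2.seq (.assign 0 (.var 5) _)), ?_, by rwa [h5], by rwa [h5]⟩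
  have hG : 2 ^ 2 ^ m ≤ 2 ^ 2 ^ (2 * k + 6) :=
    Nat.pow_le_pow_right (by omega) (Nat.pow_le_pow_right (by omega) (by omega))
  generalize 2 ^ 2 ^ (2 * k + 6) = G at hG
  generalize 2 ^ 2 ^ m = G₀ at *
  -- Parameter and size are separated by (n² + 3 + G₀) + n + 1 ≤ (G + 2)(n² + 3).
  have hτ : τ ≤ C * ((G + 2) ^ e * (n * n + 3) ^ e) := by
    refine (ht.trans (hC _)).trans ?_
    rw [← mul_pow, v0, v1]
    gcongr
    nlinarith [Nat.zero_le (G * (n * n))]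
  have hL : 1 ≤ (n * n + 3) ^ e := Nat.one_le_pow _ _ (by omega)
  -- The factor 51 is 10 + 10 + 31: both m and 2 ^ m are below G, and the constants add up to 31.
  calc 10 * m + 10 * 2 ^ m + 29 + (τ + (Expr.cost (.var 5) + 1)) ≤ 51 * G * 1 +
        C * ((G + 2) ^ e * (n * n + 3) ^ e) := by simp only [Expr.cost]; omega
    _ ≤ 51 * G * (n * n + 3) ^ e + C * ((G + 2) ^ e * (n * n + 3) ^ e) := by gcongr
    _ = _ := by ring

end ConnIn

namespace PartitionInstance

theorem length_encode (I : PartitionInstance) : I.encode.length = I.n * I.n + 3 := by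
  simp [encode]

theorem getD_encode (I : PartitionInstance) (u v : Fin I.n) :
    I.encode.getD (3 + (u * I.n + v)) 0 ≠ 0 ↔ I.D.Adj u v := by
  have hlt : (u : ℕ) * I.n + v < I.n * I.n := by
    have := Nat.mul_le_mul_right I.n (Nat.succ_le_of_lt u.2)
    have := v.2
    rw [Nat.succ_mul] at *
    omega
  have hpos : 0 < I.n := v.pos
  have hu : Fin.divNat ⟨u * I.n + v, hlt⟩ = u := by
    ext
    simp [Fin.coe_divNat, mul_comm, Nat.mul_add_div hpos, Nat.div_eq_of_lt v.2]
  have hv : Fin.modNat ⟨u * I.n + v, hlt⟩ = v := by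
    ext
    simp [Fin.coe_modNat, Nat.mod_eq_of_lt v.2]
  rw [add_comm 3]
  simp [encode, List.getD_eq_getElem?_getD, hlt, hu, hv]

end PartitionInstance

theorem theorem9 :
    connInPartitionProblem.IsFPTOn {I : PartitionInstance | 1 ≤ I.D.minInDegree} := by
  obtain ⟨C, e, hC⟩ := ConnIn.mainCmd.polyBounded_cost
  refine ⟨ConnIn.partitionProgram, _, e, ConnIn.computable_bound C e, fun I hI => ?_⟩
  obtain ⟨s, t, h1, h2, h3, h4⟩ := ConnIn.exists_exec_partitionProgram hC
    (s := RAM.Store.init I.encode) (E := I.D.Adj) (le_max_left I.k₁ I.k₂) (le_max_right I.k₁ I.k₂)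
    I.length_encode rfl rfl rfl I.getD_encode
  refine ⟨s, t, h1, h2.trans_eq (by rw [← I.length_encode]; rfl), ?_⟩
  constructor
  · intro h
    refine ConnIn.exists_isConnInPartition hI ?_
    rcases h3 h with ⟨hk₁, hk₂⟩ | h
    -- For k₁ = 0 the whole vertex set serves as second part, by the assumption on in-degrees.
    · refine ⟨∅, Set.univ, by simp, fun u hu => absurd hu (Set.notMem_empty u), by simp [hk₁], ?_,
        by simpa using hk₂⟩
      simpa using (ConnIn.one_le_minInDegree_iff I.D).1 hI
    · exact h
  · rintro ⟨V₁, V₂, h⟩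
    refine h4 ?_
    rcases Nat.eq_zero_or_pos I.k₁ with hk | hk
    · exact .inl ⟨hk, h.le_card_right.trans (by simpa using Finset.card_le_univ V₂)⟩
    · exact .inr ⟨hk, ConnIn.hasPair_of_isConnInPartition h⟩
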